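/- Let $\mathrm{sAlg}^{\mathrm{fd}}$ be the Morita bigroupoid whose objects are the finite-dimensional semisimple complex superalgebras ($\mathbb Z/2$-graded algebras), whose 1-morphisms $A\to B$ are the invertible $\mathbb Z/2$-graded $(B,A)$-bimodules, and whose 2-morphisms are the invertible even bimodule maps; the composite of $N_1\colon A\to B$ and $N_2\colon B\to C$ is $N_2\otimes_B N_1$. For a superalgebra $A$ let $\overline A^{\mathrm{op}}$ be the complex conjugate of its graded opposite, with product $\overline a^{\mathrm{op}}\,\overline b^{\mathrm{op}}=(-1)^{|a||b|}\,\overline{ba}^{\mathrm{op}}$. For a $(B,A)$-bimodule $M$ let $\overline M^{\mathrm{op}}$ be the conjugate opposite $(\overline A^{\mathrm{op}},\overline B^{\mathrm{op}})$-bimodule, with $\overline a^{\mathrm{op}}\,\overline m^{\mathrm{op}}=(-1)^{|a||m|}\,\overline{ma}^{\mathrm{op}}$ and $\overline m^{\mathrm{op}}\,\overline b^{\mathrm{op}}=(-1)^{|b||m|}\,\overline{bm}^{\mathrm{op}}$. A bimodule map $f$ induces $\overline f^{\mathrm{op}}$, the double conjugate opposite of an algebra or bimodule is identified with the algebra or bimodule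 itself, and $\overline{N\otimes_B M}^{\mathrm{op}}\cong\overline M^{\mathrm{op}}\otimes_{\overline B^{\mathrm{op}}}\overline N^{\mathrm{op}}$ by $\overline{n\otimes m}^{\mathrm{op}}\mapsto(-1)^{|m||n|}\,\overline m^{\mathrm{op}}\otimes\overline n^{\mathrm{op}}$. The bicategory $\mathrm{stAlg}$ of ($\mathbb C$-antilinear) stellar algebras is defined as follows. * Objects are triples $(A,M,\sigma)$ with $A$ a finite-dimensional semisimple complex superalgebra, $M$ an invertible $(A,\overline A^{\mathrm{op}})$-bimodule and $\sigma\colon M\to\overline M^{\mathrm{op}}$ an isomorphism of bimodules such that $\overline\sigma^{\mathrm{op}}\circ\sigma=\mathrm{id}_M$. * 1-morphisms $(A_1,M_1,\sigma_1)\to(A_2,M_2,\sigma_2)$ are pairs $(N,\phi)$ with $N$ an invertible $(A_2,A_1)$-bimodule and $\phi\colon N\otimes_{A_1}M_1\otimes_{\overline{A_1}^{\mathrm{op}}}\overline N^{\mathrm{op}}\to M_2$ an isomorphism of bimodules (a unitarity datum) such that $\sigma_2\circ\phi$ is equal to the composite $$N\otimes M_1\otimes\overline N^{\mathrm{op}}\xrightarrow{\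 \mathrm{id}\otimes\sigma_1\otimes\mathrm{id}\ }N\otimes\overline{M_1}^{\mathrm{op}}\otimes\overline N^{\mathrm{op}}\cong\overline{N\otimes M_1\otimes\overline N^{\mathrm{op}}}^{\mathrm{op}}\xrightarrow{\ \overline\phi^{\mathrm{op}}\ }\overline{M_2}^{\mathrm{op}}.$$ * 2-morphisms $(N,\phi)\to(N',\phi')$ are the invertible even bimodule maps $\psi\colon N\to N'$ such that $\phi'\circ(\psi\otimes\mathrm{id}_{M_1}\otimes\overline\psi^{\mathrm{op}})=\phi$. * The composite of $(N_1,\phi_1)$ and $(N_2,\phi_2)$ is $N_2\otimes N_1$ with the unitarity datum $(N_2\otimes N_1)\otimes M_1\otimes\overline{N_2\otimes N_1}^{\mathrm{op}}\cong N_2\otimes(N_1\otimes M_1\otimes\overline{N_1}^{\mathrm{op}})\otimes\overline{N_2}^{\mathrm{op}}\xrightarrow{\phi_1}N_2\otimes M_2\otimes\overline{N_2}^{\mathrm{op}}\xrightarrow{\phi_2}M_3$. The group $\mathbb Z_2^R=\{1,R\}$ acts on the bigroupoid $\mathrm{sAlg}^{\mathrm{fd}}$ by $\rho(R)\colon A\mapsto\overline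 A^{\mathrm{op}}$, $M\mapsto(\overline M^{\mathrm{op}})^{-1}$, on 2-morphisms by $f\mapsto$ the map of inverses which is induced by $(\overline f^{\mathrm{op}})^{-1}$, with the identification $\mathrm{id}\simeq\rho(R)\circ\rho(R)$ and the associativity modification that come from the canonical identification of the double conjugate opposite. Let $(\mathrm{sAlg}^{\mathrm{fd}})^{\mathbb Z_2^R}$ be the bicategory of homotopy fixed points of this action, with strict units: its objects are an object $A$, an invertible 1-morphism $m\colon\rho(R)(A)\to A$ and a 2-isomorphism between the composite $A\simeq\rho(R)^2(A)\xrightarrow{\rho(R)(m)}\rho(R)(A)\xrightarrow{m}A$ and $\mathrm{id}_A$, which satisfies the coherence condition for the triple $(R,R,R)$. Its 1-morphisms are 1-morphisms $f\colon A\to A'$ with a 2-isomorphism $f\circ m\cong m'\circ\rho(R)(f)$ which is compatible with these 2-isomorphisms, and its 2-morphisms are the 2-morphisms $f\to g$ which are compatible with these data. **Theorem.** The core of the bicategory $\mathrm{stAlg}$ of antilinear stellar algebras is equivalent, as a bicategory, to the bicategory $(\mathrm{sAlg}^{\mathrm{fd}})^{\mathbb Z_2^R}$ of homotopy $\mathbb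 Z_2^R$-fixed points in $\mathrm{sAlg}^{\mathrm{fd}}$ for the action $A\mapsto\overline A^{\mathrm{op}}$. -/

import Mathlib

open CategoryTheory Bicategory MulOpposite

universe u w v u' w' v'

section

open scoped TensorProduct


/-- A `ℤ/2`-grading `V = V₀ ⊕ V₁` of an abelian group. -/
class Z2Graded (V : Type*) [AddCommGroup V] where
  gr : ZMod 2 → AddSubgroup V
  isInternal : DirectSum.IsInternal gr

namespace Z2Graded
variable {V : Type*} [AddCommGroup V] [Z2Graded V]

noncomputable instance : DirectSum.Decomposition (gr (V := V)) :=
  isInternal.chooseDecomposition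

/-- The component of degree `i` of a vector. -/
noncomputable def comp (i : ZMod 2) : V →+ V :=
  ((gr (V := V) i).subtype.comp (DFinsupp.evalAddMonoidHom i)).comp
    (DirectSum.decomposeAddEquiv (gr (V := V))).toAddMonoidHom

theorem comp_mem (i : ZMod 2) (v : V) : comp i v ∈ gr (V := V) i := by
  exact SetLike.coe_mem _

theorem comp_same {i : ZMod 2} {v : V} (h : v ∈ gr (V := V) i) : comp i v = v :=
  DirectSum.decompose_of_mem_same _ h

theorem comp_ne {i j : ZMod 2} {v : V} (h : v ∈ gr (V := V) i) (hij : i ≠ j) : comp j v = 0 :=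
  DirectSum.decompose_of_mem_ne _ h hij

theorem ind {p : V → Prop} (hom : ∀ i, ∀ v ∈ gr (V := V) i, p v)
    (add : ∀ v w, p v → p w → p (v + w)) (v : V) : p v := by
  induction v using DirectSum.Decomposition.inductionOn (gr (V := V)) with
  | zero => exact hom 0 0 (zero_mem _)
  | homogeneous m => exact hom _ _ m.2
  | add m m' h h' => exact add _ _ h h'

theorem cases2 {p : ZMod 2 → Prop} (h0 : p 0) (h1 : p 1) (i : ZMod 2) : p i := by
  have : i = 0 ∨ i = 1 := by revert i; decide
  rcases this with rfl | rfl
  exacts [h0, h1]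

theorem comp_zero_add_comp_one (v : V) : comp 0 v + comp 1 v = v := by
  induction v using ind with
  | hom i v h =>
    induction i using cases2 with
    | h0 => rw [comp_same h, comp_ne h zero_ne_one, add_zero]
    | h1 => rw [comp_same h, comp_ne h one_ne_zero, zero_add]
  | add v w hv hw =>
    rw [map_add, map_add, add_add_add_comm, hv, hw]

theorem mem_zero_iff (v : V) : v ∈ gr (V := V) 0 ↔ comp 0 v = v :=
  ⟨comp_same, fun h => h ▸ comp_mem 0 v⟩

theorem mem_one_iff (v : V) : v ∈ gr (V := V) 1 ↔ comp 0 v = 0 :=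
  ⟨fun h => comp_ne h one_ne_zero, fun h => by
    have := comp_zero_add_comp_one v
    rw [h, zero_add] at this
    exact this ▸ comp_mem 1 v⟩

/-- The grading with even part `{v | p v = v}` and odd part `{v | p v = 0}` for a projection `p`. -/
@[reducible] def ofProj {V : Type*} [AddCommGroup V] (p : V →+ V) (hp : ∀ v, p (p v) = p v) : Z2Graded V where
  gr i := if i = 0 then (p - AddMonoidHom.id V).ker else p.ker
  isInternal := by
    set g : ZMod 2 → AddSubgroup V :=
      fun i => if i = 0 then (p - AddMonoidHom.id V).ker else p.ker with hg
    have h0 : g 0 = (p - AddMonoidHom.id V).ker := by simp [hg]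
    have h1 : g 1 = p.ker := by simp [hg]
    have m0 : ∀ v, v ∈ g 0 ↔ p v = v := fun v => by
      rw [h0, AddMonoidHom.mem_ker, AddMonoidHom.sub_apply, sub_eq_zero]; rfl
    have m1 : ∀ v, v ∈ g 1 ↔ p v = 0 := fun v => by rw [h1, AddMonoidHom.mem_ker]
    have key : ∀ x : DirectSum (ZMod 2) fun i => g i,
        DirectSum.coeAddMonoidHom g x = (x 0 : V) + (x 1 : V) := by
      intro x
      induction x using DirectSum.induction_on with
      | zero => simp
      | of i y =>
        rw [DirectSum.coeAddMonoidHom_of]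
        induction i using cases2 with
        | h0 => rw [DirectSum.of_eq_same, DirectSum.of_eq_of_ne _ _ _ one_ne_zero]; simp
        | h1 => rw [DirectSum.of_eq_same, DirectSum.of_eq_of_ne _ _ _ zero_ne_one]; simp
      | add x y hx hy =>
        rw [map_add, hx, hy, DirectSum.add_apply, DirectSum.add_apply, AddSubgroup.coe_add,
          AddSubgroup.coe_add, add_add_add_comm]
    constructor
    · refine (injective_iff_map_eq_zero _).2 fun x hx => ?_
      rw [key] at hx
      have hx0 : (x 0 : V) = 0 := by
        have := congrArg p hx
        rwa [map_add, (m0 _).1 (x 0).2, (m1 _).1 (x 1).2, add_zero, map_zero] at this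
      have hx1 : (x 1 : V) = 0 := by rwa [hx0, zero_add] at hx
      refine DFinsupp.ext fun i => ?_
      induction i using cases2 with
      | h0 => exact Subtype.ext hx0
      | h1 => exact Subtype.ext hx1
    · intro v
      refine ⟨DirectSum.of (fun i => g i) 0 ⟨p v, (m0 _).2 (hp v)⟩ +
        DirectSum.of (fun i => g i) 1 ⟨v - p v, (m1 _).2 (by rw [map_sub, hp, sub_self])⟩, ?_⟩
      rw [map_add, DirectSum.coeAddMonoidHom_of, DirectSum.coeAddMonoidHom_of]
      simp

theorem mem_ofProj_zero {V : Type*} [AddCommGroup V] (p : V →+ V) (hp : ∀ v, p (p v) = p v)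
    (v : V) : v ∈ (ofProj p hp).gr 0 ↔ p v = v := by
  change v ∈ (if (0 : ZMod 2) = 0 then (p - AddMonoidHom.id V).ker else p.ker) ↔ _
  rw [if_pos rfl, AddMonoidHom.mem_ker, AddMonoidHom.sub_apply, sub_eq_zero]; rfl

theorem mem_ofProj_one {V : Type*} [AddCommGroup V] (p : V →+ V) (hp : ∀ v, p (p v) = p v)
    (v : V) : v ∈ (ofProj p hp).gr 1 ↔ p v = 0 := by
  change v ∈ (if (1 : ZMod 2) = 0 then (p - AddMonoidHom.id V).ker else p.ker) ↔ _
  rw [if_neg one_ne_zero, AddMonoidHom.mem_ker]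

end Z2Graded
open Z2Graded

/-- The Koszul sign `(-1)^{ij}`. -/
def ksign (i j : ZMod 2) : ℤ := if i = 1 ∧ j = 1 then -1 else 1

theorem ksign_comm (i j : ZMod 2) : ksign i j = ksign j i := by revert i j; decide
theorem ksign_add_left (i j k : ZMod 2) : ksign (i + j) k = ksign i k * ksign j k := by
  revert i j k; decide
theorem ksign_add_right (i j k : ZMod 2) : ksign k (i + j) = ksign k i * ksign k j := by
  revert i j k; decide
theorem ksign_sq (i j : ZMod 2) : ksign i j * ksign i j = 1 := by revert i j; decide
@[simp] theorem ksign_zero_left (j : ZMod 2) : ksign 0 j = 1 := by revert j; decide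
@[simp] theorem ksign_zero_right (j : ZMod 2) : ksign j 0 = 1 := by revert j; decide

section koszul
variable {V W X : Type*} [AddCommGroup V] [AddCommGroup W] [AddCommGroup X]
  [Z2Graded V] [Z2Graded W]

/-- The biadditive map which is `(v, w) ↦ (-1)^{|v||w|} f v w` on homogeneous elements. -/
noncomputable def koszul (f : V →+ W →+ X) : V →+ W →+ X :=
  f - 2 • (f.comp (comp 1)).compl₂ (comp 1)

theorem koszul_apply (f : V →+ W →+ X) {i j : ZMod 2} {v : V} {w : W} (hv : v ∈ gr (V := V) i)
    (hw : w ∈ gr (V := W) j) : koszul f v w = ksign i j • f v w := by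
  have : koszul f v w = f v w - 2 • f (comp 1 v) (comp 1 w) := rfl
  rw [this]
  induction i using cases2 with
  | h0 => rw [comp_ne hv zero_ne_one]; simp
  | h1 =>
    induction j using cases2 with
    | h0 => rw [comp_ne hw zero_ne_one]; simp
    | h1 =>
      rw [comp_same hv, comp_same hw]
      have : ksign 1 1 = -1 := by decide
      rw [this, neg_one_zsmul, two_nsmul]; abel

end koszul

/-- The tensor product `N ⊗_B M` of a right and a left module over a (noncommutative) ring `B`. -/
def BTensor (B N M : Type*) [Ring B] [AddCommGroup N] [Module Bᵐᵒᵖ N] [AddCommGroup M]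
    [Module B M] : Type _ :=
  (N ⊗[ℤ] M) ⧸ AddSubgroup.closure
    {t : N ⊗[ℤ] M | ∃ (n : N) (b : B) (m : M), t = (op b • n) ⊗ₜ m - n ⊗ₜ (b • m)}

namespace BTensor
variable {B N M : Type*} [Ring B] [AddCommGroup N] [Module Bᵐᵒᵖ N] [AddCommGroup M] [Module B M]

instance : AddCommGroup (BTensor B N M) := by unfold BTensor; infer_instance

/-- The pure tensors. -/
def tmul : N →+ M →+ BTensor B N M :=
  AddMonoidHom.mk' (fun n => AddMonoidHom.mk' (fun m => QuotientAddGroup.mk (n ⊗ₜ[ℤ] m))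
    fun m m' => by rw [TensorProduct.tmul_add]; rfl)
    fun n n' => by ext m; change QuotientAddGroup.mk _ = _; rw [TensorProduct.add_tmul]; rfl

theorem tmul_smul (n : N) (b : B) (m : M) :
    (tmul (op b • n) m : BTensor B N M) = tmul n (b • m) := by
  refine (QuotientAddGroup.eq_iff_sub_mem).2 (AddSubgroup.subset_closure ⟨n, b, m, rfl⟩)

theorem ind {p : BTensor B N M → Prop} (h : ∀ n m, p (tmul n m))
    (add : ∀ x y, p x → p y → p (x + y)) (x : BTensor B N M) : p x := by
  induction x using QuotientAddGroup.induction_on with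
  | H x =>
    induction x using TensorProduct.induction_on with
    | zero => have := h 0 0; rwa [map_zero] at this
    | tmul n m => exact h n m
    | add x y hx hy => exact add _ _ hx hy

theorem hom_ext {P : Type*} [AddCommGroup P] {f g : BTensor B N M →+ P}
    (h : ∀ n m, f (tmul n m) = g (tmul n m)) : f = g := by
  ext x
  induction x using ind with
  | h n m => exact h n m
  | add x y hx hy => rw [map_add, map_add, hx, hy]

/-- The map out of the tensor product given by a balanced biadditive map. -/
def lift {P : Type*} [AddCommGroup P] (f : N →+ M →+ P)
    (hf : ∀ n (b : B) m, f (op b • n) m = f n (b • m)) : BTensor B N M →+ P :=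
  QuotientAddGroup.lift _ (TensorProduct.liftAddHom f fun r n m => by
    rw [map_zsmul, map_zsmul, AddMonoidHom.smul_apply]) <| by
      rw [AddSubgroup.closure_le]
      rintro _ ⟨n, b, m, rfl⟩
      simp [hf]

@[simp] theorem lift_tmul {P : Type*} [AddCommGroup P] (f : N →+ M →+ P)
    (hf : ∀ n (b : B) m, f (op b • n) m = f n (b • m)) (n : N) (m : M) :
    lift f hf (tmul n m) = f n m := rfl

/-- Functoriality of the tensor product. -/
def map {N' M' : Type*} [AddCommGroup N'] [Module Bᵐᵒᵖ N'] [AddCommGroup M'] [Module B M']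
    (f : N →+ N') (g : M →+ M') (hf : ∀ (b : B) n, f (op b • n) = op b • f n)
    (hg : ∀ (b : B) m, g (b • m) = b • g m) : BTensor B N M →+ BTensor B N' M' :=
  lift ((tmul.comp f).compl₂ g) fun n b m => by
    change tmul (f _) (g _) = tmul (f _) (g _)
    rw [hf, hg, tmul_smul]

@[simp] theorem map_tmul {N' M' : Type*} [AddCommGroup N'] [Module Bᵐᵒᵖ N'] [AddCommGroup M']
    [Module B M'] (f : N →+ N') (g : M →+ M') (hf : ∀ (b : B) n, f (op b • n) = op b • f n)
    (hg : ∀ (b : B) m, g (b • m) = b • g m) (n : N) (m : M) :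
    map f g hf hg (tmul n m) = tmul (f n) (g m) := rfl

instance {C : Type*} [Ring C] [Module C N] [SMulCommClass C Bᵐᵒᵖ N] :
    Module C (BTensor B N M) where
  smul c := map (DistribSMul.toAddMonoidHom N c) (AddMonoidHom.id M)
    (fun b n => smul_comm c (op b) n) (fun _ _ => rfl)
  one_smul x := by
    induction x using ind with
    | h n m => exact congrArg (fun n => tmul n m) (one_smul C n)
    | add x y hx hy => exact (map_add _ _ _).trans (congrArg₂ _ hx hy)
  mul_smul c d x := by
    induction x using ind with
    | h n m => exact congrArg (fun n => tmul n m) (mul_smul c d n)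
    | add x y hx hy =>
      refine (map_add _ _ _).trans ((congrArg₂ _ hx hy).trans ?_)
      exact ((congrArg _ (map_add _ _ _)).trans (map_add _ _ _)).symm
  smul_zero c := map_zero _
  smul_add c := map_add _
  add_smul c d x := by
    induction x using ind with
    | h n m =>
      refine (congrArg (fun n => tmul n m) (add_smul c d n)).trans ?_
      exact congrArg (fun f : M →+ BTensor B N M => f m) (map_add tmul _ _)
    | add x y hx hy =>
      refine (map_add _ _ _).trans ((congrArg₂ _ hx hy).trans ((add_add_add_comm _ _ _ _).trans ?_))
      exact congrArg₂ _ (map_add _ _ _).symm (map_add _ _ _).symm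
  zero_smul x := by
    induction x using ind with
    | h n m =>
      refine (congrArg (fun n => tmul n m) (zero_smul C n)).trans ?_
      exact congrArg (fun f : M →+ BTensor B N M => f m) (map_zero tmul)
    | add x y hx hy =>
      exact (map_add _ _ _).trans ((congrArg₂ _ hx hy).trans (add_zero _))

theorem smul_tmul {C : Type*} [Ring C] [Module C N] [SMulCommClass C Bᵐᵒᵖ N] (c : C) (n : N)
    (m : M) : c • (tmul n m : BTensor B N M) = tmul (c • n) m := rfl

instance {A : Type*} [Ring A] [Module Aᵐᵒᵖ M] [SMulCommClass B Aᵐᵒᵖ M] :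
    Module Aᵐᵒᵖ (BTensor B N M) where
  smul c := map (AddMonoidHom.id N) (DistribSMul.toAddMonoidHom M c)
    (fun _ _ => rfl) (fun b m => (smul_comm b c m).symm)
  one_smul x := by
    induction x using ind with
    | h n m => exact congrArg (fun m => tmul n m) (one_smul Aᵐᵒᵖ m)
    | add x y hx hy => exact (map_add _ _ _).trans (congrArg₂ _ hx hy)
  mul_smul c d x := by
    induction x using ind with
    | h n m => exact congrArg (fun m => tmul n m) (mul_smul c d m)
    | add x y hx hy =>
      refine (map_add _ _ _).trans ((congrArg₂ _ hx hy).trans ?_)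
      exact ((congrArg _ (map_add _ _ _)).trans (map_add _ _ _)).symm
  smul_zero c := map_zero _
  smul_add c := map_add _
  add_smul c d x := by
    induction x using ind with
    | h n m =>
      refine (congrArg (fun m => tmul n m) (add_smul c d m)).trans ?_
      exact map_add (tmul n) _ _
    | add x y hx hy =>
      refine (map_add _ _ _).trans ((congrArg₂ _ hx hy).trans ((add_add_add_comm _ _ _ _).trans ?_))
      exact congrArg₂ _ (map_add _ _ _).symm (map_add _ _ _).symm
  zero_smul x := by
    induction x using ind with
    | h n m =>
      refine (congrArg (fun m => tmul n m) (zero_smul Aᵐᵒᵖ m)).trans ?_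
      exact map_zero (tmul n)
    | add x y hx hy =>
      exact (map_add _ _ _).trans ((congrArg₂ _ hx hy).trans (add_zero _))

theorem tmul_rsmul {A : Type*} [Ring A] [Module Aᵐᵒᵖ M] [SMulCommClass B Aᵐᵒᵖ M] (a : A) (n : N)
    (m : M) : op a • (tmul n m : BTensor B N M) = tmul n (op a • m) := rfl

instance {A C : Type*} [Ring A] [Ring C] [Module Aᵐᵒᵖ M] [SMulCommClass B Aᵐᵒᵖ M] [Module C N]
    [SMulCommClass C Bᵐᵒᵖ N] : SMulCommClass C Aᵐᵒᵖ (BTensor B N M) where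
  smul_comm c a x := by
    induction x using ind with
    | h n m => rfl
    | add x y hx hy => simp only [smul_add, hx, hy]

/-- The projection `n ⊗ m ↦ n₀ ⊗ m₀ + n₁ ⊗ m₁`, given that `B` is graded and acts compatibly. -/
noncomputable def proj [Z2Graded B] [Z2Graded N] [Z2Graded M]
    (hN : ∀ {i j} {b : B} {n : N}, b ∈ gr (V := B) i → n ∈ gr (V := N) j →
      op b • n ∈ gr (V := N) (i + j))
    (hM : ∀ {i j} {b : B} {m : M}, b ∈ gr (V := B) i → m ∈ gr (V := M) j →
      b • m ∈ gr (V := M) (i + j)) : BTensor B N M →+ BTensor B N M :=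
  lift ((tmul.comp (comp 0)).compl₂ (comp 0) + (tmul.comp (comp 1)).compl₂ (comp 1)) <| by
    intro n b m
    change tmul (comp 0 (op b • n)) (comp 0 m) + tmul (comp 1 (op b • n)) (comp 1 m) =
      tmul (comp 0 n) (comp 0 (b • m)) + tmul (comp 1 n) (comp 1 (b • m))
    induction n using Z2Graded.ind with
    | add v w hv hw =>
      simp only [smul_add, map_add, AddMonoidHom.add_apply] at hv hw ⊢
      rw [add_add_add_comm, hv, hw]; abel
    | hom i n hn =>
    induction b using Z2Graded.ind with
    | add v w hv hw =>
      simp only [MulOpposite.op_add, add_smul, map_add, AddMonoidHom.add_apply] at hv hw ⊢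
      rw [add_add_add_comm, hv, hw]; abel
    | hom j b hb =>
    induction m using Z2Graded.ind with
    | add v w hv hw =>
      simp only [smul_add, map_add, AddMonoidHom.add_apply] at hv hw ⊢
      rw [add_add_add_comm, hv, hw]; abel
    | hom k m hm =>
    have h1 := hN hb hn
    have h2 := hM hb hm
    have key : ∀ l, tmul (comp l (op b • n)) (comp l m) =
        (if l = k ∧ j + i = k then tmul n (b • m) else 0 : BTensor B N M) := by
      intro l
      split_ifs with h
      · obtain ⟨rfl, h⟩ := h
        rw [comp_same hm, comp_same (h ▸ h1), tmul_smul]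
      · by_cases hl : k = l
        · rw [comp_ne h1 fun hh => h ⟨hl.symm, hh.trans hl.symm⟩, map_zero,
            AddMonoidHom.zero_apply]
        · rw [comp_ne hm hl, map_zero]
    have key' : ∀ l, tmul (comp l n) (comp l (b • m)) =
        (if l = i ∧ j + k = i then tmul n (b • m) else 0 : BTensor B N M) := by
      intro l
      split_ifs with h
      · obtain ⟨rfl, h⟩ := h
        rw [comp_same hn, comp_same (h ▸ h2)]
      · by_cases hl : i = l
        · rw [comp_ne h2 fun hh => h ⟨hl.symm, hh.trans hl.symm⟩, map_zero]
        · rw [comp_ne hn hl, map_zero, AddMonoidHom.zero_apply]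
    rw [key, key, key', key']
    have : (if 0 = k ∧ j + i = k then (1 : ℤ) else 0) + (if 1 = k ∧ j + i = k then (1 : ℤ) else 0) =
      (if 0 = i ∧ j + k = i then (1 : ℤ) else 0) + (if 1 = i ∧ j + k = i then (1 : ℤ) else 0) := by
      clear * -
      revert i j k; decide
    have := congrArg (fun z : ℤ => z • (tmul n (b • m) : BTensor B N M)) this
    simpa only [add_smul, ite_smul, one_smul, zero_smul] using this

section graded
variable [Z2Graded B] [Z2Graded N] [Z2Graded M]
    (hN : ∀ {i j} {b : B} {n : N}, b ∈ gr (V := B) i → n ∈ gr (V := N) j →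
      op b • n ∈ gr (V := N) (i + j))
    (hM : ∀ {i j} {b : B} {m : M}, b ∈ gr (V := B) i → m ∈ gr (V := M) j →
      b • m ∈ gr (V := M) (i + j))

theorem proj_tmul (n : N) (m : M) : proj hN hM (tmul n m) =
    tmul (comp 0 n) (comp 0 m) + tmul (comp 1 n) (comp 1 m) := rfl

theorem proj_hom {i j : ZMod 2} {n : N} {m : M} (hn : n ∈ gr (V := N) i)
    (hm : m ∈ gr (V := M) j) :
    proj hN hM (tmul n m) = if i + j = 0 then tmul n m else 0 := by
  rw [proj_tmul]
  induction i using cases2 with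
  | h0 =>
    induction j using cases2 with
    | h0 => simp [comp_same hn, comp_same hm, comp_ne hm zero_ne_one]
    | h1 => simp [comp_ne hn zero_ne_one, comp_ne hm one_ne_zero]
  | h1 =>
    induction j using cases2 with
    | h0 => simp [comp_ne hn one_ne_zero, comp_ne hm zero_ne_one]
    | h1 =>
      rw [comp_same hn, comp_same hm, comp_ne hm one_ne_zero, map_zero, zero_add]
      rw [if_pos (by decide)]

/-- Homogeneous pure tensors span. -/
theorem ind_hom {p : BTensor B N M → Prop}
    (h : ∀ i j, ∀ n ∈ gr (V := N) i, ∀ m ∈ gr (V := M) j, p (tmul n m))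
    (add : ∀ x y, p x → p y → p (x + y)) (x : BTensor B N M) : p x := by
  induction x using ind with
  | add x y hx hy => exact add _ _ hx hy
  | h n m =>
  induction n using Z2Graded.ind with
  | add v w hv hw => rw [map_add]; exact add _ _ hv hw
  | hom i n hn =>
  induction m using Z2Graded.ind with
  | add v w hv hw => rw [map_add]; exact add _ _ hv hw
  | hom j m hm => exact h i j n hn m hm

/-- The grading of the tensor product, with `|n ⊗ m| = |n| + |m|`. -/
@[reducible] noncomputable def graded : Z2Graded (BTensor B N M) :=
  ofProj (proj hN hM) fun x => by
    induction x using ind_hom with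
    | add x y hx hy => simp only [map_add, hx, hy]
    | h i j n hn m hm =>
      rw [proj_hom hN hM hn hm]
      split_ifs with h
      · rw [proj_hom hN hM hn hm, if_pos h]
      · rw [map_zero]

theorem tmul_mem {i j : ZMod 2} {n : N} {m : M} (hn : n ∈ gr (V := N) i)
    (hm : m ∈ gr (V := M) j) : tmul n m ∈ (graded hN hM).gr (i + j) := by
  have h1 := proj_hom hN hM hn hm
  generalize hk : i + j = k at h1
  induction k using cases2 with
  | h0 => exact (mem_ofProj_zero _ _ _).2 (by rw [h1, if_pos rfl])
  | h1 => exact (mem_ofProj_one _ _ _).2 (by rw [h1, if_neg one_ne_zero])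

end graded
end BTensor

end

section

open scoped TensorProduct
open Z2Graded

/-- A complex superalgebra. -/
structure SAlg : Type (u + 1) where
  carrier : Type u
  [ring : Ring carrier]
  [algebra : Algebra ℂ carrier]
  [graded : Z2Graded carrier]
  algebraMap_mem : ∀ c : ℂ, algebraMap ℂ carrier c ∈ gr (V := carrier) 0
  mul_mem : ∀ {i j : ZMod 2} {a b : carrier}, a ∈ gr (V := carrier) i → b ∈ gr (V := carrier) j →
    a * b ∈ gr (V := carrier) (i + j)

instance : CoeSort SAlg.{u} (Type u) := ⟨SAlg.carrier⟩
attribute [instance] SAlg.ring SAlg.algebra SAlg.graded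

theorem SAlg.one_mem (A : SAlg.{u}) : (1 : A) ∈ gr (V := A) 0 := by
  have := A.algebraMap_mem 1
  rwa [map_one] at this

/-- A `(B, A)`-superbimodule over the complex superalgebras `B` and `A`. -/
structure SBimod (B A : SAlg.{u}) : Type (u + 1) where
  carrier : Type u
  [addCommGroup : AddCommGroup carrier]
  [left : Module B carrier]
  [right : Module Aᵐᵒᵖ carrier]
  [smulComm : SMulCommClass B Aᵐᵒᵖ carrier]
  [graded : Z2Graded carrier]
  central : ∀ (c : ℂ) (x : carrier), algebraMap ℂ B c • x = op (algebraMap ℂ A c) • x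
  left_mem : ∀ {i j : ZMod 2} {b : B} {x : carrier}, b ∈ gr (V := B) i → x ∈ gr (V := carrier) j →
    b • x ∈ gr (V := carrier) (i + j)
  right_mem : ∀ {i j : ZMod 2} {a : A} {x : carrier}, a ∈ gr (V := A) i → x ∈ gr (V := carrier) j →
    op a • x ∈ gr (V := carrier) (i + j)

namespace SBimod
variable {A B C E : SAlg.{u}}

instance : CoeSort (SBimod B A) (Type u) := ⟨SBimod.carrier⟩
attribute [instance] addCommGroup left right smulComm graded

/-- An even bimodule map. -/
@[ext] structure Hom (M N : SBimod B A) : Type u where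
  hom : M →+ N
  map_smul : ∀ (b : B) (x : M), hom (b • x) = b • hom x
  map_rsmul : ∀ (a : A) (x : M), hom (op a • x) = op a • hom x
  map_mem : ∀ {i : ZMod 2} {x : M}, x ∈ gr (V := M) i → hom x ∈ gr (V := N) i

instance : Category (SBimod B A) where
  Hom := Hom
  id M := ⟨AddMonoidHom.id M, fun _ _ => rfl, fun _ _ => rfl, fun h => h⟩
  comp f g := ⟨g.hom.comp f.hom, fun b x => by simp [f.map_smul, g.map_smul],
    fun a x => by simp [f.map_rsmul, g.map_rsmul], fun h => g.map_mem (f.map_mem h)⟩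

@[simp] theorem id_hom (M : SBimod B A) (x : M) : Hom.hom (𝟙 M) x = x := rfl
@[simp] theorem comp_hom {M N P : SBimod B A} (f : M ⟶ N) (g : N ⟶ P) (x : M) :
    (f ≫ g).hom x = g.hom (f.hom x) := rfl

theorem hom_ext {M N : SBimod B A} {f g : M ⟶ N} (h : ∀ x, f.hom x = g.hom x) : f = g :=
  Hom.ext (AddMonoidHom.ext h)

theorem gr_of_comp {V W : Type*} [AddCommGroup V] [AddCommGroup W] [Z2Graded V] [Z2Graded W]
    {f : V →+ W} (h : ∀ x, f (comp 0 x) = comp 0 (f x)) {i : ZMod 2} {x : V}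
    (hx : x ∈ gr (V := V) i) : f x ∈ gr (V := W) i := by
  induction i using cases2 with
  | h0 => rw [mem_zero_iff] at hx ⊢; rw [← h, hx]
  | h1 => rw [mem_one_iff] at hx ⊢; rw [← h, hx, map_zero]

theorem comp_of_gr {V W : Type*} [AddCommGroup V] [AddCommGroup W] [Z2Graded V] [Z2Graded W]
    {f : V →+ W} (h : ∀ {i : ZMod 2} {x : V}, x ∈ gr (V := V) i → f x ∈ gr (V := W) i)
    (x : V) : f (comp 0 x) = comp 0 (f x) := by
  induction x using Z2Graded.ind with
  | add v w hv hw => simp only [map_add, hv, hw]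
  | hom i x hx =>
    induction i using cases2 with
    | h0 => rw [comp_same hx, comp_same (h hx)]
    | h1 => rw [comp_ne hx one_ne_zero, comp_ne (h hx) one_ne_zero, map_zero]

/-- A bijective even bimodule map is an isomorphism. -/
def isoMk {M N : SBimod B A} (e : M ≃+ N) (h₁ : ∀ (b : B) (x : M), e (b • x) = b • e x)
    (h₂ : ∀ (a : A) (x : M), e (op a • x) = op a • e x)
    (h₃ : ∀ {i : ZMod 2} {x : M}, x ∈ gr (V := M) i → e x ∈ gr (V := N) i) : M ≅ N where
  hom := ⟨e.toAddMonoidHom, h₁, h₂, h₃⟩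
  inv := ⟨e.symm.toAddMonoidHom, fun b x => e.injective (by simp [h₁]),
    fun a x => e.injective (by simp [h₂]), fun h => gr_of_comp (fun x => e.injective (by
      have := comp_of_gr (f := e.toAddMonoidHom) h₃ (e.symm x)
      simp at this ⊢
      rw [this])) h⟩
  hom_inv_id := hom_ext fun x => e.symm_apply_apply x
  inv_hom_id := hom_ext fun x => e.apply_symm_apply x

/-- A bijective even bimodule map is an isomorphism. -/
def isoOfHom {M N : SBimod B A} (f : M ⟶ N) (g : N → M) (h₁ : ∀ x, g (f.hom x) = x)
    (h₂ : ∀ x, f.hom (g x) = x) : M ≅ N :=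
  isoMk { f.hom with invFun := g, left_inv := h₁, right_inv := h₂ } f.map_smul f.map_rsmul f.map_mem

@[simp] theorem isoOfHom_hom {M N : SBimod B A} (f : M ⟶ N) (g h₁ h₂) :
    (isoOfHom f g h₁ h₂).hom = f := rfl
@[simp] theorem isoOfHom_inv {M N : SBimod B A} (f : M ⟶ N) (g h₁ h₂) (x : N) :
    (isoOfHom f g h₁ h₂).inv.hom x = g x := rfl

theorem iso_hom_inv {M N : SBimod B A} (e : M ≅ N) (x : M) : e.inv.hom (e.hom.hom x) = x :=
  congrArg (fun f : M ⟶ M => f.hom x) e.hom_inv_id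
theorem iso_inv_hom {M N : SBimod B A} (e : M ≅ N) (x : N) : e.hom.hom (e.inv.hom x) = x :=
  congrArg (fun f : N ⟶ N => f.hom x) e.inv_hom_id

theorem iso_inv_eq {M N : SBimod B A} (e : M ≅ N) {x : M} {y : N} (h : e.hom.hom x = y) :
    e.inv.hom y = x := by rw [← h, iso_hom_inv]

/-- The algebra `A` as an `(A, A)`-bimodule. -/
def regular (A : SAlg.{u}) : SBimod A A where
  carrier := A
  central c x := by simpa using Algebra.commutes c x
  left_mem ha hx := A.mul_mem ha hx
  right_mem {i j} _ _ ha hx := add_comm i j ▸ A.mul_mem hx ha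

/-- The elements of `regular A` are those of `A`. -/
def reg : A ≃+ regular A := AddEquiv.refl _

@[simp] theorem smul_reg (b a : A) : b • reg a = reg (b * a) := rfl
@[simp] theorem rsmul_reg (b a : A) : op b • reg a = reg (a * b) := rfl
theorem reg_mem {i : ZMod 2} {a : A} : reg a ∈ gr (V := regular A) i ↔ a ∈ gr (V := A) i := Iff.rfl
theorem reg_ind {p : regular A → Prop} (h : ∀ a, p (reg a)) (x : regular A) : p x := h x

/-- The relative tensor product `N ⊗_B M`. -/
noncomputable def tensor (N : SBimod C B) (M : SBimod B A) : SBimod C A where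
  carrier := BTensor B N M
  graded := BTensor.graded N.right_mem M.left_mem
  central c x := by
    induction x using BTensor.ind with
    | h n m =>
      rw [BTensor.smul_tmul, BTensor.tmul_rsmul, N.central, ← M.central, BTensor.tmul_smul]
    | add x y hx hy => simp only [smul_add, hx, hy]
  left_mem {i j c x} hc hx := by
    let _ := BTensor.graded N.right_mem M.left_mem
    have : ∀ x : BTensor B N M, c • comp j x ∈ gr (V := BTensor B N M) (i + j) := by
      intro x
      refine BTensor.ind_hom (B := B) (N := N) (M := M)
        (p := fun x => c • comp j x ∈ gr (V := BTensor B N M) (i + j)) (fun k l n hn m hm => ?_)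
        (fun x y hx hy => by rw [map_add, smul_add]; exact add_mem hx hy) x
      by_cases h : k + l = j
      · subst h
        rw [comp_same (BTensor.tmul_mem N.right_mem M.left_mem hn hm), ← add_assoc]
        exact BTensor.tmul_mem N.right_mem M.left_mem (N.left_mem hc hn) hm
      · rw [comp_ne (BTensor.tmul_mem N.right_mem M.left_mem hn hm) h, smul_zero]
        exact zero_mem _
    have h := this x
    rwa [comp_same hx] at h
  right_mem {i j c x} hc hx := by
    let _ := BTensor.graded N.right_mem M.left_mem
    have : ∀ x : BTensor B N M, op c • comp j x ∈ gr (V := BTensor B N M) (i + j) := by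
      intro x
      refine BTensor.ind_hom (B := B) (N := N) (M := M)
        (p := fun x => op c • comp j x ∈ gr (V := BTensor B N M) (i + j)) (fun k l n hn m hm => ?_)
        (fun x y hx hy => by rw [map_add, smul_add]; exact add_mem hx hy) x
      by_cases h : k + l = j
      · subst h
        rw [comp_same (BTensor.tmul_mem N.right_mem M.left_mem hn hm), add_left_comm]
        exact BTensor.tmul_mem N.right_mem M.left_mem hn (M.right_mem hc hm)
      · rw [comp_ne (BTensor.tmul_mem N.right_mem M.left_mem hn hm) h, smul_zero]
        exact zero_mem _
    have h := this x
    rwa [comp_same hx] at h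

/-- Pure tensors `n ⊗ m`. -/
def tm {N : SBimod C B} {M : SBimod B A} : N →+ M →+ N.tensor M := BTensor.tmul

section
variable {N N' : SBimod C B} {M M' : SBimod B A}

theorem tm_smul (n : N) (b : B) (m : M) : tm (op b • n) m = tm n (b • m) := BTensor.tmul_smul n b m

@[simp] theorem smul_tm (c : C) (n : N) (m : M) : c • tm n m = tm (c • n) m := rfl
@[simp] theorem rsmul_tm (a : A) (n : N) (m : M) : op a • tm n m = tm n (op a • m) := rfl

theorem tm_mem {i j : ZMod 2} {n : N} {m : M} (hn : n ∈ gr (V := N) i) (hm : m ∈ gr (V := M) j) :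
    tm n m ∈ gr (V := N.tensor M) (i + j) := BTensor.tmul_mem N.right_mem M.left_mem hn hm

theorem ind {p : N.tensor M → Prop} (h : ∀ n m, p (tm n m)) (add : ∀ x y, p x → p y → p (x + y))
    (x : N.tensor M) : p x := BTensor.ind h add x

theorem ind_hom {p : N.tensor M → Prop}
    (h : ∀ i j, ∀ n ∈ gr (V := N) i, ∀ m ∈ gr (V := M) j, p (tm n m))
    (add : ∀ x y, p x → p y → p (x + y)) (x : N.tensor M) : p x :=
  BTensor.ind_hom (B := B) h add x

/-- The map out of the tensor product given by a balanced biadditive map. -/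
def lift {P : Type*} [AddCommGroup P] (f : N →+ M →+ P)
    (hf : ∀ n (b : B) m, f (op b • n) m = f n (b • m)) : N.tensor M →+ P := BTensor.lift f hf

@[simp] theorem lift_tm {P : Type*} [AddCommGroup P] (f : N →+ M →+ P)
    (hf : ∀ n (b : B) m, f (op b • n) m = f n (b • m)) (n : N) (m : M) :
    lift f hf (tm n m) = f n m := rfl

theorem lift_mem {P : Type*} [AddCommGroup P] [Z2Graded P] (f : N.tensor M →+ P)
    (h : ∀ {i j : ZMod 2} {n : N} {m : M}, n ∈ gr (V := N) i → m ∈ gr (V := M) j →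
      f (tm n m) ∈ gr (V := P) (i + j)) {i : ZMod 2} {x : N.tensor M}
    (hx : x ∈ gr (V := N.tensor M) i) : f x ∈ gr (V := P) i := by
  refine gr_of_comp (fun x => ?_) hx
  induction x using ind_hom with
  | add x y hx hy => simp only [map_add, hx, hy]
  | h i j n hn m hm =>
    have h1 := tm_mem hn hm
    have h2 := h hn hm
    generalize i + j = k at h1 h2
    induction k using cases2 with
    | h0 => rw [comp_same h1, comp_same h2]
    | h1 => rw [comp_ne h1 one_ne_zero, comp_ne h2 one_ne_zero, map_zero]

theorem tensor_ext {P : SBimod C A} {f g : N.tensor M ⟶ P}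
    (h : ∀ n m, f.hom (tm n m) = g.hom (tm n m)) : f = g :=
  Hom.ext (BTensor.hom_ext h)

theorem tensor_ext_hom {P : SBimod C A} {f g : N.tensor M ⟶ P}
    (h : ∀ i j, ∀ n ∈ gr (V := N) i, ∀ m ∈ gr (V := M) j, f.hom (tm n m) = g.hom (tm n m)) :
    f = g := by
  refine hom_ext fun x => ?_
  induction x using ind_hom with
  | add x y hx hy => simp only [map_add, hx, hy]
  | h i j n hn m hm => exact h i j n hn m hm

/-- The bimodule map out of the tensor product given by a balanced bilinear map. -/
noncomputable def homMk {P : SBimod C A} (f : N →+ M →+ P) (hf : ∀ n (b : B) m, f (op b • n) m = f n (b • m))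
    (h₁ : ∀ (c : C) n m, f (c • n) m = c • f n m) (h₂ : ∀ (a : A) n m, f n (op a • m) = op a • f n m)
    (h₃ : ∀ {i j : ZMod 2} {n : N} {m : M}, n ∈ gr (V := N) i → m ∈ gr (V := M) j →
      f n m ∈ gr (V := P) (i + j)) : N.tensor M ⟶ P where
  hom := lift f hf
  map_smul c x := by
    induction x using ind with
    | add x y hx hy => simp only [map_add, smul_add, hx, hy]
    | h n m => simp [h₁]
  map_rsmul c x := by
    induction x using ind with
    | add x y hx hy => simp only [map_add, smul_add, hx, hy]
    | h n m => simp [h₂]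
  map_mem := lift_mem _ h₃

@[simp] theorem homMk_tm {P : SBimod C A} (f : N →+ M →+ P) (hf h₁ h₂ h₃) (n : N) (m : M) :
    (homMk (P := P) f hf h₁ h₂ h₃).hom (tm n m) = f n m := rfl

/-- Functoriality of the tensor product. -/
noncomputable def tensorMap (f : N ⟶ N') (g : M ⟶ M') : N.tensor M ⟶ N'.tensor M' :=
  homMk ((tm.comp f.hom).compl₂ g.hom)
    (fun n b m => by
      change tm (f.hom _) (g.hom _) = tm (f.hom _) (g.hom _)
      rw [f.map_rsmul, g.map_smul, tm_smul])
    (fun c n m => by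
      change tm (f.hom _) (g.hom _) = c • tm (f.hom _) (g.hom _)
      rw [f.map_smul, smul_tm])
    (fun a n m => by
      change tm (f.hom _) (g.hom _) = op a • tm (f.hom _) (g.hom _)
      rw [g.map_rsmul, rsmul_tm])
    (fun hn hm => tm_mem (f.map_mem hn) (g.map_mem hm))

@[simp] theorem tensorMap_tm (f : N ⟶ N') (g : M ⟶ M') (n : N) (m : M) :
    (tensorMap f g).hom (tm n m) = tm (f.hom n) (g.hom m) := rfl

end

section assoc
variable (P : SBimod E C) (N : SBimod C B) (M : SBimod B A)

/-- `p ⊗ (n ⊗ m) ↦ (p ⊗ n) ⊗ m`. -/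
noncomputable def assocHom : P.tensor (N.tensor M) ⟶ (P.tensor N).tensor M :=
  homMk (AddMonoidHom.mk' (fun p => lift (tm.comp (tm p)) fun n b m => by
      change tm (tm p (op b • n)) m = _
      rw [← rsmul_tm, tm_smul]; rfl) fun p p' => BTensor.hom_ext fun n m => by
        change tm (tm (p + p') n) m = tm (tm p n) m + tm (tm p' n) m
        simp only [map_add, AddMonoidHom.add_apply])
    (fun p c x => by
      induction x using ind with
      | add x y hx hy => simp only [map_add, smul_add, hx, hy]
      | h n m => exact congrArg (fun y => tm y m) (tm_smul p c n))
    (fun e p x => by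
      induction x using ind with
      | add x y hx hy => simp only [map_add, smul_add, hx, hy]
      | h n m => rfl)
    (fun a p x => by
      induction x using ind with
      | add x y hx hy => simp only [map_add, smul_add, hx, hy]
      | h n m => rfl)
    (fun {i j p x} hp hx => by
      have : ∀ x : N.tensor M, (lift (tm.comp (tm p)) (fun n b m => by
          change tm (tm p (op b • n)) m = _
          rw [← rsmul_tm, tm_smul]; rfl) : N.tensor M →+ (P.tensor N).tensor M)
            (comp j x) ∈ gr (V := (P.tensor N).tensor M) (i + j) := by
        intro x
        induction x using ind_hom with
        | add x y hx hy => rw [map_add, map_add]; exact add_mem hx hy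
        | h k l n hn m hm =>
          by_cases h : k + l = j
          · subst h
            rw [comp_same (tm_mem hn hm), ← add_assoc]
            exact tm_mem (tm_mem hp hn) hm
          · rw [comp_ne (tm_mem hn hm) h, map_zero]
            exact zero_mem _
      have h := this x
      rwa [comp_same hx] at h)

@[simp] theorem assocHom_tm (p : P) (n : N) (m : M) :
    (assocHom P N M).hom (tm p (tm n m)) = tm (tm p n) m := rfl

/-- `(p ⊗ n) ⊗ m ↦ p ⊗ (n ⊗ m)`. -/
noncomputable def assocInv : (P.tensor N).tensor M →+ P.tensor (N.tensor M) :=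
  lift (AddMonoidHom.mk' (fun m => lift (N := P) (M := N)
      ((AddMonoidHom.mk' (fun n => tm.flip (tm n m)) fun n n' => by
        ext p; simp only [map_add, AddMonoidHom.add_apply]).flip) fun p c n => by
      change tm (op c • p) (tm n m) = tm p (tm (c • n) m)
      rw [tm_smul, smul_tm]) fun m m' => BTensor.hom_ext fun p n => by
        change tm p (tm n (m + m')) = tm p (tm n m) + tm p (tm n m')
        simp only [map_add]).flip fun x b m => by
      induction x using ind with
      | add x y hx hy => simp only [smul_add, map_add, AddMonoidHom.add_apply, hx, hy]
      | h p n => exact congrArg (tm p) (tm_smul n b m)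

@[simp] theorem assocInv_tm (p : P) (n : N) (m : M) :
    assocInv P N M (tm (tm p n) m) = tm p (tm n m) := rfl

/-- The associator. -/
noncomputable def assoc : P.tensor (N.tensor M) ≅ (P.tensor N).tensor M :=
  isoOfHom (assocHom P N M) (assocInv P N M)
    (fun x => by
      induction x using SBimod.ind with
      | add x y hx hy => simp only [map_add, hx, hy]
      | h p x =>
        induction x using SBimod.ind with
        | add x y hx hy => simp only [map_add, hx, hy]
        | h n m => rfl)
    (fun x => by
      induction x using SBimod.ind with
      | add x y hx hy => simp only [map_add, hx, hy]
      | h x m =>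
        induction x using SBimod.ind with
        | add x y hx hy => simp only [map_add, AddMonoidHom.add_apply, hx, hy]
        | h p n => rfl)

@[simp] theorem assoc_hom_tm (p : P) (n : N) (m : M) :
    (assoc P N M).hom.hom (tm p (tm n m)) = tm (tm p n) m := rfl
@[simp] theorem assoc_inv_tm (p : P) (n : N) (m : M) :
    (assoc P N M).inv.hom (tm (tm p n) m) = tm p (tm n m) := rfl

/-- `b ⊗ m ↦ b • m`. -/
noncomputable def leftUnit : (regular B).tensor M ≅ M :=
  isoOfHom (homMk (P := M) (N := regular B) (M := M)
      ((AddMonoidHom.mk' (fun b : B => DistribSMul.toAddMonoidHom M b)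
        fun b b' => by ext m; exact add_smul b b' m).comp reg.symm.toAddMonoidHom)
      (fun b' b m => mul_smul (α := B) b' b m) (fun b' b m => mul_smul (α := B) b' b m)
      (fun a b m => smul_comm (M := B) b (op a) m) (fun hb hm => M.left_mem hb hm))
    (fun m => tm (reg (1 : B)) m)
    (fun x => by
      induction x using SBimod.ind with
      | add x y hx hy => simp only [map_add, hx, hy]
      | h b m =>
        induction b using reg_ind with
        | h b =>
          refine (tm_smul (reg (1 : B)) b m).symm.trans ?_
          rw [rsmul_reg, one_mul])
    (fun m => one_smul B m)

@[simp] theorem leftUnit_hom_tm (b : B) (m : M) : (leftUnit M).hom.hom (tm (reg b) m) = b • m := rfl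
@[simp] theorem leftUnit_inv (m : M) : (leftUnit M).inv.hom m = tm (reg (1 : B)) m := rfl

/-- `m ⊗ a ↦ m • a`. -/
noncomputable def rightUnit : M.tensor (regular A) ≅ M :=
  isoOfHom (homMk (P := M) (N := M) (M := regular A)
      ((AddMonoidHom.mk' (fun a : A => DistribSMul.toAddMonoidHom M (op a))
        fun b b' => by ext m; exact add_smul (op b) (op b') m).comp reg.symm.toAddMonoidHom).flip
      (fun m b a => (mul_smul (α := Aᵐᵒᵖ) (op (reg.symm a)) (op b) m).symm)
      (fun b m a => (smul_comm (M := B) (N := Aᵐᵒᵖ) b (op (reg.symm a)) m).symm)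
      (fun a' m a => mul_smul (α := Aᵐᵒᵖ) (op a') (op (reg.symm a)) m)
      (fun {i j _ _} hb hm => add_comm i j ▸ M.right_mem hm hb))
    (fun m => tm m (reg (1 : A)))
    (fun x => by
      induction x using SBimod.ind with
      | add x y hx hy => simp only [map_add, AddMonoidHom.add_apply, hx, hy]
      | h m a =>
        induction a using reg_ind with
        | h a =>
          refine (tm_smul m a (reg (1 : A))).trans ?_
          rw [smul_reg, mul_one])
    (fun m => one_smul Aᵐᵒᵖ m)

@[simp] theorem rightUnit_hom_tm (a : A) (m : M) :
    (rightUnit M).hom.hom (tm m (reg a)) = op a • m := rfl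
@[simp] theorem rightUnit_inv (m : M) : (rightUnit M).inv.hom m = tm m (reg (1 : A)) := rfl

end assoc
end SBimod

open SBimod

/-- The Morita bicategory of complex superalgebras: a 1-morphism `A ⟶ B` is a `(B, A)`-bimodule. -/
noncomputable instance : Bicategory SAlg.{u} where
  Hom A B := SBimod B A
  id A := regular A
  comp M N := N.tensor M
  whiskerLeft M _ _ η := tensorMap η (𝟙 M)
  whiskerRight η N := tensorMap (𝟙 N) η
  associator M N P := assoc P N M
  leftUnitor M := rightUnit M
  rightUnitor M := leftUnit M
  whiskerLeft_id _ _ := by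
    refine tensor_ext fun _ _ => ?_
    rfl
  whiskerLeft_comp _ _ _ _ _ _ := by
    refine tensor_ext fun _ _ => ?_
    rfl
  id_whiskerLeft {A _ f g} η := by
    refine tensor_ext (N := f) (M := regular A) fun m a => ?_
    induction a using reg_ind with
    | h a =>
      change tm (η.hom m) (reg a) = tm (η.hom (op a • m)) (reg 1)
      rw [η.map_rsmul, tm_smul, smul_reg, mul_one]
  comp_whiskerLeft M N P P' η := by
    refine tensor_ext (N := P) (M := N.tensor M) fun p x => ?_
    induction x using SBimod.ind with
    | add x y hx hy => simp only [map_add, hx, hy]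
    | h n m => rfl
  id_whiskerRight _ _ := by
    refine tensor_ext fun _ _ => ?_
    rfl
  comp_whiskerRight _ _ _ := by
    refine tensor_ext fun _ _ => ?_
    rfl
  whiskerRight_id {_ B f g} η := by
    refine tensor_ext (N := regular B) (M := f) fun b m => ?_
    induction b using reg_ind with
    | h b =>
      change tm (reg b) (η.hom m) = tm (reg 1) (η.hom (b • m))
      rw [η.map_smul, ← tm_smul, rsmul_reg, one_mul]
  whiskerRight_comp {_ _ _ _ f _} η N P := by
    refine tensor_ext (N := P.tensor N) (M := f) fun x m => ?_
    induction x using SBimod.ind with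
    | add x y hx hy => simp only [map_add, AddMonoidHom.add_apply, hx, hy]
    | h p n => rfl
  whisker_assoc M N _ η P := by
    refine tensor_ext (N := P) (M := N.tensor M) fun p x => ?_
    induction x using SBimod.ind with
    | add x y hx hy => simp only [map_add, hx, hy]
    | h n m => rfl
  whisker_exchange _ _ := by
    refine tensor_ext fun n m => ?_
    rfl
  pentagon M N P Q := by
    refine tensor_ext (N := Q) (M := P.tensor (N.tensor M)) fun q x => ?_
    induction x using SBimod.ind with
    | add x y hx hy => simp only [map_add, hx, hy]
    | h p x =>
      induction x using SBimod.ind with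
      | add x y hx hy => simp only [map_add, hx, hy]
      | h n m => rfl
  triangle {_ B _} M N := by
    refine tensor_ext (N := N) (M := (regular B).tensor M) fun n x => ?_
    induction x using SBimod.ind with
    | add x y hx hy => simp only [map_add, hx, hy]
    | h b m =>
      induction b using reg_ind with
      | h b => exact tm_smul n b m

end

section

/-- A weak duality involution on a bicategory: a pseudofunctor `D`, reversing 1-morphisms but not
2-morphisms, with a pseudonatural equivalence `e : 𝟭 ⟶ D ∘ D` and an invertible modification
`θ : e_{D a} ≫ D e_a ≅ 𝟙`, subject to the swallowtail equation. -/
structure Duality (B : Type u) [Bicategory.{w, v} B] where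
  obj : B → B
  map {a b : B} (f : a ⟶ b) : obj b ⟶ obj a
  map₂ {a b : B} {f g : a ⟶ b} (η : f ⟶ g) : map f ⟶ map g
  map₂_id {a b : B} (f : a ⟶ b) : map₂ (𝟙 f) = 𝟙 (map f)
  map₂_comp {a b : B} {f g h : a ⟶ b} (η : f ⟶ g) (ξ : g ⟶ h) :
    map₂ (η ≫ ξ) = map₂ η ≫ map₂ ξ
  mapId (a : B) : map (𝟙 a) ≅ 𝟙 (obj a)
  mapComp {a b c : B} (f : a ⟶ b) (g : b ⟶ c) : map (f ≫ g) ≅ map g ≫ map f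
  map₂_whisker_left {a b c : B} (f : a ⟶ b) {g h : b ⟶ c} (η : g ⟶ h) :
    map₂ (f ◁ η) = (mapComp f g).hom ≫ map₂ η ▷ map f ≫ (mapComp f h).inv
  map₂_whisker_right {a b c : B} {f g : a ⟶ b} (η : f ⟶ g) (h : b ⟶ c) :
    map₂ (η ▷ h) = (mapComp f h).hom ≫ map h ◁ map₂ η ≫ (mapComp g h).inv
  map₂_associator {a b c d : B} (f : a ⟶ b) (g : b ⟶ c) (h : c ⟶ d) :
    map₂ (α_ f g h).hom = (mapComp (f ≫ g) h).hom ≫ map h ◁ (mapComp f g).hom ≫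
      (α_ (map h) (map g) (map f)).inv ≫ (mapComp g h).inv ▷ map f ≫ (mapComp f (g ≫ h)).inv
  map₂_left_unitor {a b : B} (f : a ⟶ b) :
    map₂ (λ_ f).hom = (mapComp (𝟙 a) f).hom ≫ map f ◁ (mapId a).hom ≫ (ρ_ (map f)).hom
  map₂_right_unitor {a b : B} (f : a ⟶ b) :
    map₂ (ρ_ f).hom = (mapComp f (𝟙 b)).hom ≫ (mapId b).hom ▷ map f ≫ (λ_ (map f)).hom
  e (a : B) : a ⟶ obj (obj a)
  e_equiv (a : B) : ∃ g : obj (obj a) ⟶ a, Nonempty (e a ≫ g ≅ 𝟙 _) ∧ Nonempty (g ≫ e a ≅ 𝟙 _)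
  nat {a b : B} (f : a ⟶ b) : f ≫ e b ≅ e a ≫ map (map f)
  nat_naturality {a b : B} {f g : a ⟶ b} (η : f ⟶ g) :
    η ▷ e b ≫ (nat g).hom = (nat f).hom ≫ e a ◁ map₂ (map₂ η)
  nat_id (a : B) : (nat (𝟙 a)).hom ≫ e a ◁ (map₂ (mapId a).hom ≫ (mapId (obj a)).hom) =
    (λ_ (e a)).hom ≫ (ρ_ (e a)).inv
  nat_comp {a b c : B} (f : a ⟶ b) (g : b ⟶ c) :
    (nat (f ≫ g)).hom ≫ e a ◁ (map₂ (mapComp f g).hom ≫ (mapComp (map g) (map f)).hom) =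
      (α_ f g (e c)).hom ≫ f ◁ (nat g).hom ≫ (α_ f (e b) (map (map g))).inv ≫
        (nat f).hom ▷ map (map g) ≫ (α_ (e a) (map (map f)) (map (map g))).hom
  θ (a : B) : e (obj a) ≫ map (e a) ≅ 𝟙 (obj a)
  θ_naturality {a b : B} (f : a ⟶ b) :
    map f ◁ (θ a).hom ≫ (ρ_ (map f)).hom =
      (α_ (map f) (e (obj a)) (map (e a))).inv ≫ (nat (map f)).hom ▷ map (e a) ≫
        (α_ (e (obj b)) (map (map (map f))) (map (e a))).hom ≫
        e (obj b) ◁ ((mapComp (e a) (map (map f))).inv ≫ map₂ (nat f).inv ≫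
          (mapComp f (e b)).hom) ≫
        (α_ (e (obj b)) (map (e b)) (map f)).inv ≫ (θ b).hom ▷ map f ≫ (λ_ (map f)).hom
  swallowtail (a : B) :
    e a ◁ (θ (obj a)).hom ≫ (ρ_ (e a)).hom =
      (α_ (e a) (e (obj (obj a))) (map (e (obj a)))).inv ≫
        (nat (e a)).hom ▷ map (e (obj a)) ≫
        (α_ (e a) (map (map (e a))) (map (e (obj a)))).hom ≫
        e a ◁ ((mapComp (e (obj a)) (map (e a))).inv ≫ map₂ (θ a).hom ≫ (mapId (obj a)).hom) ≫
        (ρ_ (e a)).hom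

end

section

open Z2Graded SBimod

/-- The underlying abelian group of the conjugate opposite. -/
def Dl (V : Type u) : Type u := V

namespace Dl
variable {V : Type u} [AddCommGroup V]
instance : AddCommGroup (Dl V) := inferInstanceAs (AddCommGroup V)
/-- The tautological bijection `v ↦ v̄ᵒᵖ`. -/
def dl : V ≃+ Dl V := AddEquiv.refl V
instance [Z2Graded V] : Z2Graded (Dl V) := inferInstanceAs (Z2Graded V)
theorem dl_mem [Z2Graded V] {i : ZMod 2} {v : V} (h : v ∈ gr (V := V) i) :
    dl v ∈ gr (V := Dl V) i := h
theorem dl_ind {p : Dl V → Prop} (h : ∀ v, p (dl v)) (x : Dl V) : p x := h x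
theorem dl_ind_hom [Z2Graded V] {p : Dl V → Prop} (h : ∀ i, ∀ v ∈ gr (V := V) i, p (dl v))
    (add : ∀ v w, p v → p w → p (v + w)) (x : Dl V) : p x :=
  Z2Graded.ind (V := V) h add x
end Dl
open Dl

namespace SAlg
variable (A : SAlg.{u})

/-- `ā^{op} b̄^{op} = (-1)^{|a||b|} (b a)‾^{op}`. -/
noncomputable def dlMul : Dl A →+ Dl A →+ Dl A :=
  koszul (((AddMonoidHom.mul (R := A)).flip.compr₂ dl.toAddMonoidHom).compl₂
    dl.symm.toAddMonoidHom |>.comp dl.symm.toAddMonoidHom)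

variable {A}
theorem dlMul_dl {i j : ZMod 2} {a b : A} (ha : a ∈ gr (V := A) i) (hb : b ∈ gr (V := A) j) :
    A.dlMul (dl a) (dl b) = ksign i j • dl (b * a) := koszul_apply _ (dl_mem ha) (dl_mem hb)

theorem dlMul_even {a : A} (ha : a ∈ gr (V := A) 0) (b : A) :
    A.dlMul (dl a) (dl b) = dl (b * a) := by
  induction b using Z2Graded.ind with
  | add v w hv hw => simp only [map_add, hv, hw, add_mul]
  | hom j b hb => rw [dlMul_dl ha hb, ksign_zero_left, one_zsmul]

theorem dlMul_even' {a : A} (ha : a ∈ gr (V := A) 0) (b : A) :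
    A.dlMul (dl b) (dl a) = dl (a * b) := by
  induction b using Z2Graded.ind with
  | add v w hv hw => simp only [map_add, AddMonoidHom.add_apply, hv, hw, mul_add]
  | hom j b hb => rw [dlMul_dl hb ha, ksign_zero_right, one_zsmul]

noncomputable instance : Ring (Dl A) :=
  { (inferInstance : AddCommGroup (Dl A)) with
    mul a b := A.dlMul a b
    one := dl 1
    left_distrib a := map_add (A.dlMul a)
    right_distrib a b c := congrArg (fun f : Dl A →+ Dl A => f c) (map_add A.dlMul a b)
    zero_mul a := congrArg (fun f : Dl A →+ Dl A => f a) (map_zero A.dlMul)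
    mul_zero a := map_zero (A.dlMul a)
    mul_assoc a b c := by
      change A.dlMul (A.dlMul a b) c = A.dlMul a (A.dlMul b c)
      induction a using dl_ind_hom with
      | add v w hv hw => simp only [map_add, AddMonoidHom.add_apply, hv, hw]
      | h i a ha =>
      induction b using dl_ind_hom with
      | add v w hv hw => simp only [map_add, AddMonoidHom.add_apply, hv, hw]
      | h j b hb =>
      induction c using dl_ind_hom with
      | add v w hv hw => simp only [map_add, hv, hw]
      | h k c hc =>
      rw [dlMul_dl ha hb, dlMul_dl hb hc, map_zsmul, map_zsmul, AddMonoidHom.smul_apply,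
        dlMul_dl (A.mul_mem hb ha) hc, dlMul_dl ha (A.mul_mem hc hb), smul_smul, smul_smul, mul_assoc,
        ksign_add_left, ksign_add_right]
      congr 1
      ring
    one_mul a := by
      induction a using dl_ind with
      | h a => exact (dlMul_even A.one_mem a).trans (congrArg dl (mul_one a))
    mul_one a := by
      induction a using dl_ind with
      | h a => exact (dlMul_even' A.one_mem a).trans (congrArg dl (one_mul a)) }

theorem dl_mul_dl {i j : ZMod 2} {a b : A} (ha : a ∈ gr (V := A) i) (hb : b ∈ gr (V := A) j) :
    dl a * dl b = ksign i j • dl (b * a) := dlMul_dl ha hb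
theorem dl_one : (dl (1 : A) : Dl A) = 1 := rfl

noncomputable instance : Algebra ℂ (Dl A) :=
  RingHom.toAlgebra' (R := ℂ) (S := Dl A)
    { toFun := fun c => dl (algebraMap ℂ A (starRingEnd ℂ c))
      map_one' := by rw [map_one, map_one, dl_one]
      map_mul' := fun c d => by
        rw [dl_mul_dl (A.algebraMap_mem _) (A.algebraMap_mem _), ksign_zero_left, one_zsmul,
          ← map_mul, ← map_mul, mul_comm]
      map_zero' := by simp
      map_add' := fun c d => by simp }
    fun c x => by
      induction x using dl_ind with
      | h x =>
        refine (dlMul_even (A.algebraMap_mem _) x).trans (Eq.trans ?_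
          (dlMul_even' (A.algebraMap_mem _) x).symm)
        exact congrArg dl (Algebra.commutes _ x).symm

theorem dl_algebraMap (c : ℂ) :
    algebraMap ℂ (Dl A) c = dl (algebraMap ℂ A (starRingEnd ℂ c)) := rfl

variable (A) in
/-- The superalgebra `Ā^{op}`. -/
noncomputable def dual : SAlg.{u} where
  carrier := Dl A
  algebraMap_mem c := dl_mem (A.algebraMap_mem _)
  mul_mem {i j a b} ha hb := by
    have := dl_mul_dl (A := A) (i := i) (j := j) (a := a) (b := b) ha hb
    exact (congrArg (· ∈ gr (V := Dl A) (i + j)) this).mpr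
      (zsmul_mem (dl_mem (add_comm i j ▸ A.mul_mem hb ha)) _)

end SAlg
open SAlg

namespace SBimod
variable {A B C : SAlg.{u}} (M : SBimod B A)

/-- `ā^{op} • m̄^{op} = (-1)^{|a||m|} (m • a)‾^{op}`. -/
noncomputable def dlLeft : Dl A →+ Dl M →+ Dl M :=
  koszul (((AddMonoidHom.mk' (fun a : A => DistribSMul.toAddMonoidHom M (op a))
    fun a a' => by ext m; exact add_smul (op a) (op a') m).compr₂ dl.toAddMonoidHom).compl₂
    dl.symm.toAddMonoidHom |>.comp dl.symm.toAddMonoidHom)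

/-- `m̄^{op} • b̄^{op} = (-1)^{|b||m|} (b • m)‾^{op}`. -/
noncomputable def dlRight : Dl B →+ Dl M →+ Dl M :=
  koszul (((AddMonoidHom.mk' (fun b : B => DistribSMul.toAddMonoidHom M b)
    fun a a' => by ext m; exact add_smul a a' m).compr₂ dl.toAddMonoidHom).compl₂
    dl.symm.toAddMonoidHom |>.comp dl.symm.toAddMonoidHom)

variable {M}
theorem dlLeft_dl {i j : ZMod 2} {a : A} {m : M} (ha : a ∈ gr (V := A) i)
    (hm : m ∈ gr (V := M) j) : M.dlLeft (dl a) (dl m) = ksign i j • dl (op a • m) :=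
  koszul_apply _ (dl_mem ha) (dl_mem hm)

theorem dlRight_dl {i j : ZMod 2} {b : B} {m : M} (hb : b ∈ gr (V := B) i)
    (hm : m ∈ gr (V := M) j) : M.dlRight (dl b) (dl m) = ksign i j • dl (b • m) :=
  koszul_apply _ (dl_mem hb) (dl_mem hm)

theorem dl_central (c : ℂ) (m : Dl M) :
    M.dlLeft (algebraMap ℂ (Dl A) c) m = M.dlRight (algebraMap ℂ (Dl B) c) m := by
  induction m using dl_ind_hom with
  | add v w hv hw => simp only [map_add, hv, hw]
  | h k m hm =>
  rw [dl_algebraMap, dl_algebraMap, dlLeft_dl (A.algebraMap_mem _) hm,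
    dlRight_dl (B.algebraMap_mem _) hm, M.central]

theorem dlLeft_one (m : Dl M) : M.dlLeft 1 m = m := by
  induction m using dl_ind_hom with
  | add v w hv hw => rw [map_add, hv, hw]
  | h i m hm => rw [← dl_one, dlLeft_dl A.one_mem hm, ksign_zero_left, one_zsmul, op_one, one_smul]

theorem dlRight_one (m : Dl M) : M.dlRight 1 m = m := by
  induction m using dl_ind_hom with
  | add v w hv hw => rw [map_add, hv, hw]
  | h i m hm => rw [← dl_one, dlRight_dl B.one_mem hm, ksign_zero_left, one_zsmul, one_smul]

theorem dlLeft_mul (a b : Dl A) (m : Dl M) : M.dlLeft (a * b) m = M.dlLeft a (M.dlLeft b m) := by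
  induction a using dl_ind_hom with
  | add v w hv hw => simp only [add_mul, map_add, AddMonoidHom.add_apply, hv, hw]
  | h i a ha =>
  induction b using dl_ind_hom with
  | add v w hv hw => simp only [mul_add, map_add, AddMonoidHom.add_apply, hv, hw]
  | h j b hb =>
  induction m using dl_ind_hom with
  | add v w hv hw => simp only [map_add, hv, hw]
  | h k m hm =>
  rw [dl_mul_dl ha hb, dlLeft_dl hb hm, map_zsmul, map_zsmul, AddMonoidHom.smul_apply,
    dlLeft_dl (A.mul_mem hb ha) hm, dlLeft_dl ha (M.right_mem hb hm), smul_smul, smul_smul,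
    op_mul, mul_smul (op a) (op b) m, ksign_add_left, ksign_add_right]
  congr 1
  ring

theorem dlRight_mul (a b : Dl B) (m : Dl M) :
    M.dlRight (b * a) m = M.dlRight a (M.dlRight b m) := by
  induction a using dl_ind_hom with
  | add v w hv hw => simp only [mul_add, map_add, AddMonoidHom.add_apply, hv, hw]
  | h i a ha =>
  induction b using dl_ind_hom with
  | add v w hv hw => simp only [add_mul, map_add, AddMonoidHom.add_apply, hv, hw]
  | h j b hb =>
  induction m using dl_ind_hom with
  | add v w hv hw => simp only [map_add, hv, hw]
  | h k m hm =>
  rw [dl_mul_dl hb ha, dlRight_dl hb hm, map_zsmul, map_zsmul, AddMonoidHom.smul_apply,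
    dlRight_dl (B.mul_mem ha hb) hm, dlRight_dl ha (M.left_mem hb hm), smul_smul, smul_smul,
    mul_smul a b m, ksign_add_left, ksign_add_right, ksign_comm j i]
  congr 1
  ring

theorem dlLeft_dlRight (a : Dl A) (b : Dl B) (m : Dl M) :
    M.dlLeft a (M.dlRight b m) = M.dlRight b (M.dlLeft a m) := by
  induction a using dl_ind_hom with
  | add v w hv hw => simp only [map_add, AddMonoidHom.add_apply, hv, hw]
  | h i a ha =>
  induction b using dl_ind_hom with
  | add v w hv hw => simp only [map_add, AddMonoidHom.add_apply, hv, hw]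
  | h j b hb =>
  induction m using dl_ind_hom with
  | add v w hv hw => simp only [map_add, hv, hw]
  | h k m hm =>
  rw [dlLeft_dl ha hm, dlRight_dl hb hm, map_zsmul, map_zsmul,
    dlRight_dl hb (M.right_mem ha hm), dlLeft_dl ha (M.left_mem hb hm), smul_smul, smul_smul,
    smul_comm b (op a) m, ksign_add_right, ksign_add_right, ksign_comm j i]
  congr 1
  ring

noncomputable instance : Module A.dual (Dl M) where
  smul a m := M.dlLeft a m
  one_smul m := dlLeft_one (M := M) m
  mul_smul a b m := dlLeft_mul (M := M) a b m
  smul_zero a := map_zero (M.dlLeft a)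
  smul_add a := map_add (M.dlLeft a)
  add_smul a b m := congrArg (fun f : Dl M →+ Dl M => f m) (map_add M.dlLeft a b)
  zero_smul m := congrArg (fun f : Dl M →+ Dl M => f m) (map_zero M.dlLeft)

noncomputable instance : Module (B.dual)ᵐᵒᵖ (Dl M) where
  smul b m := M.dlRight (unop b) m
  one_smul m := dlRight_one (M := M) m
  mul_smul a b m := dlRight_mul (M := M) (unop a) (unop b) m
  smul_zero a := map_zero (M.dlRight (unop a))
  smul_add a := map_add (M.dlRight (unop a))
  add_smul a b m :=
    congrArg (fun f : Dl M →+ Dl M => f m) (map_add M.dlRight (unop a) (unop b))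
  zero_smul m := congrArg (fun f : Dl M →+ Dl M => f m) (map_zero M.dlRight)

variable (M) in
/-- The `(Ā^{op}, B̄^{op})`-bimodule `M̄^{op}`. -/
noncomputable def dual : SBimod A.dual B.dual where
  carrier := Dl M
  smulComm := ⟨fun a b m => dlLeft_dlRight (M := M) a (unop b) m⟩
  central c m := dl_central (M := M) c m
  left_mem {i j a m} ha hm := by
    have := dlLeft_dl (M := M) (i := i) (j := j) ha hm
    exact (congrArg (· ∈ gr (V := Dl M) (i + j)) this).mpr
      (zsmul_mem (dl_mem (M.right_mem ha hm)) _)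
  right_mem {i j a m} ha hm := by
    have := dlRight_dl (M := M) (i := i) (j := j) ha hm
    exact (congrArg (· ∈ gr (V := Dl M) (i + j)) this).mpr
      (zsmul_mem (dl_mem (M.left_mem ha hm)) _)

end SBimod

end

section

open Z2Graded SBimod

namespace SAlg
variable {A : SAlg.{u}}
/-- `a ↦ ā^{op}`. -/
def d : A ≃+ A.dual := Dl.dl
theorem d_mem {i : ZMod 2} {a : A} (h : a ∈ gr (V := A) i) : d a ∈ gr (V := A.dual) i := h
theorem d_ind {p : A.dual → Prop} (h : ∀ a, p (d a)) (x : A.dual) : p x := h x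
theorem d_ind_hom {p : A.dual → Prop} (h : ∀ i, ∀ v ∈ gr (V := A) i, p (d v))
    (add : ∀ v w, p v → p w → p (v + w)) (x : A.dual) : p x :=
  Z2Graded.ind (V := A) h add x
theorem d_mul {i j : ZMod 2} {a b : A} (ha : a ∈ gr (V := A) i) (hb : b ∈ gr (V := A) j) :
    d a * d b = ksign i j • d (b * a) := dl_mul_dl ha hb
theorem d_one : d (1 : A) = 1 := rfl
theorem d_algebraMap (c : ℂ) :
    algebraMap ℂ A.dual c = d (algebraMap ℂ A (starRingEnd ℂ c)) := rfl

variable (A) in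
/-- The isomorphism of superalgebras from `A` to its double conjugate opposite. -/
noncomputable def dd : A ≃+* A.dual.dual :=
  { (d (A := A)).trans (d (A := A.dual)) with
    map_mul' := fun a b => by
      change d (d (a * b)) = d (d a) * d (d b)
      induction a using Z2Graded.ind with
      | add v w hv hw => simp only [add_mul, map_add, hv, hw]
      | hom i a ha =>
      induction b using Z2Graded.ind with
      | add v w hv hw => simp only [mul_add, map_add, hv, hw]
      | hom j b hb =>
      rw [d_mul (d_mem ha) (d_mem hb), d_mul hb ha, map_zsmul, smul_smul, ksign_comm j i, ksign_sq,
        one_smul] }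
theorem dd_apply (a : A) : dd A a = d (d a) := rfl
theorem dd_mem {i : ZMod 2} {a : A} (h : a ∈ gr (V := A) i) :
    dd A a ∈ gr (V := A.dual.dual) i := h
theorem dd_ind {p : A.dual.dual → Prop} (h : ∀ a, p (dd A a)) (x : A.dual.dual) : p x := h x
theorem dd_symm_mem {i : ZMod 2} {a : A.dual.dual} (h : a ∈ gr (V := A.dual.dual) i) :
    (dd A).symm a ∈ gr (V := A) i := h
theorem dd_algebraMap (c : ℂ) : algebraMap ℂ A.dual.dual c = dd A (algebraMap ℂ A c) := by
  rw [d_algebraMap, d_algebraMap, Complex.conj_conj]; rfl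
end SAlg
open SAlg

namespace SBimod
variable {A B C : SAlg.{u}} {N N' : SBimod C B} {M M' : SBimod B A}

/-- `m ↦ m̄^{op}`. -/
def dm : M ≃+ M.dual := Dl.dl
theorem dm_mem {i : ZMod 2} {m : M} : dm m ∈ gr (V := M.dual) i ↔ m ∈ gr (V := M) i := Iff.rfl
theorem dm_symm_mem {i : ZMod 2} {m : M.dual} (h : m ∈ gr (V := M.dual) i) :
    dm.symm m ∈ gr (V := M) i := h
theorem dm_ind {p : M.dual → Prop} (h : ∀ m, p (dm m)) (x : M.dual) : p x := h x
theorem dm_ind_hom {p : M.dual → Prop} (h : ∀ i, ∀ v ∈ gr (V := M) i, p (dm v))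
    (add : ∀ v w, p v → p w → p (v + w)) (x : M.dual) : p x :=
  Z2Graded.ind (V := M) h add x
theorem d_smul_dm {i j : ZMod 2} {a : A} {m : M} (ha : a ∈ gr (V := A) i)
    (hm : m ∈ gr (V := M) j) : d a • dm m = ksign i j • dm (op a • m) := dlLeft_dl ha hm
theorem d_rsmul_dm {i j : ZMod 2} {b : B} {m : M} (hb : b ∈ gr (V := B) i)
    (hm : m ∈ gr (V := M) j) : op (d b) • dm m = ksign i j • dm (b • m) := dlRight_dl hb hm

/-- The effect of `M ↦ M̄^{op}` on even bimodule maps. -/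
noncomputable def dualMap (f : M ⟶ M') : M.dual ⟶ M'.dual where
  hom := (dm.toAddMonoidHom.comp f.hom).comp dm.symm.toAddMonoidHom
  map_smul a m := by
    induction a using d_ind_hom with
    | add v w hv hw => simp only [add_smul, map_add, hv, hw]
    | h i a ha =>
    induction m using dm_ind_hom with
    | add v w hv hw => simp only [smul_add, map_add, hv, hw]
    | h j m hm =>
    rw [d_smul_dm ha hm, map_zsmul]
    change ksign i j • dm (f.hom (op a • m)) = d a • dm (f.hom m)
    rw [d_smul_dm ha (f.map_mem hm), f.map_rsmul]
  map_rsmul a m := by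
    induction a using d_ind_hom with
    | add v w hv hw => simp only [MulOpposite.op_add, add_smul, map_add, hv, hw]
    | h i a ha =>
    induction m using dm_ind_hom with
    | add v w hv hw => simp only [smul_add, map_add, hv, hw]
    | h j m hm =>
    rw [d_rsmul_dm ha hm, map_zsmul]
    change ksign i j • dm (f.hom (a • m)) = op (d a) • dm (f.hom m)
    rw [d_rsmul_dm ha (f.map_mem hm), f.map_smul]
  map_mem h := dm_mem.2 (f.map_mem h)

@[simp] theorem dualMap_dm (f : M ⟶ M') (m : M) : (dualMap f).hom (dm m) = dm (f.hom m) := rfl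

theorem dual_ext {P : SBimod A.dual B.dual} {f g : M.dual ⟶ P}
    (h : ∀ m, f.hom (dm m) = g.hom (dm m)) : f = g := hom_ext h

/-- Compatibility of `M ↦ M̄^{op}` with the identity bimodules. -/
noncomputable def dualId (A : SAlg.{u}) : (regular A).dual ≅ regular A.dual :=
  isoMk ((dm.symm.trans reg.symm).trans (d.trans reg))
    (fun a m => by
      induction a using d_ind_hom with
      | add v w hv hw => simp only [add_smul, map_add, hv, hw]
      | h i a ha =>
      induction m using dm_ind_hom with
      | add v w hv hw => simp only [smul_add, map_add, hv, hw]
      | h j m hm =>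
      induction m using reg_ind with
      | h m =>
      rw [d_smul_dm ha hm, map_zsmul]
      change ksign i j • reg (d (m * a)) = reg (d a * d m)
      rw [d_mul ha (reg_mem.1 hm), map_zsmul])
    (fun a m => by
      induction a using d_ind_hom with
      | add v w hv hw => simp only [MulOpposite.op_add, add_smul, map_add, hv, hw]
      | h i a ha =>
      induction m using dm_ind_hom with
      | add v w hv hw => simp only [smul_add, map_add, hv, hw]
      | h j m hm =>
      induction m using reg_ind with
      | h m =>
      rw [d_rsmul_dm ha hm, map_zsmul]
      change ksign i j • reg (d (a * m)) = reg (d m * d a)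
      rw [d_mul (reg_mem.1 hm) ha, map_zsmul, ksign_comm j i])
    (fun h => h)

@[simp] theorem dualId_hom (a : A) : (dualId A).hom.hom (dm (reg a)) = reg (d a) := rfl
@[simp] theorem dualId_inv (a : A) : (dualId A).inv.hom (reg (d a)) = dm (reg a) := rfl

section
variable (N M)

/-- `m̄^{op} ⊗ n̄^{op} ↦ (-1)^{|m||n|} (n ⊗ m)‾^{op}`. -/
noncomputable def dualTensorFun : M.dual →+ N.dual →+ (N.tensor M).dual :=
  koszul (((tm (N := N) (M := M)).flip.compr₂ dm.toAddMonoidHom).compl₂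
    dm.symm.toAddMonoidHom |>.comp dm.symm.toAddMonoidHom)

/-- `(n ⊗ m)‾^{op} ↦ (-1)^{|m||n|} m̄^{op} ⊗ n̄^{op}`. -/
noncomputable def dualTensorInvFun : N →+ M →+ M.dual.tensor N.dual :=
  koszul ((tm (N := M.dual) (M := N.dual)).flip.compl₂ dm.toAddMonoidHom |>.comp dm.toAddMonoidHom)

variable {N M}
theorem dualTensorFun_dm {i j : ZMod 2} {m : M} {n : N} (hm : m ∈ gr (V := M) i)
    (hn : n ∈ gr (V := N) j) : dualTensorFun N M (dm m) (dm n) = ksign i j • dm (tm n m) :=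
  koszul_apply _ (dm_mem.2 hm) (dm_mem.2 hn)
theorem dualTensorInvFun_apply {i j : ZMod 2} {m : M} {n : N} (hm : m ∈ gr (V := M) i)
    (hn : n ∈ gr (V := N) j) : dualTensorInvFun N M n m = ksign j i • tm (dm m) (dm n) :=
  koszul_apply _ hn hm

variable (N M)
/-- `m̄^{op} ⊗ n̄^{op} ↦ (-1)^{|m||n|} (n ⊗ m)‾^{op}`. -/
noncomputable def dualTensorHom : M.dual.tensor N.dual ⟶ (N.tensor M).dual :=
  homMk (dualTensorFun N M)
    (fun m b n => by
      induction m using dm_ind_hom with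
      | add v w hv hw => simp only [smul_add, map_add, AddMonoidHom.add_apply, hv, hw]
      | h i m hm =>
      induction b using d_ind_hom with
      | add v w hv hw =>
        simp only [MulOpposite.op_add, add_smul, map_add, AddMonoidHom.add_apply, hv, hw]
      | h j b hb =>
      induction n using dm_ind_hom with
      | add v w hv hw => simp only [smul_add, map_add, hv, hw]
      | h k n hn =>
      rw [d_rsmul_dm hb hm, d_smul_dm hb hn, map_zsmul, map_zsmul, AddMonoidHom.smul_apply,
        dualTensorFun_dm (M.left_mem hb hm) hn, dualTensorFun_dm hm (N.right_mem hb hn),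
        tm_smul, smul_smul, smul_smul, ksign_add_left, ksign_add_right, ksign_comm j i]
      congr 1
      ring)
    (fun a m n => by
      induction m using dm_ind_hom with
      | add v w hv hw => simp only [smul_add, map_add, AddMonoidHom.add_apply, hv, hw]
      | h i m hm =>
      induction a using d_ind_hom with
      | add v w hv hw => simp only [add_smul, map_add, AddMonoidHom.add_apply, hv, hw]
      | h j a ha =>
      induction n using dm_ind_hom with
      | add v w hv hw => simp only [smul_add, map_add, hv, hw]
      | h k n hn =>
      rw [d_smul_dm ha hm, map_zsmul, AddMonoidHom.smul_apply,
        dualTensorFun_dm (M.right_mem ha hm) hn, dualTensorFun_dm hm hn, smul_comm (d a) (ksign i k),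
        d_smul_dm ha (tm_mem hn hm), smul_smul, smul_smul, rsmul_tm, ksign_add_left,
        ksign_add_right]
      congr 1
      ring)
    (fun c m n => by
      induction m using dm_ind_hom with
      | add v w hv hw => simp only [smul_add, map_add, AddMonoidHom.add_apply, hv, hw]
      | h i m hm =>
      induction c using d_ind_hom with
      | add v w hv hw =>
        simp only [MulOpposite.op_add, add_smul, map_add, hv, hw]
      | h j c hc =>
      induction n using dm_ind_hom with
      | add v w hv hw => simp only [smul_add, map_add, hv, hw]
      | h k n hn =>
      rw [d_rsmul_dm hc hn, map_zsmul,
        dualTensorFun_dm hm (N.left_mem hc hn), dualTensorFun_dm hm hn, smul_comm (op (d c)) (ksign i k),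
        d_rsmul_dm hc (tm_mem hn hm), smul_smul, smul_smul, smul_tm, ksign_add_right,
        ksign_add_right, ksign_comm j i]
      congr 1
      ring)
    (fun {i j m n} hm hn => by
      induction m using dm_ind with
      | h m =>
      induction n using dm_ind with
      | h n =>
      rw [dualTensorFun_dm (dm_mem.1 hm) (dm_mem.1 hn)]
      exact zsmul_mem (dm_mem.2 (add_comm i j ▸ tm_mem (dm_mem.1 hn) (dm_mem.1 hm))) _)

/-- `(n ⊗ m)‾^{op} ↦ (-1)^{|m||n|} m̄^{op} ⊗ n̄^{op}`. -/
noncomputable def dualTensorInv : (N.tensor M).dual →+ M.dual.tensor N.dual :=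
  (lift (dualTensorInvFun N M) fun n b m => by
    induction m using Z2Graded.ind with
    | add v w hv hw => simp only [smul_add, map_add, hv, hw]
    | hom i m hm =>
    induction b using Z2Graded.ind with
    | add v w hv hw =>
      simp only [MulOpposite.op_add, add_smul, map_add, AddMonoidHom.add_apply, hv, hw]
    | hom j b hb =>
    induction n using Z2Graded.ind with
    | add v w hv hw => simp only [smul_add, map_add, AddMonoidHom.add_apply, hv, hw]
    | hom k n hn =>
    rw [dualTensorInvFun_apply hm (N.right_mem hb hn), dualTensorInvFun_apply (M.left_mem hb hm) hn]
    have h := tm_smul (dm m) (d b) (dm n)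
    rw [d_rsmul_dm hb hm, d_smul_dm hb hn, map_zsmul, map_zsmul, AddMonoidHom.smul_apply] at h
    have h' := congrArg (fun z => (ksign k i * ksign j k * ksign j i) • z) h
    simp only [smul_smul] at h'
    rw [show ksign k i * ksign j k * ksign j i * ksign j i = ksign k (j + i) by
      clear * -; revert i j k; decide] at h'
    rw [show ksign k i * ksign j k * ksign j i * ksign j k = ksign (j + k) i by
      clear * -; revert i j k; decide] at h'
    exact h'.symm).comp dm.symm.toAddMonoidHom

variable {N M}
theorem dualTensorHom_tm {i j : ZMod 2} {m : M} {n : N} (hm : m ∈ gr (V := M) i)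
    (hn : n ∈ gr (V := N) j) :
    (dualTensorHom N M).hom (tm (dm m) (dm n)) = ksign i j • dm (tm n m) := dualTensorFun_dm hm hn
theorem dualTensorInv_tm {i j : ZMod 2} {m : M} {n : N} (hm : m ∈ gr (V := M) i)
    (hn : n ∈ gr (V := N) j) :
    dualTensorInv N M (dm (tm n m)) = ksign j i • tm (dm m) (dm n) := dualTensorInvFun_apply hm hn

theorem dual_tensor_ind {p : (N.tensor M).dual → Prop}
    (h : ∀ i j, ∀ n ∈ gr (V := N) i, ∀ m ∈ gr (V := M) j, p (dm (tm n m)))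
    (add : ∀ x y, p x → p y → p (x + y)) (x : (N.tensor M).dual) : p x := by
  induction x using dm_ind with
  | h x => exact SBimod.ind_hom (p := fun x => p (dm x)) h (fun x y => add (dm x) (dm y)) x

theorem tensor_dual_ind {p : M.dual.tensor N.dual → Prop}
    (h : ∀ i j, ∀ n ∈ gr (V := N) i, ∀ m ∈ gr (V := M) j, p (tm (dm m) (dm n)))
    (add : ∀ x y, p x → p y → p (x + y)) (x : M.dual.tensor N.dual) : p x :=
  SBimod.ind_hom (N := M.dual) (M := N.dual) (fun i j m hm n hn => h j i n hn m hm) add x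

variable (N M)
/-- `(n ⊗ m)‾^{op} ↦ (-1)^{|m||n|} m̄^{op} ⊗ n̄^{op}`. -/
noncomputable def dualTensor : (N.tensor M).dual ≅ M.dual.tensor N.dual :=
  (isoOfHom (dualTensorHom N M) (dualTensorInv N M)
    (fun x => by
      induction x using tensor_dual_ind with
      | add x y hx hy => simp only [map_add, hx, hy]
      | h i j n hn m hm =>
        rw [dualTensorHom_tm hm hn, map_zsmul, dualTensorInv_tm hm hn, smul_smul, ksign_comm i j,
          ksign_sq, one_smul])
    (fun x => by
      induction x using dual_tensor_ind with
      | add x y hx hy => simp only [map_add, hx, hy]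
      | h i j n hn m hm =>
        rw [dualTensorInv_tm hm hn, map_zsmul, dualTensorHom_tm hm hn, smul_smul, ksign_comm j i,
          ksign_sq, one_smul])).symm

variable {N M}
theorem dualTensor_hom {i j : ZMod 2} {m : M} {n : N} (hm : m ∈ gr (V := M) i)
    (hn : n ∈ gr (V := N) j) :
    (dualTensor N M).hom.hom (dm (tm n m)) = ksign i j • tm (dm m) (dm n) :=
  (dualTensorInv_tm hm hn).trans (by rw [ksign_comm])
theorem dualTensor_inv {i j : ZMod 2} {m : M} {n : N} (hm : m ∈ gr (V := M) i)
    (hn : n ∈ gr (V := N) j) :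
    (dualTensor N M).inv.hom (tm (dm m) (dm n)) = ksign i j • dm (tm n m) :=
  dualTensorHom_tm hm hn

theorem dual_tensor_ext {P : SBimod A.dual C.dual} {f g : (N.tensor M).dual ⟶ P}
    (h : ∀ i j, ∀ n ∈ gr (V := N) i, ∀ m ∈ gr (V := M) j,
      f.hom (dm (tm n m)) = g.hom (dm (tm n m))) : f = g := by
  refine hom_ext fun x => ?_
  induction x using dual_tensor_ind with
  | add x y hx hy => simp only [map_add, hx, hy]
  | h i j n hn m hm => exact h i j n hn m hm

theorem tensor_dual_ext {P : SBimod A.dual C.dual} {f g : M.dual.tensor N.dual ⟶ P}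
    (h : ∀ i j, ∀ n ∈ gr (V := N) i, ∀ m ∈ gr (V := M) j,
      f.hom (tm (dm m) (dm n)) = g.hom (tm (dm m) (dm n))) : f = g := by
  refine hom_ext fun x => ?_
  induction x using tensor_dual_ind with
  | add x y hx hy => simp only [map_add, hx, hy]
  | h i j n hn m hm => exact h i j n hn m hm
end

/-- The underlying group of `unit A`. -/
def UnitC (A : SAlg.{u}) : Type u := A
/-- The underlying group of `unitInv A`. -/
def UnitInvC (A : SAlg.{u}) : Type u := A
noncomputable instance : AddCommGroup (UnitC A) := inferInstanceAs (AddCommGroup A)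
noncomputable instance : AddCommGroup (UnitInvC A) := inferInstanceAs (AddCommGroup A)
noncomputable instance : Z2Graded (UnitC A) := inferInstanceAs (Z2Graded A)
noncomputable instance : Z2Graded (UnitInvC A) := inferInstanceAs (Z2Graded A)
noncomputable instance : Module A.dual.dual (UnitC A) :=
  Module.compHom A (dd A).symm.toRingHom
noncomputable instance : Module Aᵐᵒᵖ (UnitC A) := inferInstanceAs (Module Aᵐᵒᵖ A)
noncomputable instance : Module A (UnitInvC A) := inferInstanceAs (Module A A)
noncomputable instance : Module (A.dual.dual)ᵐᵒᵖ (UnitInvC A) :=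
  Module.compHom A (RingEquiv.op (dd A).symm).toRingHom

/-- The `(A, A)`-bimodule `A`, as a bimodule over the double conjugate opposite of `A` and `A`. -/
noncomputable def unit (A : SAlg.{u}) : SBimod A.dual.dual A where
  carrier := UnitC A
  smulComm := ⟨fun a b x => mul_assoc (G := A) ((dd A).symm a) x (unop b) |>.symm⟩
  central c x := by
    have h : (dd A).symm (algebraMap ℂ A.dual.dual c) = algebraMap ℂ A c := by
      rw [dd_algebraMap, RingEquiv.symm_apply_apply]
    refine (congrArg (fun y : A => y * (show A from x)) h).trans (Algebra.commutes (A := A) c x)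
  left_mem ha hx := A.mul_mem (dd_symm_mem ha) hx
  right_mem {i j _ _} ha hx := add_comm i j ▸ A.mul_mem hx ha

/-- The `(A, A)`-bimodule `A`, as a bimodule over `A` and the double conjugate opposite of `A`. -/
noncomputable def unitInv (A : SAlg.{u}) : SBimod A A.dual.dual where
  carrier := UnitInvC A
  smulComm := ⟨fun a b x => mul_assoc (G := A) a x ((dd A).symm (unop b)) |>.symm⟩
  central c x := by
    have h : (dd A).symm (algebraMap ℂ A.dual.dual c) = algebraMap ℂ A c := by
      rw [dd_algebraMap, RingEquiv.symm_apply_apply]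
    refine (Algebra.commutes (A := A) c x).trans (congrArg (fun y : A => (show A from x) * y) h).symm
  left_mem ha hx := A.mul_mem ha hx
  right_mem {i j _ _} ha hx := add_comm i j ▸ A.mul_mem hx (dd_symm_mem ha)

/-- The elements of `unit A` are those of `A`. -/
def un : A ≃+ unit A := AddEquiv.refl _
theorem un_ind {p : unit A → Prop} (h : ∀ a, p (un a)) (x : unit A) : p x := h x
theorem un_mem {i : ZMod 2} {a : A} : un a ∈ gr (V := unit A) i ↔ a ∈ gr (V := A) i := Iff.rfl
@[simp] theorem rsmul_un (b a : A) : op b • un a = un (a * b) := rfl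
@[simp] theorem smul_un (b a : A) : dd A b • un a = un (b * a) := rfl

/-- The elements of `unitInv A` are those of `A`. -/
def ui : A ≃+ unitInv A := AddEquiv.refl _
theorem ui_ind {p : unitInv A → Prop} (h : ∀ a, p (ui a)) (x : unitInv A) : p x := h x
theorem ui_mem {i : ZMod 2} {a : A} : ui a ∈ gr (V := unitInv A) i ↔ a ∈ gr (V := A) i := Iff.rfl
@[simp] theorem smul_ui (b a : A) : b • ui a = ui (b * a) := rfl
@[simp] theorem rsmul_ui (b a : A) : op (dd A b) • ui a = ui (a * b) := rfl

/-- `unitInv A ⊗ unit A ≅ A`. -/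
noncomputable def unitInvUnit (A : SAlg.{u}) : (unitInv A).tensor (unit A) ≅ regular A :=
  isoOfHom
    (homMk (P := regular A)
      (((AddMonoidHom.mul (R := A)).comp ui.symm.toAddMonoidHom).compl₂ un.symm.toAddMonoidHom
        |>.compr₂ reg.toAddMonoidHom)
      (fun n b m => mul_assoc (G := A) n ((dd A).symm b) m)
      (fun c n m => mul_assoc (G := A) c n m) (fun a n m => (mul_assoc (G := A) n m a).symm)
      (fun hn hm => A.mul_mem hn hm))
    (fun x => tm (ui 1) (un (reg.symm x)))
    (fun x => by
      induction x using SBimod.ind with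
      | add x y hx hy => simp only [map_add, hx, hy]
      | h n m =>
        induction n using ui_ind with
        | h n =>
        induction m using un_ind with
        | h m =>
        change tm (ui 1) (un (n * m)) = tm (ui n) (un m)
        rw [← smul_un, ← tm_smul, rsmul_ui, one_mul])
    (fun x => one_mul (M := A) x)

/-- `unit A ⊗ unitInv A` is the identity bimodule of the double conjugate opposite of `A`. -/
noncomputable def unitUnitInv (A : SAlg.{u}) : (unit A).tensor (unitInv A) ≅ regular A.dual.dual :=
  isoOfHom
    (homMk (P := regular A.dual.dual)
      (((AddMonoidHom.mul (R := A)).comp un.symm.toAddMonoidHom).compl₂ ui.symm.toAddMonoidHom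
        |>.compr₂ ((dd A).toAddEquiv.trans reg).toAddMonoidHom)
      (fun n b m => congrArg (dd A) (mul_assoc (G := A) n b m))
      (fun c n m => by
        induction c using dd_ind with
        | h c =>
        exact (congrArg (dd A) (mul_assoc (G := A) c n m)).trans (map_mul (dd A) _ _))
      (fun c n m => by
        induction c using dd_ind with
        | h c =>
        exact (congrArg (dd A) (mul_assoc (G := A) n m c).symm).trans (map_mul (dd A) _ _))
      (fun hn hm => dd_mem (A.mul_mem hn hm)))
    (fun x => tm (un 1) (ui ((dd A).symm (reg.symm x))))
    (fun x => by
      induction x using SBimod.ind with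
      | add x y hx hy => simp only [map_add, hx, hy]
      | h n m =>
        induction n using un_ind with
        | h n =>
        induction m using ui_ind with
        | h m =>
        change tm (un 1) (ui (n * m)) = tm (un n) (ui m)
        rw [← smul_ui, ← tm_smul, rsmul_un, one_mul])
    (fun x => one_mul (M := A) x)

theorem dd_smul (b : B) (m : M) : dd B b • dm (dm m) = dm (dm (b • m)) := by
  rw [dd_apply]
  induction b using Z2Graded.ind with
  | add v w hv hw => simp only [add_smul, map_add, hv, hw]
  | hom i b hb =>
  induction m using Z2Graded.ind with
  | add v w hv hw => simp only [smul_add, map_add, hv, hw]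
  | hom j m hm =>
  rw [d_smul_dm (d_mem hb) (dm_mem.2 hm), d_rsmul_dm hb hm, map_zsmul, smul_smul, ksign_sq,
    one_smul]

theorem dd_rsmul (a : A) (m : M) : op (dd A a) • dm (dm m) = dm (dm (op a • m)) := by
  rw [dd_apply]
  induction a using Z2Graded.ind with
  | add v w hv hw => simp only [MulOpposite.op_add, add_smul, map_add, hv, hw]
  | hom i b hb =>
  induction m using Z2Graded.ind with
  | add v w hv hw => simp only [smul_add, map_add, hv, hw]
  | hom j m hm =>
  rw [d_rsmul_dm (d_mem hb) (dm_mem.2 hm), d_smul_dm hb hm, map_zsmul, smul_smul, ksign_sq,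
    one_smul]

/-- The map `b ⊗ m ↦ (b • m) ⊗ 1`, where `b • m` is viewed in the double conjugate opposite. -/
noncomputable def unitNatHom (M : SBimod B A) :
    (unit B).tensor M ⟶ M.dual.dual.tensor (unit A) :=
  homMk (((AddMonoidHom.mk' (fun b : B => DistribSMul.toAddMonoidHom M b)
      fun b b' => by ext m; exact add_smul b b' m).comp un.symm.toAddMonoidHom).compr₂
      ((tm (N := M.dual.dual) (M := unit A)).flip (un 1) |>.comp
        ((dm (M := M)).trans (dm (M := M.dual))).toAddMonoidHom))
    (fun n b m => congrArg (fun x => tm (dm (dm x)) (un 1)) (mul_smul (α := B) n b m))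
    (fun c n m => by
      induction c using dd_ind with
      | h c =>
      induction n using un_ind with
      | h n =>
      change tm (dm (dm ((c * n) • m))) (un 1) = tm (dd B c • dm (dm (n • m))) (un 1)
      rw [dd_smul, mul_smul])
    (fun a n m => by
      induction n using un_ind with
      | h n =>
      change tm (dm (dm (n • op a • m))) (un 1) = tm (dm (dm (n • m))) (un (1 * a))
      rw [one_mul, ← mul_one a, ← smul_un, ← tm_smul, dd_rsmul, smul_comm, mul_one])
    (fun {i j n m} hn hm => by
      have h := tm_mem (N := M.dual.dual) (M := unit A) (n := dm (dm (un.symm n • m))) (m := un 1)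
        (M.left_mem hn hm) A.one_mem
      rw [add_zero] at h
      exact h)

@[simp] theorem unitNatHom_tm (b : B) (m : M) :
    (unitNatHom M).hom (tm (un b) m) = tm (dm (dm (b • m))) (un 1) := rfl

/-- The map `m ⊗ a ↦ 1 ⊗ (m • a)`. -/
noncomputable def unitNatInv (M : SBimod B A) :
    M.dual.dual.tensor (unit A) →+ (unit B).tensor M :=
  lift ((((AddMonoidHom.mk' (fun a : A => DistribSMul.toAddMonoidHom M (op a))
      fun b b' => by ext m; exact add_smul (op b) (op b') m).comp un.symm.toAddMonoidHom).compr₂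
      (tm (N := unit B) (un 1))).flip.comp
        ((dm (M := M)).trans (dm (M := M.dual))).symm.toAddMonoidHom)
    (fun m a x => by
      induction a using dd_ind with
      | h a =>
      induction m using dm_ind with
      | h m =>
      induction m using dm_ind with
      | h m =>
      induction x using un_ind with
      | h x =>
      rw [dd_rsmul, smul_un]
      change tm (un 1) (op x • op a • m) = tm (un 1) (op (a * x) • m)
      rw [op_mul, mul_smul])

@[simp] theorem unitNatInv_tm (a : A) (m : M) :
    (unitNatInv M) (tm (dm (dm m)) (un a)) = tm (un 1) (op a • m) := rfl

/-- The naturality isomorphism of the unit of the double dual. -/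
noncomputable def unitNat (M : SBimod B A) : (unit B).tensor M ≅ M.dual.dual.tensor (unit A) :=
  isoOfHom (unitNatHom M) (unitNatInv M)
    (fun x => by
      induction x using SBimod.ind with
      | add x y hx hy => simp only [map_add, hx, hy]
      | h n m =>
      induction n using un_ind with
      | h n =>
      rw [unitNatHom_tm, unitNatInv_tm, op_one, one_smul, ← tm_smul, rsmul_un, one_mul])
    (fun x => by
      induction x using SBimod.ind with
      | add x y hx hy => simp only [map_add, hx, hy]
      | h m n =>
      induction n using un_ind with
      | h n =>
      induction m using dm_ind with
      | h m =>
      induction m using dm_ind with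
      | h m =>
      rw [unitNatInv_tm, unitNatHom_tm, one_smul, ← dd_rsmul, tm_smul, smul_un, mul_one])

@[simp] theorem unitNat_hom_tm (b : B) (m : M) :
    (unitNat M).hom.hom (tm (un b) m) = tm (dm (dm (b • m))) (un 1) := rfl
@[simp] theorem unitNat_inv_tm (a : A) (m : M) :
    (unitNat M).inv.hom (tm (dm (dm m)) (un a)) = tm (un 1) (op a • m) := rfl

theorem d_smul_dun {x a : A} {i j : ZMod 2} (ha : a ∈ gr (V := A) i)
    (hx : x ∈ gr (V := A) j) :
    d a • dm (un x) = ksign i j • dm (un (x * a)) := d_smul_dm ha (un_mem.2 hx)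

theorem d_rsmul_dun {x a : A} {i j : ZMod 2} (ha : a ∈ gr (V := A) i)
    (hx : x ∈ gr (V := A) j) :
    op (d (dd A a)) • dm (un x) = ksign i j • dm (un (a * x)) := d_rsmul_dm (dd_mem ha) (un_mem.2 hx)

/-- The isomorphism `x‾ ⊗ y ↦ x‾ y` which relates the units of `Ā^{op}` and of `A`. -/
noncomputable def theta (A : SAlg.{u}) : (unit A).dual.tensor (unit A.dual) ≅ regular A.dual :=
  isoOfHom
    (homMk (P := regular A.dual)
      (((AddMonoidHom.mul (R := A.dual)).comp
        ((dm.symm.trans un.symm).trans d).toAddMonoidHom).compl₂ un.symm.toAddMonoidHom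
        |>.compr₂ reg.toAddMonoidHom)
      (fun n b m => by
        induction m using un_ind with
        | h m =>
        induction b using dd_ind with
        | h b =>
        induction b using d_ind_hom with
        | add v w hv hw =>
          simp only [MulOpposite.op_add, add_smul, map_add, AddMonoidHom.add_apply, hv, hw]
        | h i b hb =>
        induction n using dm_ind_hom with
        | add v w hv hw => simp only [smul_add, map_add, AddMonoidHom.add_apply, hv, hw]
        | h j n hn =>
        induction n using un_ind with
        | h n =>
        rw [smul_un]
        have h := d_rsmul_dun hb (un_mem.1 hn)
        rw [dd_apply] at h ⊢
        rw [h, map_zsmul, AddMonoidHom.smul_apply]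
        change ksign i j • reg (d (b * n) * m) = reg (d n * (d b * m))
        rw [← mul_assoc, d_mul (un_mem.1 hn) hb, smul_mul_assoc, map_zsmul, ksign_comm j i])
      (fun a n m => by
        induction m using un_ind with
        | h m =>
        induction a using d_ind_hom with
        | add v w hv hw => simp only [add_smul, map_add, AddMonoidHom.add_apply, hv, hw]
        | h i a ha =>
        induction n using dm_ind_hom with
        | add v w hv hw => simp only [smul_add, map_add, AddMonoidHom.add_apply, hv, hw]
        | h j n hn =>
        induction n using un_ind with
        | h n =>
        rw [d_smul_dun ha (un_mem.1 hn), map_zsmul, AddMonoidHom.smul_apply]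
        change ksign i j • reg (d (n * a) * m) = reg (d a * (d n * m))
        rw [← mul_assoc, d_mul ha (un_mem.1 hn), smul_mul_assoc, map_zsmul])
      (fun a n m => (mul_assoc (G := A.dual) (d (un.symm (dm.symm n))) m a).symm)
      (fun hn hm => A.dual.mul_mem hn hm))
    (fun x => tm (dm (un 1)) (un (reg.symm x)))
    (fun x => by
      induction x using SBimod.ind with
      | add x y hx hy => simp only [map_add, hx, hy]
      | h n m =>
        induction m using un_ind with
        | h m =>
        induction n using dm_ind_hom with
        | add v w hv hw => simp only [map_add, AddMonoidHom.add_apply, hv, hw]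
        | h i n hn =>
        induction n using un_ind with
        | h n =>
        change tm (dm (un 1)) (un (d n * m)) = tm (dm (un n)) (un m)
        rw [← smul_un, ← tm_smul, dd_apply]
        have h := d_rsmul_dun (un_mem.1 hn) A.one_mem
        rw [dd_apply] at h
        rw [h, ksign_zero_right, one_smul, mul_one])
    (fun x => one_mul (M := A.dual) x)

@[simp] theorem theta_hom_tm (a : A) (b : A.dual) :
    (theta A).hom.hom (tm (dm (un a)) (un b)) = reg (d a * b) := rfl
@[simp] theorem theta_inv (a : A.dual) :
    (theta A).inv.hom (reg a) = tm (dm (un 1)) (un a) := rfl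

end SBimod

end

section

open Z2Graded SBimod

/-- The duality `A ↦ Ā^{op}` on the Morita bicategory of complex superalgebras. -/
noncomputable def SAlg.duality : Duality SAlg.{u} where
  obj A := A.dual
  map M := SBimod.dual M
  map₂ η := dualMap η
  map₂_id _ := by
    refine dual_ext fun _ => ?_
    rfl
  map₂_comp _ _ := by
    refine dual_ext fun _ => ?_
    rfl
  mapId A := dualId A
  mapComp M N := dualTensor N M
  map₂_whisker_left M N N' η := by
    refine dual_tensor_ext (N := N) (M := M) fun i j n hn m hm => ?_
    change dm (tm (η.hom n) m) =
      (dualTensor N' M).inv.hom ((tensorMap (𝟙 _) (dualMap η)).hom ((dualTensor N M).hom.hom (dm (tm n m))))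
    rw [dualTensor_hom hm hn, map_zsmul, tensorMap_tm, map_zsmul, dualMap_dm, id_hom,
      dualTensor_inv hm (η.map_mem hn), smul_smul, ksign_sq, one_smul]
  map₂_whisker_right {_ _ _ M M'} η N := by
    refine dual_tensor_ext (N := N) (M := M) fun i j n hn m hm => ?_
    change dm (tm n (η.hom m)) =
      (dualTensor N M').inv.hom ((tensorMap (dualMap η) (𝟙 _)).hom ((dualTensor N M).hom.hom (dm (tm n m))))
    rw [dualTensor_hom hm hn, map_zsmul, tensorMap_tm, map_zsmul, dualMap_dm, id_hom,
      dualTensor_inv (η.map_mem hm) hn, smul_smul, ksign_sq, one_smul]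
  map₂_associator M N P := by
    refine dual_ext (M := P.tensor (N.tensor M)) fun x => ?_
    induction x using SBimod.ind with
    | add x y hx hy => simp only [map_add, hx, hy]
    | h p x =>
    induction x using SBimod.ind_hom with
    | add x y hx hy => simp only [map_add, hx, hy]
    | h j k n hn m hm =>
    induction p using Z2Graded.ind with
    | add x y hx hy => simp only [map_add, AddMonoidHom.add_apply, hx, hy]
    | hom i p hp =>
    change dm (tm (tm p n) m) = (dualTensor (P.tensor N) M).inv.hom
      ((tensorMap (𝟙 M.dual) (dualTensor P N).inv).hom ((assoc M.dual N.dual P.dual).inv.hom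
        ((tensorMap (dualTensor N M).hom (𝟙 P.dual)).hom
          ((dualTensor P (N.tensor M)).hom.hom (dm (tm p (tm n m)))))))
    rw [dualTensor_hom (tm_mem hn hm) hp, map_zsmul, tensorMap_tm, dualTensor_hom hm hn]
    simp only [map_zsmul, AddMonoidHom.smul_apply]
    rw [id_hom, assoc_inv_tm, tensorMap_tm, dualTensor_inv hn hp, id_hom, map_zsmul, map_zsmul,
      dualTensor_inv hm (tm_mem hp hn)]
    simp only [smul_smul]
    rw [show ksign (j + k) i * (ksign k j * (ksign j i * ksign k (i + j))) = 1 by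
      clear * -; revert i j k; decide, one_smul]
  map₂_left_unitor {A B} M := by
    refine dual_tensor_ext (N := M) (M := regular A) fun i j m hm a ha => ?_
    induction a using reg_ind with
    | h a =>
    change dm (op a • m) =
      (leftUnit M.dual).hom.hom ((tensorMap (dualId A).hom (𝟙 _)).hom
        ((dualTensor M (regular A)).hom.hom (dm (tm m (reg a)))))
    rw [dualTensor_hom ha hm, map_zsmul, tensorMap_tm, map_zsmul, dualId_hom, id_hom,
      leftUnit_hom_tm, d_smul_dm (reg_mem.1 ha) hm, smul_smul, ksign_sq, one_smul]
  map₂_right_unitor {A B} M := by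
    refine dual_tensor_ext (N := regular B) (M := M) fun i j b hb m hm => ?_
    induction b using reg_ind with
    | h b =>
    change dm (b • m) =
      (rightUnit M.dual).hom.hom ((tensorMap (𝟙 _) (dualId B).hom).hom
        ((dualTensor (regular B) M).hom.hom (dm (tm (reg b) m))))
    rw [dualTensor_hom hm hb, map_zsmul, tensorMap_tm, map_zsmul, dualId_hom, id_hom,
      rightUnit_hom_tm, d_rsmul_dm (reg_mem.1 hb) hm, smul_smul, ksign_comm j i, ksign_sq, one_smul]
  e A := unit A
  e_equiv A := ⟨unitInv A, ⟨unitInvUnit A⟩, ⟨unitUnitInv A⟩⟩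
  nat M := unitNat M
  nat_naturality {A B M M'} η := by
    refine tensor_ext (N := unit B) (M := M) fun b m => ?_
    induction b using un_ind with
    | h b =>
    change tm (dm (dm (b • η.hom m))) (un 1) = tm (dm (dm (η.hom (b • m)))) (un 1)
    rw [η.map_smul]
  nat_id A := by
    refine tensor_ext (N := unit A) (M := regular A) fun b a => ?_
    induction b using un_ind with
    | h b =>
    induction a using reg_ind with
    | h a =>
    change tm (reg (dd A (b * a))) (un 1) = tm (reg (1 : A.dual.dual)) (un (b * a))
    rw [← one_mul (dd A (b * a)), ← rsmul_reg, tm_smul, smul_un, mul_one]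
  nat_comp {A B C} M N := by
    refine tensor_ext (N := unit C) (M := N.tensor M) fun c x => ?_
    induction c using un_ind with
    | h c =>
    induction x using SBimod.ind with
    | add x y hx hy => simp only [map_add, hx, hy]
    | h n m =>
    change (tensorMap (dualMap (dualTensor N M).hom ≫ (dualTensor M.dual N.dual).hom)
        (𝟙 (unit A))).hom (tm (dm (dm (tm (c • n) m))) (un 1)) =
      (assoc N.dual.dual M.dual.dual (unit A)).hom.hom
        ((tensorMap (𝟙 N.dual.dual) (unitNat M).hom).hom
          ((assoc N.dual.dual (unit B) M).inv.hom (tm (tm (dm (dm (c • n))) (un 1)) m)))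
    rw [assoc_inv_tm, tensorMap_tm, tensorMap_tm, unitNat_hom_tm, one_smul, assoc_hom_tm, id_hom,
      id_hom, comp_hom, dualMap_dm]
    congr 2
    generalize c • n = n
    induction n using Z2Graded.ind with
    | add x y hx hy => simp only [map_add, AddMonoidHom.add_apply, hx, hy]
    | hom i n hn =>
    induction m using Z2Graded.ind with
    | add x y hx hy => simp only [map_add, hx, hy]
    | hom j m hm =>
    rw [dualTensor_hom hm hn, map_zsmul, map_zsmul,
      dualTensor_hom (dm_mem.2 hn) (dm_mem.2 hm), smul_smul, ksign_comm i j, ksign_sq, one_smul]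
  θ A := theta A
  θ_naturality {A B} M := by
    refine tensor_ext (N := (unit A).dual.tensor (unit A.dual)) (M := M.dual) fun x m => ?_
    induction x using SBimod.ind with
    | add x y hx hy => simp only [map_add, AddMonoidHom.add_apply, hx, hy]
    | h x y =>
    induction x using dm_ind with
    | h x =>
    induction x using un_ind with
    | h x =>
    induction y using un_ind with
    | h y =>
    change (d x * y) • m = (rightUnit M.dual).hom.hom ((tensorMap (𝟙 M.dual) (theta B).hom).hom
      ((assoc M.dual (unit B).dual (unit B.dual)).inv.hom
        ((tensorMap ((dualTensor M.dual.dual (unit A)).inv ≫ dualMap (unitNat M).inv ≫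
          (dualTensor (unit B) M).hom) (𝟙 (unit B.dual))).hom
          (tm (tm (dm (un x)) (dm (dm (y • m)))) (un 1)))))
    rw [mul_smul, tensorMap_tm]
    generalize y • m = m'
    have h : ((dualTensor M.dual.dual (unit A)).inv ≫ dualMap (unitNat M).inv ≫
        (dualTensor (unit B) M).hom).hom (tm (dm (un x)) (dm (dm m'))) =
        tm (d x • m') (dm (un 1)) := by
      induction m' using dm_ind_hom with
      | add x y hx hy => simp only [map_add, AddMonoidHom.add_apply, smul_add, hx, hy]
      | h j m hm =>
      induction x using Z2Graded.ind with
      | add x y hx hy => simp only [map_add, AddMonoidHom.add_apply, add_smul, hx, hy]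
      | hom i x hx =>
      rw [comp_hom, comp_hom, dualTensor_inv (un_mem.2 hx) (dm_mem.2 (dm_mem.2 hm)), map_zsmul,
        map_zsmul, dualMap_dm, unitNat_inv_tm, dualTensor_hom (M.right_mem hx hm)
          (un_mem.2 B.one_mem), ksign_zero_right, one_smul, d_smul_dm hx hm, map_zsmul,
        AddMonoidHom.smul_apply]
    rw [h, assoc_inv_tm, tensorMap_tm, id_hom, id_hom, theta_hom_tm, rightUnit_hom_tm, mul_one,
      d_one, op_one, one_smul]
  swallowtail A := by
    refine tensor_ext (N := (unit A.dual).dual.tensor (unit A.dual.dual)) (M := unit A)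
      fun x y => ?_
    induction x using SBimod.ind with
    | add x y hx hy => simp only [map_add, AddMonoidHom.add_apply, hx, hy]
    | h x z =>
    induction x using dm_ind with
    | h x =>
    induction x using un_ind with
    | h x =>
    induction x using d_ind with
    | h x =>
    induction z using un_ind with
    | h z =>
    induction z using dd_ind with
    | h z =>
    induction y using un_ind with
    | h y =>
    change (leftUnit (unit A)).hom.hom (tm (reg (d (d x) * dd A z)) (un y)) =
      (leftUnit (unit A)).hom.hom ((tensorMap
        ((dualTensor (unit A).dual (unit A.dual)).inv ≫ dualMap (theta A).hom ≫ (dualId A.dual).hom)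
          (𝟙 (unit A))).hom
        ((assoc (unit A.dual).dual (unit A).dual.dual (unit A)).hom.hom
          (tm (dm (un (d x))) (tm (dm (dm (dd A z • un y))) (un 1)))))
    rw [assoc_hom_tm, tensorMap_tm, leftUnit_hom_tm, id_hom, smul_un]
    have h : ((dualTensor (unit A).dual (unit A.dual)).inv ≫ dualMap (theta A).hom ≫
        (dualId A.dual).hom).hom (tm (dm (un (d x))) (dm (dm (un (z * y))))) =
        reg (dd A (x * (z * y))) := by
      generalize z * y = y'
      induction x using Z2Graded.ind with
      | add x y hx hy => simp only [map_add, AddMonoidHom.add_apply, add_mul, hx, hy]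
      | hom i x hx =>
      induction y' using Z2Graded.ind with
      | add x y hx hy => simp only [map_add, mul_add, hx, hy]
      | hom j y' hy =>
      rw [comp_hom, comp_hom, dualTensor_inv (un_mem.2 (d_mem hx)) (dm_mem.2 (un_mem.2 hy)),
        map_zsmul, map_zsmul, dualMap_dm, theta_hom_tm, d_mul hy hx, map_zsmul, map_zsmul,
        map_zsmul, dualId_hom, smul_smul, ksign_comm j i, ksign_sq, one_smul]
      rfl
    rw [h, leftUnit_hom_tm, smul_un, mul_one, mul_smul, smul_un]
    exact smul_un x (z * y)

end

section

/-- A 1-morphism is an equivalence if it has an inverse up to invertible 2-morphisms. -/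
def IsEquiv1 {B : Type u} [Bicategory.{w, v} B] {a b : B} (f : a ⟶ b) : Prop :=
  ∃ g : b ⟶ a, Nonempty (f ≫ g ≅ 𝟙 a) ∧ Nonempty (g ≫ f ≅ 𝟙 b)

theorem IsEquiv1.id {B : Type u} [Bicategory.{w, v} B] (a : B) : IsEquiv1 (𝟙 a) :=
  ⟨𝟙 a, ⟨λ_ _⟩, ⟨λ_ _⟩⟩

theorem IsEquiv1.comp {B : Type u} [Bicategory.{w, v} B] {a b c : B} {f : a ⟶ b} {g : b ⟶ c}
    (hf : IsEquiv1 f) (hg : IsEquiv1 g) : IsEquiv1 (f ≫ g) := by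
  obtain ⟨f', ⟨i⟩, ⟨j⟩⟩ := hf
  obtain ⟨g', ⟨k⟩, ⟨l⟩⟩ := hg
  exact ⟨g' ≫ f',
    ⟨α_ _ _ _ ≪≫ whiskerLeftIso f ((α_ _ _ _).symm ≪≫ whiskerRightIso k f' ≪≫ λ_ f') ≪≫ i⟩,
    ⟨α_ _ _ _ ≪≫ whiskerLeftIso g' ((α_ _ _ _).symm ≪≫ whiskerRightIso j g ≪≫ λ_ g) ≪≫ l⟩⟩

/-- The maximal sub-bigroupoid of a bicategory on the objects with the property `P`: its
1-morphisms are the equivalences and its 2-morphisms are the isomorphisms. -/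
structure BiCore (B : Type u) (P : B → Prop) where
  obj : B
  prop : P obj

namespace BiCore
variable {B : Type u} [Bicategory.{w, v} B] {P : B → Prop}

/-- The 1-morphisms of the core. -/
structure Hom (a b : BiCore B P) where
  hom : a.obj ⟶ b.obj
  isEquiv : IsEquiv1 hom

/-- The 2-morphisms of the core. -/
@[ext] structure Hom₂ {a b : BiCore B P} (f g : Hom a b) where
  iso : f.hom ≅ g.hom

instance (a b : BiCore B P) : Category (Hom a b) where
  Hom f g := Hom₂ f g
  id f := ⟨Iso.refl f.hom⟩
  comp η ξ := ⟨η.iso ≪≫ ξ.iso⟩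

theorem ext₂ {a b : BiCore B P} {f g : Hom a b} {η ξ : f ⟶ g} (h : η.iso.hom = ξ.iso.hom) :
    η = ξ := Hom₂.ext (Iso.ext h)

/-- An invertible 2-morphism as an isomorphism of the core. -/
def isoMk {a b : BiCore B P} {f g : Hom a b} (e : f.hom ≅ g.hom) : f ≅ g where
  hom := ⟨e⟩
  inv := ⟨e.symm⟩
  hom_inv_id := ext₂ e.hom_inv_id
  inv_hom_id := ext₂ e.inv_hom_id

/-- An isomorphism in the core as an invertible 2-morphism. -/
def toIso {a b : BiCore B P} {f g : Hom a b} (e : f ≅ g) : f.hom ≅ g.hom := e.hom.iso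

instance : Bicategory (BiCore B P) where
  Hom := Hom
  id a := ⟨𝟙 a.obj, .id _⟩
  comp f g := ⟨f.hom ≫ g.hom, f.isEquiv.comp g.isEquiv⟩
  whiskerLeft f _ _ η := Hom₂.mk (whiskerLeftIso f.hom (Hom₂.iso η))
  whiskerRight η h := Hom₂.mk (whiskerRightIso (Hom₂.iso η) h.hom)
  associator f g h := isoMk (α_ f.hom g.hom h.hom)
  leftUnitor f := isoMk (λ_ f.hom)
  rightUnitor f := isoMk (ρ_ f.hom)
  whiskerLeft_id _ _ := ext₂ (whiskerLeft_id _ _)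
  whiskerLeft_comp _ _ _ _ _ _ := ext₂ (whiskerLeft_comp _ _ _)
  id_whiskerLeft _ := ext₂ (id_whiskerLeft _)
  comp_whiskerLeft _ _ _ _ _ := ext₂ (comp_whiskerLeft _ _ _)
  id_whiskerRight _ _ := ext₂ (id_whiskerRight _ _)
  comp_whiskerRight _ _ _ := ext₂ (comp_whiskerRight _ _ _)
  whiskerRight_id _ := ext₂ (whiskerRight_id _)
  whiskerRight_comp _ _ _ := ext₂ (whiskerRight_comp _ _ _)
  whisker_assoc _ _ _ _ _ := ext₂ (whisker_assoc _ _ _)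
  whisker_exchange _ _ := ext₂ (whisker_exchange _ _)
  pentagon _ _ _ _ := ext₂ (pentagon _ _ _ _)
  triangle _ _ := ext₂ (triangle _ _)

instance {a b : BiCore B P} (f g : a ⟶ b) (η : f ⟶ g) : IsIso η :=
  (isoMk η.iso).isIso_hom

theorem isEquiv1 {a b : BiCore B P} (f : a ⟶ b) : IsEquiv1 f := by
  obtain ⟨g, ⟨i⟩, ⟨j⟩⟩ := f.isEquiv
  exact ⟨⟨g, f.hom, ⟨j⟩, ⟨i⟩⟩, ⟨isoMk i⟩, ⟨isoMk j⟩⟩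

end BiCore

/-- A bicategory is a bigroupoid if its 1-morphisms are equivalences and its 2-morphisms are
invertible. -/
class IsBigroupoid (C : Type u) [Bicategory.{w, v} C] : Prop where
  isIso {a b : C} {f g : a ⟶ b} (η : f ⟶ g) : IsIso η
  isEquiv1 {a b : C} (f : a ⟶ b) : IsEquiv1 f

instance {B : Type u} [Bicategory.{w, v} B] {P : B → Prop} : IsBigroupoid (BiCore B P) where
  isIso _ := inferInstance
  isEquiv1 := BiCore.isEquiv1

namespace Duality
variable {B : Type u} [Bicategory.{w, v} B] (D : Duality B)

/-- The action of a duality on invertible 2-morphisms. -/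
def mapIso {a b : B} {f g : a ⟶ b} (e : f ≅ g) : D.map f ≅ D.map g where
  hom := D.map₂ e.hom
  inv := D.map₂ e.inv
  hom_inv_id := by rw [← D.map₂_comp, e.hom_inv_id, D.map₂_id]
  inv_hom_id := by rw [← D.map₂_comp, e.inv_hom_id, D.map₂_id]

theorem isEquiv1_map {a b : B} {f : a ⟶ b} (h : IsEquiv1 f) : IsEquiv1 (D.map f) := by
  obtain ⟨g, ⟨i⟩, ⟨j⟩⟩ := h
  exact ⟨D.map g, ⟨(D.mapComp g f).symm ≪≫ D.mapIso j ≪≫ D.mapId _⟩,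
    ⟨(D.mapComp f g).symm ≪≫ D.mapIso i ≪≫ D.mapId _⟩⟩

/-- A duality which preserves the property `P` restricts to the core. -/
def core (P : B → Prop) (hP : ∀ a, P a → P (D.obj a)) : Duality (BiCore B P) where
  obj a := ⟨D.obj a.obj, hP _ a.prop⟩
  map f := ⟨D.map f.hom, D.isEquiv1_map f.isEquiv⟩
  map₂ η := ⟨D.mapIso η.iso⟩
  map₂_id f := BiCore.ext₂ (D.map₂_id f.hom)
  map₂_comp η ξ := BiCore.ext₂ (D.map₂_comp _ _)
  mapId a := BiCore.isoMk (D.mapId a.obj)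
  mapComp f g := BiCore.isoMk (D.mapComp f.hom g.hom)
  map₂_whisker_left f _ _ η := BiCore.ext₂ (D.map₂_whisker_left f.hom _)
  map₂_whisker_right η h := BiCore.ext₂ (D.map₂_whisker_right _ h.hom)
  map₂_associator f g h := BiCore.ext₂ (D.map₂_associator f.hom g.hom h.hom)
  map₂_left_unitor f := BiCore.ext₂ (D.map₂_left_unitor f.hom)
  map₂_right_unitor f := BiCore.ext₂ (D.map₂_right_unitor f.hom)
  e a := ⟨D.e a.obj, D.e_equiv _⟩
  e_equiv a := BiCore.isEquiv1 _
  nat f := BiCore.isoMk (D.nat f.hom)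
  nat_naturality η := BiCore.ext₂ (D.nat_naturality _)
  nat_id a := BiCore.ext₂ (D.nat_id a.obj)
  nat_comp f g := BiCore.ext₂ (D.nat_comp f.hom g.hom)
  θ a := BiCore.isoMk (D.θ a.obj)
  θ_naturality f := BiCore.ext₂ (D.θ_naturality f.hom)
  swallowtail a := BiCore.ext₂ (D.swallowtail a.obj)

end Duality

end

section

open Z2Graded SBimod Dl

namespace SAlg
variable (A : SAlg.{u})

/-- Finite-dimensional semisimple superalgebras. -/
def FinSS (A : SAlg.{u}) : Prop := Module.Finite ℂ A ∧ IsSemisimpleRing A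

/-- The map `a ↦ a₀ + c a₁`. -/
noncomputable def twistMap (c : ℂ) : A →+ A :=
  comp 0 + (AddMonoidHom.mulLeft (algebraMap ℂ A c)).comp (comp 1)

variable {A}
theorem twistMap_even (c : ℂ) {a : A} (ha : a ∈ gr (V := A) 0) : A.twistMap c a = a := by
  simp [twistMap, comp_same ha, comp_ne ha zero_ne_one]

theorem twistMap_odd (c : ℂ) {a : A} (ha : a ∈ gr (V := A) 1) :
    A.twistMap c a = algebraMap ℂ A c * a := by
  simp [twistMap, comp_same ha, comp_ne ha one_ne_zero]

theorem algebraMap_mul_odd (c : ℂ) {a : A} (ha : a ∈ gr (V := A) 1) :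
    algebraMap ℂ A c * a ∈ gr (V := A) 1 := by
  simpa using A.mul_mem (A.algebraMap_mem c) ha

theorem twistMap_twistMap {c d : ℂ} (h : c * d = 1) (a : A) :
    A.twistMap c (A.twistMap d a) = a := by
  induction a using Z2Graded.ind with
  | add v w hv hw => simp only [map_add, hv, hw]
  | hom i a ha =>
    induction i using cases2 with
    | h0 => rw [twistMap_even d ha, twistMap_even c ha]
    | h1 => rw [twistMap_odd d ha, twistMap_odd c (algebraMap_mul_odd d ha), ← mul_assoc,
        ← map_mul, h, map_one, one_mul]

theorem twistMap_mul (x y : Dl A) :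
    A.twistMap Complex.I (dl.symm (A.dlMul x y)) =
      A.twistMap Complex.I (dl.symm y) * A.twistMap Complex.I (dl.symm x) := by
  induction x using dl_ind_hom with
  | add v w hv hw => simp only [map_add, AddMonoidHom.add_apply, mul_add, hv, hw]
  | h i a ha =>
  induction y using dl_ind_hom with
  | add v w hv hw => simp only [map_add, add_mul, hv, hw]
  | h j b hb =>
  rw [dlMul_dl ha hb, map_zsmul, map_zsmul, AddEquiv.symm_apply_apply, AddEquiv.symm_apply_apply,
    AddEquiv.symm_apply_apply]
  have hba := A.mul_mem hb ha
  induction i using cases2 with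
  | h0 =>
    rw [ksign_zero_left, one_zsmul, twistMap_even _ ha]
    induction j using cases2 with
    | h0 => rw [twistMap_even _ hb, twistMap_even _ hba]
    | h1 => rw [twistMap_odd _ hb, twistMap_odd _ hba, mul_assoc]
  | h1 =>
    rw [twistMap_odd _ ha]
    induction j using cases2 with
    | h0 =>
      rw [ksign_zero_right, one_zsmul, twistMap_even _ hb, twistMap_odd _ hba, ← mul_assoc,
        ← mul_assoc, Algebra.commutes]
    | h1 =>
      have h2 : (1 : ZMod 2) + 1 = 0 := by decide
      rw [h2] at hba
      rw [twistMap_odd _ hb, twistMap_even _ hba, show ksign 1 1 = -1 by decide,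
        mul_assoc, ← mul_assoc b, ← Algebra.commutes Complex.I b, mul_assoc, ← mul_assoc,
        ← map_mul, Complex.I_mul_I, map_neg, map_one, neg_one_zsmul, neg_one_mul]

variable (A) in
/-- The graded opposite of a superalgebra is isomorphic, as a ring, to the ungraded opposite. -/
noncomputable def dualRingEquiv : Dl A ≃+* Aᵐᵒᵖ where
  toFun x := op (A.twistMap Complex.I (dl.symm x))
  invFun x := dl (A.twistMap (-Complex.I) (unop x))
  left_inv x := congrArg dl (twistMap_twistMap (by simp) (dl.symm x))
  right_inv x := congrArg op (twistMap_twistMap (by simp) (unop x))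
  map_add' x y := congrArg op (map_add (A.twistMap Complex.I) (dl.symm x) (dl.symm y))
  map_mul' x y := congrArg op (twistMap_mul x y)

theorem finite_dl [Module.Finite ℂ A] : Module.Finite ℂ (Dl A) := by
  let f : A →ₛₗ[starRingEnd ℂ] Dl A :=
    { toFun := fun a => dl a
      map_add' := fun _ _ => rfl
      map_smul' := fun c a => by
        rw [Algebra.smul_def, Algebra.smul_def, dl_algebraMap, Complex.conj_conj, Algebra.commutes]
        exact (dlMul_even (A.algebraMap_mem c) a).symm }
  exact Module.Finite.of_surjective f fun x => ⟨x, rfl⟩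

theorem FinSS.dual {A : SAlg.{u}} (h : A.FinSS) : A.dual.FinSS := by
  obtain ⟨h1, h2⟩ := h
  exact ⟨finite_dl (A := A), (dualRingEquiv A).symm.isSemisimpleRing⟩

end SAlg

/-- The Morita bigroupoid of finite-dimensional semisimple complex superalgebras, invertible
bimodules and invertible even bimodule maps. -/
abbrev SAlgFd := BiCore SAlg.{u} SAlg.FinSS

/-- The duality `A ↦ Ā^{op}` on finite-dimensional semisimple superalgebras. -/
noncomputable def SAlgFd.duality : Duality SAlgFd.{u} :=
  SAlg.duality.core SAlg.FinSS fun _ h => h.dual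

end

section

namespace Duality
variable {C : Type u} [Bicategory.{w, v} C] (D : Duality C)

theorem map₂_hom_inv {a b : C} {f g : a ⟶ b} (i : f ≅ g) :
    D.map₂ i.hom ≫ D.map₂ i.inv = 𝟙 _ := (D.mapIso i).hom_inv_id

theorem map₂_inv_hom {a b : C} {f g : a ⟶ b} (i : f ≅ g) :
    D.map₂ i.inv ≫ D.map₂ i.hom = 𝟙 _ := (D.mapIso i).inv_hom_id

theorem map₂_associator_inv {a b c d : C} (f : a ⟶ b) (g : b ⟶ c) (h : c ⟶ d) :
    D.map₂ (α_ f g h).inv = (D.mapComp f (g ≫ h)).hom ≫ (D.mapComp g h).hom ▷ D.map f ≫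
      (α_ (D.map h) (D.map g) (D.map f)).hom ≫ D.map h ◁ (D.mapComp f g).inv ≫
        (D.mapComp (f ≫ g) h).inv := by
  refine (cancel_epi (D.mapIso (α_ f g h)).hom).1 ?_
  change D.map₂ _ ≫ D.map₂ _ = D.map₂ _ ≫ _
  rw [map₂_hom_inv, map₂_associator]
  simp

/-- The `2`-morphism `M̄^{op} → M` obtained from `s : M → M̄^{op}` by applying the duality. -/
def bar {a : C} {M : D.obj a ⟶ a} (s : M ≫ D.e a ⟶ D.map M) : D.map M ⟶ M ≫ D.e a :=
  (λ_ (D.map M)).inv ≫ (D.θ a).inv ▷ D.map M ≫ (α_ _ _ _).hom ≫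
    D.e (D.obj a) ◁ ((D.mapComp M (D.e a)).inv ≫ D.map₂ s) ≫ (D.nat M).inv

/-- `N ⊗ M ⊗ N̄^{op}`. -/
abbrev conj {a b : C} (N : a ⟶ b) (M : D.obj a ⟶ a) : D.obj b ⟶ b := D.map N ≫ M ≫ N

/-- The composite `N ⊗ M ⊗ N̄^{op} → N ⊗ M̄^{op} ⊗ N̄^{op} ≅ (N ⊗ M ⊗ N̄^{op})‾^{op}` whose first
map is `id ⊗ s ⊗ id`. -/
def herm {a b : C} (N : a ⟶ b) {M : D.obj a ⟶ a} (s : M ≫ D.e a ⟶ D.map M) :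
    D.conj N M ≫ D.e b ⟶ D.map (D.conj N M) :=
  (α_ (D.map N) (M ≫ N) (D.e b)).hom ≫
    D.map N ◁ ((α_ M N (D.e b)).hom ≫ M ◁ (D.nat N).hom ≫ (α_ M (D.e a) _).inv ≫
      s ▷ D.map (D.map N)) ≫
    (α_ _ _ _).inv ≫ (D.mapComp M N).inv ▷ D.map (D.map N) ≫ (D.mapComp (D.map N) (M ≫ N)).inv

/-- `(N₂ ⊗ N₁) ⊗ M ⊗ (N₂ ⊗ N₁)‾^{op} ≅ N₂ ⊗ (N₁ ⊗ M ⊗ N̄₁^{op}) ⊗ N̄₂^{op}`. -/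
def conjComp {a b c : C} (N₁ : a ⟶ b) (N₂ : b ⟶ c) (M : D.obj a ⟶ a) :
    D.conj (N₁ ≫ N₂) M ≅ D.conj N₂ (D.conj N₁ M) :=
  whiskerRightIso (D.mapComp N₁ N₂) _ ≪≫ whiskerLeftIso _ (α_ M N₁ N₂).symm ≪≫ α_ _ _ _ ≪≫
    whiskerLeftIso _ (α_ (D.map N₁) (M ≫ N₁) N₂).symm

/-- `A ⊗ M ⊗ Ā^{op} ≅ M`. -/
def conjId {a : C} (M : D.obj a ⟶ a) : D.conj (𝟙 a) M ≅ M :=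
  whiskerRightIso (D.mapId a) _ ≪≫ λ_ _ ≪≫ ρ_ M

theorem herm_naturality {a b : C} (N : a ⟶ b) {M M' : D.obj a ⟶ a} {s : M ≫ D.e a ⟶ D.map M}
    {s' : M' ≫ D.e a ⟶ D.map M'} {φ : M ⟶ M'} (h : s ≫ D.map₂ φ = φ ▷ D.e a ≫ s') :
    D.herm N s ≫ D.map₂ (D.map N ◁ φ ▷ N) = (D.map N ◁ φ ▷ N) ▷ D.e b ≫ D.herm N s' := by
  have h' : φ ▷ D.e a ▷ D.map (D.map N) ≫ s' ▷ D.map (D.map N) =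
      s ▷ D.map (D.map N) ≫ D.map₂ φ ▷ D.map (D.map N) := by
    rw [← comp_whiskerRight, ← comp_whiskerRight, h]
  have e1 : φ ▷ N ▷ D.e b ≫ (α_ M' N (D.e b)).hom ≫ M' ◁ (D.nat N).hom ≫ (α_ M' (D.e a) _).inv ≫
      s' ▷ D.map (D.map N) = (α_ M N (D.e b)).hom ≫ M ◁ (D.nat N).hom ≫ (α_ M (D.e a) _).inv ≫
      s ▷ D.map (D.map N) ≫ D.map₂ φ ▷ D.map (D.map N) := by
    rw [← h', associator_naturality_left_assoc, ← whisker_exchange_assoc,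
      associator_inv_naturality_left_assoc]
  have e2 : (D.map N ◁ φ ▷ N) ▷ D.e b ≫ (α_ (D.map N) (M' ≫ N) (D.e b)).hom =
    (α_ (D.map N) (M ≫ N) (D.e b)).hom ≫ D.map N ◁ φ ▷ N ▷ D.e b := by simp
  simp only [herm, map₂_whisker_left, map₂_whisker_right]
  rw [reassoc_of% e2, ← whiskerLeft_comp_assoc (D.map N) (φ ▷ N ▷ D.e b), e1]
  simp

theorem herm_conjId {a : C} {M : D.obj a ⟶ a} (s : M ≫ D.e a ⟶ D.map M) :
    D.herm (𝟙 a) s ≫ D.map₂ (D.conjId M).hom = (D.conjId M).hom ▷ D.e a ≫ s := by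
  have hn : (D.nat (𝟙 a)).hom = ((λ_ (D.e a)).hom ≫ (ρ_ (D.e a)).inv) ≫ D.e a ◁
      ((D.mapId (D.obj a)).inv ≫ D.map₂ (D.mapId a).inv) := by
    rw [← D.nat_id a, Category.assoc, ← whiskerLeft_comp]
    simp [D.map₂_hom_inv]
  have hm : D.map₂ (D.mapId a).inv ≫ D.map₂ (D.mapId a).hom = 𝟙 _ := D.map₂_inv_hom _
  simp only [herm, conjId, hn, Iso.trans_hom, whiskerRightIso_hom, map₂_comp,
    map₂_whisker_right, map₂_left_unitor, map₂_right_unitor, Category.assoc,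
    Iso.inv_hom_id_assoc]
  calc
    _ = 𝟙 _ ⊗≫ D.map (𝟙 a) ◁ ((M ≫ D.e a) ◁ ((D.mapId (D.obj a)).inv ≫ D.map₂ (D.mapId a).inv) ≫
          s ▷ D.map (D.map (𝟙 a))) ⊗≫ ((D.mapComp M (𝟙 a)).inv ▷ D.map (D.map (𝟙 a)) ≫
          D.map (M ≫ 𝟙 a) ◁ (D.map₂ (D.mapId a).hom ≫ (D.mapId (D.obj a)).hom)) ⊗≫
          (D.mapComp M (𝟙 a)).hom ⊗≫ (D.mapId a).hom ▷ D.map M ⊗≫ 𝟙 _ := by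
      bicategory
    _ = 𝟙 _ ⊗≫ D.map (𝟙 a) ◁ s ⊗≫ (D.map (𝟙 a) ≫ D.map M) ◁ ((D.mapId (D.obj a)).inv ≫
          (D.map₂ (D.mapId a).inv ≫ D.map₂ (D.mapId a).hom) ≫ (D.mapId (D.obj a)).hom) ⊗≫
          ((D.mapComp M (𝟙 a)).inv ≫ (D.mapComp M (𝟙 a)).hom) ⊗≫
          (D.mapId a).hom ▷ D.map M ⊗≫ 𝟙 _ := by
      rw [whisker_exchange s, ← whisker_exchange (D.mapComp M (𝟙 a)).inv]
      bicategory
    _ = 𝟙 _ ⊗≫ (D.map (𝟙 a) ◁ s ≫ (D.mapId a).hom ▷ D.map M) ⊗≫ 𝟙 _ := by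
      rw [hm, Category.id_comp, Iso.inv_hom_id, Iso.inv_hom_id]
      bicategory
    _ = _ := by
      rw [whisker_exchange]
      bicategory

theorem herm_conjComp {a b c : C} (N₁ : a ⟶ b) (N₂ : b ⟶ c) {M : D.obj a ⟶ a}
    (s : M ≫ D.e a ⟶ D.map M) :
    D.herm (N₁ ≫ N₂) s ≫ D.map₂ (D.conjComp N₁ N₂ M).hom =
      (D.conjComp N₁ N₂ M).hom ▷ D.e c ≫ D.herm N₂ (D.herm N₁ s) := by
  have hn : (D.nat (N₁ ≫ N₂)).hom = ((α_ N₁ N₂ (D.e c)).hom ≫ N₁ ◁ (D.nat N₂).hom ≫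
        (α_ N₁ (D.e b) (D.map (D.map N₂))).inv ≫ (D.nat N₁).hom ▷ D.map (D.map N₂) ≫
        (α_ (D.e a) (D.map (D.map N₁)) (D.map (D.map N₂))).hom) ≫ D.e a ◁
      ((D.mapComp (D.map N₂) (D.map N₁)).inv ≫ D.map₂ (D.mapComp N₁ N₂).inv) := by
    rw [← D.nat_comp, Category.assoc, ← whiskerLeft_comp]
    simp [D.map₂_hom_inv]
  have hm : D.map₂ (D.mapComp N₁ N₂).inv ≫ D.map₂ (D.mapComp N₁ N₂).hom = 𝟙 _ := D.map₂_inv_hom _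
  simp only [herm, conjComp, hn, Iso.trans_hom, whiskerRightIso_hom, whiskerLeftIso_hom,
    Iso.symm_hom, map₂_comp, map₂_whisker_right, map₂_whisker_left, map₂_associator,
    map₂_associator_inv, Category.assoc, Iso.inv_hom_id_assoc, comp_whiskerRight,
    inv_hom_whiskerRight_assoc]
  let h := D.map (N₁ ≫ N₂)
  let K := D.map (D.map N₂ ≫ D.map N₁)
  let P := D.map (D.map N₁)
  let Q := D.map (D.map N₂)
  let Z : M ≫ (N₁ ≫ N₂) ≫ D.e c ⟶ D.map M ≫ P ≫ Q :=
    M ◁ ((α_ N₁ N₂ (D.e c)).hom ≫ N₁ ◁ (D.nat N₂).hom ≫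
        (α_ N₁ (D.e b) (D.map (D.map N₂))).inv ≫ (D.nat N₁).hom ▷ D.map (D.map N₂) ≫
        (α_ (D.e a) (D.map (D.map N₁)) (D.map (D.map N₂))).hom) ≫
      (α_ M (D.e a) (P ≫ Q)).inv ≫ s ▷ (P ≫ Q)
  let x := D.mapComp (D.map N₂) (D.map N₁)
  let c' := D.mapComp N₁ N₂
  calc
    _ = 𝟙 _ ⊗≫ h ◁ M ◁ ((α_ N₁ N₂ (D.e c)).hom ≫ N₁ ◁ (D.nat N₂).hom ≫
          (α_ N₁ (D.e b) Q).inv ≫ (D.nat N₁).hom ▷ Q ≫ (α_ (D.e a) P Q).hom) ⊗≫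
          h ◁ ((M ≫ D.e a) ◁ (x.inv ≫ D.map₂ c'.inv) ≫ s ▷ D.map h) ⊗≫
          ((D.mapComp M (N₁ ≫ N₂)).inv ▷ D.map h ≫ D.map (M ≫ N₁ ≫ N₂) ◁ D.map₂ c'.hom) ⊗≫
          (D.mapComp M (N₁ ≫ N₂)).hom ▷ K ⊗≫ ((c'.hom ▷ D.map M ⊗≫
          D.map N₂ ◁ (D.mapComp M N₁).inv ⊗≫ (D.mapComp (M ≫ N₁) N₂).inv) ▷ K ≫
          D.map ((M ≫ N₁) ≫ N₂) ◁ x.hom) ⊗≫ (D.mapComp (M ≫ N₁) N₂).hom ▷ P ▷ Q ⊗≫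
          D.map N₂ ◁ (D.mapComp (D.map N₁) (M ≫ N₁)).inv ▷ Q ⊗≫
          (D.mapComp (D.map N₁ ≫ M ≫ N₁) N₂).inv ▷ Q ≫
          (D.mapComp (D.map N₂) (D.conj N₁ M ≫ N₂)).inv := by
      dsimp only [h, K, P, Q, x, c']
      bicategory
    _ = 𝟙 _ ⊗≫ h ◁ Z ⊗≫ (h ≫ D.map M) ◁ (x.inv ≫ D.map₂ c'.inv ≫ D.map₂ c'.hom) ⊗≫
          ((D.mapComp M (N₁ ≫ N₂)).inv ≫ (D.mapComp M (N₁ ≫ N₂)).hom) ▷ K ⊗≫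
          (h ≫ D.map M) ◁ x.hom ⊗≫ (c'.hom ▷ D.map M ⊗≫
          D.map N₂ ◁ (D.mapComp M N₁).inv ⊗≫ ((D.mapComp (M ≫ N₁) N₂).inv ≫
          (D.mapComp (M ≫ N₁) N₂).hom)) ▷ P ▷ Q ⊗≫
          D.map N₂ ◁ (D.mapComp (D.map N₁) (M ≫ N₁)).inv ▷ Q ⊗≫
          (D.mapComp (D.map N₁ ≫ M ≫ N₁) N₂).inv ▷ Q ≫
          (D.mapComp (D.map N₂) (D.conj N₁ M ≫ N₂)).inv := by
      rw [whisker_exchange s, ← whisker_exchange (D.mapComp M (N₁ ≫ N₂)).inv,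
        ← whisker_exchange (_ ⊗≫ _) x.hom]
      dsimp only [h, K, P, Q, x, c', Z]
      bicategory
    _ = 𝟙 _ ⊗≫ h ◁ Z ⊗≫ (h ≫ D.map M) ◁ (x.inv ≫ x.hom) ⊗≫ (c'.hom ▷ D.map M ⊗≫
          D.map N₂ ◁ (D.mapComp M N₁).inv) ▷ P ▷ Q ⊗≫
          D.map N₂ ◁ (D.mapComp (D.map N₁) (M ≫ N₁)).inv ▷ Q ⊗≫
          (D.mapComp (D.map N₁ ≫ M ≫ N₁) N₂).inv ▷ Q ≫
          (D.mapComp (D.map N₂) (D.conj N₁ M ≫ N₂)).inv := by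
      rw [show D.map₂ c'.inv ≫ D.map₂ c'.hom = 𝟙 _ from hm, Iso.inv_hom_id, Iso.inv_hom_id]
      dsimp only [h, K, P, Q, x, c', Z]
      bicategory
    _ = 𝟙 _ ⊗≫ (h ◁ Z ≫ c'.hom ▷ (D.map M ≫ P ≫ Q)) ⊗≫
          D.map N₂ ◁ (D.mapComp M N₁).inv ▷ P ▷ Q ⊗≫
          D.map N₂ ◁ (D.mapComp (D.map N₁) (M ≫ N₁)).inv ▷ Q ⊗≫
          (D.mapComp (D.map N₁ ≫ M ≫ N₁) N₂).inv ▷ Q ≫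
          (D.mapComp (D.map N₂) (D.conj N₁ M ≫ N₂)).inv := by
      rw [Iso.inv_hom_id]
      dsimp only [h, K, P, Q, x, c', Z]
      bicategory
    _ = _ := by
      rw [whisker_exchange]
      dsimp only [h, K, P, Q, x, c', Z]
      bicategory

end Duality

end

section

namespace Duality
variable {C : Type u} [Bicategory.{w, v} C] (D : Duality C)

/-- `ψ ⊗ id ⊗ ψ̄^{op}`. -/
def conjMap {a b : C} {N N' : a ⟶ b} (ψ : N ⟶ N') (M : D.obj a ⟶ a) :
    D.conj N M ⟶ D.conj N' M :=
  D.map₂ ψ ▷ (M ≫ N) ≫ D.map N' ◁ M ◁ ψ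

theorem conjMap_id {a b : C} (N : a ⟶ b) (M : D.obj a ⟶ a) : D.conjMap (𝟙 N) M = 𝟙 _ := by
  simp [conjMap, D.map₂_id]

theorem conjMap_comp {a b : C} {N N' N'' : a ⟶ b} (ψ : N ⟶ N') (ψ' : N' ⟶ N'')
    (M : D.obj a ⟶ a) : D.conjMap (ψ ≫ ψ') M = D.conjMap ψ M ≫ D.conjMap ψ' M := by
  simp only [conjMap, D.map₂_comp, comp_whiskerRight, whiskerLeft_comp, Category.assoc]
  rw [whisker_exchange_assoc]

theorem conjMap_naturality {a b : C} {N N' : a ⟶ b} (ψ : N ⟶ N') {M M' : D.obj a ⟶ a}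
    (φ : M ⟶ M') :
    D.conjMap ψ M ≫ D.map N' ◁ φ ▷ N' = D.map N ◁ φ ▷ N ≫ D.conjMap ψ M' := by
  simp only [conjMap, Category.assoc]
  rw [← whiskerLeft_comp, whisker_exchange, whiskerLeft_comp, ← whisker_exchange_assoc]

theorem conjComp_naturality {a b c : C} (N₁ : a ⟶ b) (N₂ : b ⟶ c) {M M' : D.obj a ⟶ a}
    (φ : M ⟶ M') :
    D.map (N₁ ≫ N₂) ◁ φ ▷ (N₁ ≫ N₂) ≫ (D.conjComp N₁ N₂ M').hom =
      (D.conjComp N₁ N₂ M).hom ≫ D.map N₂ ◁ (D.map N₁ ◁ φ ▷ N₁) ▷ N₂ := by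
  simp only [conjComp, Iso.trans_hom, whiskerRightIso_hom, whiskerLeftIso_hom, Iso.symm_hom]
  rw [whisker_exchange_assoc]
  bicategory

theorem conjId_naturality {a : C} {M M' : D.obj a ⟶ a} (φ : M ⟶ M') :
    D.map (𝟙 a) ◁ φ ▷ 𝟙 a ≫ (D.conjId M').hom = (D.conjId M).hom ≫ φ := by
  simp only [conjId, Iso.trans_hom, whiskerRightIso_hom]
  rw [whisker_exchange_assoc]
  bicategory

theorem conjMap_whiskerLeft {a b c : C} (N₁ : a ⟶ b) {N₂ N₂' : b ⟶ c} (ψ : N₂ ⟶ N₂')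
    (M : D.obj a ⟶ a) :
    D.conjMap (N₁ ◁ ψ) M ≫ (D.conjComp N₁ N₂' M).hom =
      (D.conjComp N₁ N₂ M).hom ≫ D.conjMap ψ (D.conj N₁ M) := by
  simp only [conjMap, conjComp, Iso.trans_hom, whiskerRightIso_hom, whiskerLeftIso_hom,
    Iso.symm_hom, map₂_whisker_left, comp_whiskerRight, Category.assoc]
  rw [whisker_exchange_assoc, inv_hom_whiskerRight_assoc]
  bicategory

theorem conjMap_whiskerRight {a b c : C} {N₁ N₁' : a ⟶ b} (ψ : N₁ ⟶ N₁') (N₂ : b ⟶ c)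
    (M : D.obj a ⟶ a) :
    D.conjMap (ψ ▷ N₂) M ≫ (D.conjComp N₁' N₂ M).hom =
      (D.conjComp N₁ N₂ M).hom ≫ D.map N₂ ◁ D.conjMap ψ M ▷ N₂ := by
  simp only [conjMap, conjComp, Iso.trans_hom, whiskerRightIso_hom, whiskerLeftIso_hom,
    Iso.symm_hom, map₂_whisker_right, comp_whiskerRight, Category.assoc]
  rw [whisker_exchange_assoc, inv_hom_whiskerRight_assoc]
  bicategory

theorem conjMap_associator {a b c d : C} (N₁ : a ⟶ b) (N₂ : b ⟶ c) (N₃ : c ⟶ d)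
    (M : D.obj a ⟶ a) :
    D.conjMap (α_ N₁ N₂ N₃).hom M ≫ (D.conjComp N₁ (N₂ ≫ N₃) M).hom ≫
      (D.conjComp N₂ N₃ (D.conj N₁ M)).hom =
      (D.conjComp (N₁ ≫ N₂) N₃ M).hom ≫ D.map N₃ ◁ (D.conjComp N₁ N₂ M).hom ▷ N₃ := by
  simp only [conjMap, conjComp, Iso.trans_hom, whiskerRightIso_hom, whiskerLeftIso_hom,
    Iso.symm_hom, map₂_associator, comp_whiskerRight, Category.assoc]
  rw [whisker_exchange_assoc, inv_hom_whiskerRight_assoc]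
  calc
    _ = 𝟙 _ ⊗≫ (D.mapComp (N₁ ≫ N₂) N₃).hom ▷ (M ≫ N₁ ≫ N₂ ≫ N₃) ⊗≫
        D.map N₃ ◁ (D.mapComp N₁ N₂).hom ▷ (M ≫ N₁ ≫ N₂ ≫ N₃) ⊗≫
        ((D.mapComp N₂ N₃).inv ≫ (D.mapComp N₂ N₃).hom) ▷ (D.map N₁ ≫ M ≫ N₁ ≫ N₂ ≫ N₃) ⊗≫
        𝟙 _ := by bicategory
    _ = _ := by
      rw [Iso.inv_hom_id]
      bicategory

theorem conjMap_leftUnitor {a b : C} (N : a ⟶ b) (M : D.obj a ⟶ a) :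
    D.conjMap (λ_ N).hom M = (D.conjComp (𝟙 a) N M).hom ≫ D.map N ◁ (D.conjId M).hom ▷ N := by
  simp only [conjMap, conjComp, conjId, Iso.trans_hom, whiskerRightIso_hom, whiskerLeftIso_hom,
    Iso.symm_hom, map₂_left_unitor, comp_whiskerRight, Category.assoc]
  bicategory

theorem conjMap_rightUnitor {a b : C} (N : a ⟶ b) (M : D.obj a ⟶ a) :
    D.conjMap (ρ_ N).hom M = (D.conjComp N (𝟙 b) M).hom ≫ (D.conjId (D.conj N M)).hom := by
  simp only [conjMap, conjComp, conjId, Iso.trans_hom, whiskerRightIso_hom, whiskerLeftIso_hom,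
    Iso.symm_hom, map₂_right_unitor, comp_whiskerRight, Category.assoc]
  bicategory

end Duality

/-- The objects of the bicategory of stellar objects for a duality `A ↦ Ā^{op}`: an object `A`
with an invertible 1-morphism `M : Ā^{op} → A` and an involution `σ : M → M̄^{op}`. The composite
with `e_A : A → (Ā^{op})‾^{op}` identifies the targets of `M` and `M̄^{op}`. -/
structure Stellar {C : Type u} [Bicategory.{w, v} C] (D : Duality C) where
  obj : C
  M : D.obj obj ⟶ obj
  invertible : IsEquiv1 M
  σ : M ≫ D.e obj ≅ D.map M
  involution : σ.hom ≫ D.bar σ.hom = 𝟙 _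

namespace Stellar
variable {C : Type u} [Bicategory.{w, v} C] {D : Duality C}

/-- A stellar 1-morphism: an invertible 1-morphism `N` with a unitarity datum
`φ : N ⊗ M₁ ⊗ N̄^{op} → M₂` which satisfies the Hermiticity condition. -/
structure Hom (X Y : Stellar D) where
  N : X.obj ⟶ Y.obj
  invertible : IsEquiv1 N
  φ : D.conj N X.M ≅ Y.M
  hermitian : φ.hom ▷ D.e Y.obj ≫ Y.σ.hom = D.herm N X.σ.hom ≫ D.map₂ φ.hom

/-- A unitary 2-morphism. -/
@[ext] structure Hom₂ {X Y : Stellar D} (F G : Hom X Y) where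
  ψ : F.N ≅ G.N
  unitary : D.conjMap ψ.hom X.M ≫ G.φ.hom = F.φ.hom

instance (X Y : Stellar D) : Category (Hom X Y) where
  Hom F G := Hom₂ F G
  id F := ⟨Iso.refl _, by simp [D.conjMap_id]⟩
  comp η ξ := ⟨η.ψ ≪≫ ξ.ψ, by
    rw [Iso.trans_hom, D.conjMap_comp, Category.assoc, ξ.unitary, η.unitary]⟩

theorem ext₂ {X Y : Stellar D} {F G : Hom X Y} {η ξ : F ⟶ G} (h : η.ψ.hom = ξ.ψ.hom) : η = ξ :=
  Hom₂.ext (Iso.ext h)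

/-- The inverse of a unitary 2-morphism is unitary. -/
def isoMk {X Y : Stellar D} {F G : Hom X Y} (ψ : F.N ≅ G.N)
    (h : D.conjMap ψ.hom X.M ≫ G.φ.hom = F.φ.hom) : F ≅ G where
  hom := ⟨ψ, h⟩
  inv := ⟨ψ.symm, by
    rw [← h, Iso.symm_hom, ← Category.assoc, ← D.conjMap_comp, ψ.inv_hom_id, D.conjMap_id,
      Category.id_comp]⟩
  hom_inv_id := ext₂ ψ.hom_inv_id
  inv_hom_id := ext₂ ψ.inv_hom_id

/-- The identity bimodule with the unitarity datum `A ⊗ M ⊗ Ā^{op} ≅ M`. -/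
def idHom (X : Stellar D) : Hom X X where
  N := 𝟙 X.obj
  invertible := .id _
  φ := D.conjId X.M
  hermitian := (D.herm_conjId X.σ.hom).symm

/-- The composite of stellar 1-morphisms, with unitarity datum
`(N₂ ⊗ N₁) ⊗ M₁ ⊗ (N₂ ⊗ N₁)‾^{op} ≅ N₂ ⊗ (N₁ ⊗ M₁ ⊗ N̄₁^{op}) ⊗ N̄₂^{op} → N₂ ⊗ M₂ ⊗ N̄₂^{op} → M₃`. -/
def compHom {X Y Z : Stellar D} (F : Hom X Y) (G : Hom Y Z) : Hom X Z where
  N := F.N ≫ G.N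
  invertible := F.invertible.comp G.invertible
  φ := D.conjComp F.N G.N X.M ≪≫ whiskerLeftIso (D.map G.N) (whiskerRightIso F.φ G.N) ≪≫ G.φ
  hermitian := by
    simp only [Iso.trans_hom, whiskerLeftIso_hom, whiskerRightIso_hom, comp_whiskerRight,
      Category.assoc, G.hermitian, D.map₂_comp]
    rw [← reassoc_of% D.herm_naturality G.N F.hermitian.symm, ← reassoc_of% D.herm_conjComp]

/-- Left whiskering of unitary 2-morphisms. -/
def whiskerL {X Y Z : Stellar D} (F : Hom X Y) {G H : Hom Y Z} (η : Hom₂ G H) :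
    Hom₂ (compHom F G) (compHom F H) where
  ψ := whiskerLeftIso F.N η.ψ
  unitary := by
    simp only [compHom, Iso.trans_hom, whiskerLeftIso_hom, whiskerRightIso_hom]
    rw [reassoc_of% D.conjMap_whiskerLeft, reassoc_of% D.conjMap_naturality, η.unitary]

/-- Right whiskering of unitary 2-morphisms. -/
def whiskerR {X Y Z : Stellar D} {F G : Hom X Y} (η : Hom₂ F G) (H : Hom Y Z) :
    Hom₂ (compHom F H) (compHom G H) where
  ψ := whiskerRightIso η.ψ H.N
  unitary := by
    simp only [compHom, Iso.trans_hom, whiskerLeftIso_hom, whiskerRightIso_hom]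
    rw [reassoc_of% D.conjMap_whiskerRight, ← whiskerLeft_comp_assoc, ← comp_whiskerRight,
      η.unitary]

theorem unitary_associator {W X Y Z : Stellar D} (F : Hom W X) (G : Hom X Y) (H : Hom Y Z) :
    D.conjMap (α_ F.N G.N H.N).hom W.M ≫ (compHom F (compHom G H)).φ.hom =
      (compHom (compHom F G) H).φ.hom := by
  simp only [compHom, Iso.trans_hom, whiskerLeftIso_hom, whiskerRightIso_hom, comp_whiskerRight,
    whiskerLeft_comp, Category.assoc]
  rw [← reassoc_of% D.conjMap_associator, reassoc_of% D.conjComp_naturality]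

theorem unitary_leftUnitor {X Y : Stellar D} (F : Hom X Y) :
    D.conjMap (λ_ F.N).hom X.M ≫ F.φ.hom = (compHom (idHom X) F).φ.hom := by
  simp only [compHom, idHom, Iso.trans_hom, whiskerLeftIso_hom, whiskerRightIso_hom]
  rw [D.conjMap_leftUnitor, Category.assoc]

theorem unitary_rightUnitor {X Y : Stellar D} (F : Hom X Y) :
    D.conjMap (ρ_ F.N).hom X.M ≫ F.φ.hom = (compHom F (idHom Y)).φ.hom := by
  simp only [compHom, idHom, Iso.trans_hom, whiskerLeftIso_hom, whiskerRightIso_hom]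
  rw [D.conjMap_rightUnitor, D.conjId_naturality, Category.assoc]

instance : Bicategory (Stellar D) where
  Hom := Hom
  id := idHom
  comp := compHom
  whiskerLeft F _ _ η := whiskerL F η
  whiskerRight η H := whiskerR η H
  associator F G H := isoMk (α_ F.N G.N H.N) (unitary_associator F G H)
  leftUnitor F := isoMk (λ_ F.N) (unitary_leftUnitor F)
  rightUnitor F := isoMk (ρ_ F.N) (unitary_rightUnitor F)
  whiskerLeft_id _ _ := ext₂ (whiskerLeft_id _ _)
  whiskerLeft_comp _ _ _ _ _ _ := ext₂ (whiskerLeft_comp _ _ _)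
  id_whiskerLeft _ := ext₂ (id_whiskerLeft _)
  comp_whiskerLeft _ _ _ _ _ := ext₂ (comp_whiskerLeft _ _ _)
  id_whiskerRight _ _ := ext₂ (id_whiskerRight _ _)
  comp_whiskerRight _ _ _ := ext₂ (comp_whiskerRight _ _ _)
  whiskerRight_id _ := ext₂ (whiskerRight_id _)
  whiskerRight_comp _ _ _ := ext₂ (whiskerRight_comp _ _ _)
  whisker_assoc _ _ _ _ _ := ext₂ (whisker_assoc _ _ _)
  whisker_exchange _ _ := ext₂ (whisker_exchange _ _)
  pentagon _ _ _ _ := ext₂ (pentagon _ _ _ _)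
  triangle _ _ := ext₂ (triangle _ _)

end Stellar

end

section

/-- An action of the group `ℤ/2 = {1, R}` on a bicategory, with strict units: a pseudofunctor
`ρ = ρ(R)`, a pseudonatural equivalence `R_{R,R} : ρ(R R) = 𝟭 ⟶ ρ ∘ ρ` and an invertible modification
`ω_{R,R,R}` which satisfies the pentagon identity for `(R, R, R, R)`. -/
structure Z2Action (C : Type u) [Bicategory.{w, v} C] where
  ρ : Pseudofunctor C C
  R : Pseudofunctor.StrongTrans (Pseudofunctor.id C) (ρ.comp ρ)
  R_equiv (b : C) : IsEquiv1 (R.app b)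
  ω (b : C) : R.app (ρ.obj b) ≅ ρ.map (R.app b)
  ω_naturality {a b : C} (f : a ⟶ b) :
    (R.naturality (ρ.map f)).hom ≫ (ω a).hom ▷ ρ.map (ρ.map (ρ.map f)) =
      ρ.map f ◁ (ω b).hom ≫ (ρ.mapComp f (R.app b)).inv ≫ ρ.map₂ (R.naturality f).hom ≫
        (ρ.mapComp (R.app a) (ρ.map (ρ.map f))).hom
  ω_pentagon (b : C) :
    (R.naturality (R.app b)).hom = R.app b ◁ ((ω (ρ.obj b)).hom ≫ ρ.map₂ (ω b).hom)

namespace Z2Action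
variable {C : Type u} [Bicategory.{w, v} C] (T : Z2Action C)

/-- The component `R_b : b → ρ(ρ(b))`. -/
abbrev Rapp (b : C) : b ⟶ T.ρ.obj (T.ρ.obj b) := T.R.app b

/-- The naturality constraint `f ≫ R_b ≅ R_a ≫ ρ(ρ(f))`. -/
def Rnat {a b : C} (f : a ⟶ b) : f ≫ T.Rapp b ≅ T.Rapp a ≫ T.ρ.map (T.ρ.map f) :=
  T.R.naturality f

theorem Rnat_naturality {a b : C} {f g : a ⟶ b} (η : f ⟶ g) :
    η ▷ T.Rapp b ≫ (T.Rnat g).hom = (T.Rnat f).hom ≫ T.Rapp a ◁ T.ρ.map₂ (T.ρ.map₂ η) :=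
  T.R.naturality_naturality η

theorem Rnat_id (a : C) :
    (T.Rnat (𝟙 a)).hom ≫ T.Rapp a ◁ (T.ρ.map₂ (T.ρ.mapId a).hom ≫ (T.ρ.mapId (T.ρ.obj a)).hom) =
      (λ_ (T.Rapp a)).hom ≫ (ρ_ (T.Rapp a)).inv :=
  (T.R.naturality_id a).trans
    ((congrArg (· ≫ (λ_ (T.Rapp a)).hom ≫ (ρ_ (T.Rapp a)).inv) (id_whiskerRight (𝟙 a) (T.Rapp a))).trans
      (Category.id_comp _))

theorem Rnat_comp {a b c : C} (f : a ⟶ b) (g : b ⟶ c) :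
    (T.Rnat (f ≫ g)).hom ≫ T.Rapp a ◁ (T.ρ.map₂ (T.ρ.mapComp f g).hom ≫
      (T.ρ.mapComp (T.ρ.map f) (T.ρ.map g)).hom) =
      (α_ _ _ _).hom ≫ f ◁ (T.Rnat g).hom ≫ (α_ _ _ _).inv ≫
        (T.Rnat f).hom ▷ T.ρ.map (T.ρ.map g) ≫ (α_ _ _ _).hom :=
  (T.R.naturality_comp f g).trans
    ((congrArg (· ≫ (α_ f g (T.Rapp c)).hom ≫ f ◁ (T.Rnat g).hom ≫
      (α_ f (T.Rapp b) (T.ρ.map (T.ρ.map g))).inv ≫ (T.Rnat f).hom ▷ T.ρ.map (T.ρ.map g) ≫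
      (α_ _ _ _).hom) (id_whiskerRight (f ≫ g) (T.Rapp c))).trans (Category.id_comp _))

/-- The composite `R_F ≫ ρ(m) ≫ m`. -/
abbrev sq {F : C} (m : T.ρ.obj F ⟶ F) : F ⟶ F := T.Rapp F ≫ T.ρ.map m ≫ m

/-- The image of a square under the pseudofunctor `ρ`. -/
def mapSquare {F F' : C} {m : T.ρ.obj F ⟶ F} {m' : T.ρ.obj F' ⟶ F'} {f : F ⟶ F'}
    (fR : m ≫ f ⟶ T.ρ.map f ≫ m') :
    T.ρ.map m ≫ T.ρ.map f ⟶ T.ρ.map (T.ρ.map f) ≫ T.ρ.map m' :=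
  (T.ρ.mapComp m f).inv ≫ T.ρ.map₂ fR ≫ (T.ρ.mapComp (T.ρ.map f) m').hom

/-- The pasting of the naturality square of `R` at `f` with `ρ(f_R)` and `f_R`. -/
def sqMap {F F' : C} {m : T.ρ.obj F ⟶ F} {m' : T.ρ.obj F' ⟶ F'} {f : F ⟶ F'}
    (fR : m ≫ f ⟶ T.ρ.map f ≫ m') : T.sq m ≫ f ⟶ f ≫ T.sq m' :=
  (α_ _ _ _).hom ≫ T.Rapp F ◁ ((α_ _ _ _).hom ≫ T.ρ.map m ◁ fR ≫ (α_ _ _ _).inv ≫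
    T.mapSquare fR ▷ m' ≫ (α_ _ _ _).hom) ≫ (α_ _ _ _).inv ≫ (T.Rnat f).inv ▷ _ ≫ (α_ _ _ _).hom

/-- The identity square. -/
def squareId {F : C} (m : T.ρ.obj F ⟶ F) : m ≫ 𝟙 F ≅ T.ρ.map (𝟙 F) ≫ m :=
  ρ_ m ≪≫ (λ_ m).symm ≪≫ whiskerRightIso (T.ρ.mapId F).symm m

/-- The pasting of two squares. -/
def squareComp {F F' F'' : C} {m : T.ρ.obj F ⟶ F} {m' : T.ρ.obj F' ⟶ F'}
    {m'' : T.ρ.obj F'' ⟶ F''} {f : F ⟶ F'} {g : F' ⟶ F''} (fR : m ≫ f ≅ T.ρ.map f ≫ m')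
    (gR : m' ≫ g ≅ T.ρ.map g ≫ m'') : m ≫ f ≫ g ≅ T.ρ.map (f ≫ g) ≫ m'' :=
  (α_ m f g).symm ≪≫ whiskerRightIso fR g ≪≫ α_ _ _ _ ≪≫ whiskerLeftIso (T.ρ.map f) gR ≪≫
    (α_ _ _ _).symm ≪≫ whiskerRightIso (T.ρ.mapComp f g).symm m''

theorem ρ_associator_inv {a b c d : C} (f : a ⟶ b) (g : b ⟶ c) (h : c ⟶ d) :
    T.ρ.map₂ (α_ f g h).inv = (T.ρ.mapComp f (g ≫ h)).hom ≫ T.ρ.map f ◁ (T.ρ.mapComp g h).hom ≫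
      (α_ _ _ _).inv ≫ (T.ρ.mapComp f g).inv ▷ T.ρ.map h ≫ (T.ρ.mapComp (f ≫ g) h).inv := by
  rw [← cancel_epi (T.ρ.map₂ (α_ f g h).hom), ← T.ρ.map₂_comp, Iso.hom_inv_id]
  simp

theorem ρ_leftUnitor_inv {a b : C} (f : a ⟶ b) :
    T.ρ.map₂ (λ_ f).inv = (λ_ _).inv ≫ (T.ρ.mapId a).inv ▷ T.ρ.map f ≫
      (T.ρ.mapComp (𝟙 a) f).inv := by
  rw [← cancel_epi (T.ρ.map₂ (λ_ f).hom), ← T.ρ.map₂_comp, Iso.hom_inv_id]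
  simp

theorem mapSquare_id {F : C} (m : T.ρ.obj F ⟶ F) :
    T.mapSquare (T.squareId m).hom = T.ρ.map m ◁ (T.ρ.mapId F).hom ≫ (ρ_ _).hom ≫ (λ_ _).inv ≫
      ((T.ρ.mapId (T.ρ.obj F)).inv ≫ T.ρ.map₂ (T.ρ.mapId F).inv) ▷ T.ρ.map m := by
  simp [mapSquare, squareId, ρ_leftUnitor_inv]

theorem mapSquare_comp {F F' F'' : C} {m : T.ρ.obj F ⟶ F} {m' : T.ρ.obj F' ⟶ F'}
    {m'' : T.ρ.obj F'' ⟶ F''} {f : F ⟶ F'} {g : F' ⟶ F''} (fR : m ≫ f ≅ T.ρ.map f ≫ m')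
    (gR : m' ≫ g ≅ T.ρ.map g ≫ m'') :
    T.mapSquare (T.squareComp fR gR).hom = T.ρ.map m ◁ (T.ρ.mapComp f g).hom ≫ (α_ _ _ _).inv ≫
      T.mapSquare fR.hom ▷ T.ρ.map g ≫ (α_ _ _ _).hom ≫ T.ρ.map (T.ρ.map f) ◁ T.mapSquare gR.hom ≫
      (α_ _ _ _).inv ≫ ((T.ρ.mapComp (T.ρ.map f) (T.ρ.map g)).inv ≫
        T.ρ.map₂ (T.ρ.mapComp f g).inv) ▷ T.ρ.map m'' := by
  simp [mapSquare, squareComp, ρ_associator_inv]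

theorem sqMap_id {F : C} (m : T.ρ.obj F ⟶ F) :
    T.sqMap (T.squareId m).hom = (ρ_ _).hom ≫ (λ_ _).inv := by
  have hn : (T.Rnat (𝟙 F)).hom = ((λ_ (T.Rapp F)).hom ≫ (ρ_ (T.Rapp F)).inv) ≫ T.Rapp F ◁
      ((T.ρ.mapId (T.ρ.obj F)).inv ≫ T.ρ.map₂ (T.ρ.mapId F).inv) := by
    rw [← T.Rnat_id, Category.assoc, ← whiskerLeft_comp]
    simp [← T.ρ.map₂_comp]
  have hi : (T.Rnat (𝟙 F)).inv = T.Rapp F ◁ (T.ρ.map₂ (T.ρ.mapId F).hom ≫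
      (T.ρ.mapId (T.ρ.obj F)).hom) ≫ (ρ_ (T.Rapp F)).hom ≫ (λ_ (T.Rapp F)).inv := by
    rw [← cancel_epi (T.Rnat (𝟙 F)).hom, Iso.hom_inv_id, reassoc_of% T.Rnat_id]
    simp
  have hp : T.ρ.map₂ (T.ρ.mapId F).inv ≫ T.ρ.map₂ (T.ρ.mapId F).hom = 𝟙 _ := by
    rw [← T.ρ.map₂_comp, Iso.inv_hom_id, T.ρ.map₂_id]
  simp only [sqMap, hi, mapSquare_id]
  simp only [squareId, Iso.trans_hom, Iso.symm_hom, whiskerRightIso_hom]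
  calc
    _ = 𝟙 _ ⊗≫ T.Rapp F ◁ T.ρ.map m ◁ ((T.ρ.mapId F).inv ≫ (T.ρ.mapId F).hom) ▷ m ⊗≫
        T.Rapp F ◁ ((T.ρ.mapId (T.ρ.obj F)).inv ≫ (T.ρ.map₂ (T.ρ.mapId F).inv ≫
          T.ρ.map₂ (T.ρ.mapId F).hom) ≫ (T.ρ.mapId (T.ρ.obj F)).hom) ▷ (T.ρ.map m ≫ m) ⊗≫
        𝟙 _ := by
      bicategory
    _ = _ := by
      rw [hp, Category.id_comp, Iso.inv_hom_id, Iso.inv_hom_id]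
      bicategory

theorem sqMap_comp {F F' F'' : C} {m : T.ρ.obj F ⟶ F} {m' : T.ρ.obj F' ⟶ F'}
    {m'' : T.ρ.obj F'' ⟶ F''} {f : F ⟶ F'} {g : F' ⟶ F''} (fR : m ≫ f ≅ T.ρ.map f ≫ m')
    (gR : m' ≫ g ≅ T.ρ.map g ≫ m'') :
    T.sqMap (T.squareComp fR gR).hom = (α_ _ _ _).inv ≫ T.sqMap fR.hom ▷ g ≫ (α_ _ _ _).hom ≫
      f ◁ T.sqMap gR.hom ≫ (α_ _ _ _).inv := by
  have hi : (T.Rnat (f ≫ g)).inv = T.Rapp F ◁ (T.ρ.map₂ (T.ρ.mapComp f g).hom ≫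
      (T.ρ.mapComp (T.ρ.map f) (T.ρ.map g)).hom) ≫ (α_ _ _ _).inv ≫
      (T.Rnat f).inv ▷ T.ρ.map (T.ρ.map g) ≫ (α_ _ _ _).hom ≫ f ◁ (T.Rnat g).inv ≫
      (α_ _ _ _).inv := by
    rw [← cancel_epi (T.Rnat (f ≫ g)).hom, Iso.hom_inv_id, reassoc_of% T.Rnat_comp]
    simp
  have hp : T.ρ.map₂ (T.ρ.mapComp f g).inv ≫ T.ρ.map₂ (T.ρ.mapComp f g).hom = 𝟙 _ := by
    rw [← T.ρ.map₂_comp, Iso.inv_hom_id, T.ρ.map₂_id]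
  simp only [sqMap, hi, mapSquare_comp]
  simp only [squareComp, Iso.trans_hom, Iso.symm_hom, whiskerRightIso_hom, whiskerLeftIso_hom]
  set P := T.mapSquare fR.hom
  set Q := T.mapSquare gR.hom
  calc
    _ = 𝟙 _ ⊗≫ T.Rapp F ◁ T.ρ.map m ◁ (fR.hom ▷ g ⊗≫ T.ρ.map f ◁ gR.hom) ⊗≫
        T.Rapp F ◁ T.ρ.map m ◁ ((T.ρ.mapComp f g).inv ≫ (T.ρ.mapComp f g).hom) ▷ m'' ⊗≫
        T.Rapp F ◁ P ▷ T.ρ.map g ▷ m'' ⊗≫ T.Rapp F ◁ T.ρ.map (T.ρ.map f) ◁ Q ▷ m'' ⊗≫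
        T.Rapp F ◁ ((T.ρ.mapComp (T.ρ.map f) (T.ρ.map g)).inv ≫ (T.ρ.map₂ (T.ρ.mapComp f g).inv ≫
          T.ρ.map₂ (T.ρ.mapComp f g).hom) ≫ (T.ρ.mapComp (T.ρ.map f) (T.ρ.map g)).hom) ▷
          (T.ρ.map m'' ≫ m'') ⊗≫
        (T.Rnat f).inv ▷ (T.ρ.map (T.ρ.map g) ≫ T.ρ.map m'' ≫ m'') ⊗≫
        f ◁ (T.Rnat g).inv ▷ (T.ρ.map m'' ≫ m'') ⊗≫ 𝟙 _ := by
      bicategory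
    _ = 𝟙 _ ⊗≫ T.Rapp F ◁ T.ρ.map m ◁ fR.hom ▷ g ⊗≫
        T.Rapp F ◁ ((T.ρ.map m ≫ T.ρ.map f) ◁ gR.hom ≫ P ▷ (T.ρ.map g ≫ m'')) ⊗≫
        ((T.Rapp F ≫ T.ρ.map (T.ρ.map f)) ◁ Q ▷ m'' ≫
          (T.Rnat f).inv ▷ ((T.ρ.map (T.ρ.map g) ≫ T.ρ.map m'') ≫ m'')) ⊗≫
        f ◁ (T.Rnat g).inv ▷ (T.ρ.map m'' ≫ m'') ⊗≫ 𝟙 _ := by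
      rw [hp, Category.id_comp, Iso.inv_hom_id, Iso.inv_hom_id]
      bicategory
    _ = 𝟙 _ ⊗≫ T.Rapp F ◁ T.ρ.map m ◁ fR.hom ▷ g ⊗≫ T.Rapp F ◁ P ▷ (m' ≫ g) ⊗≫
        ((T.Rapp F ≫ T.ρ.map (T.ρ.map f)) ◁ T.ρ.map m' ◁ gR.hom ≫
          (T.Rnat f).inv ▷ (T.ρ.map m' ≫ T.ρ.map g ≫ m'')) ⊗≫ (f ≫ T.Rapp F') ◁ Q ▷ m'' ⊗≫
        f ◁ (T.Rnat g).inv ▷ (T.ρ.map m'' ≫ m'') ⊗≫ 𝟙 _ := by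
      rw [whisker_exchange P, whisker_exchange (T.Rnat f).inv]
      bicategory
    _ = _ := by
      rw [whisker_exchange (T.Rnat f).inv]
      bicategory

end Z2Action

end

section

namespace Z2Action
variable {C : Type u} [Bicategory.{w, v} C] (T : Z2Action C)

theorem squareComp_whiskerLeft {F F' F'' : C} {m : T.ρ.obj F ⟶ F} {m' : T.ρ.obj F' ⟶ F'}
    {m'' : T.ρ.obj F'' ⟶ F''} {f : F ⟶ F'} {g h : F' ⟶ F''} (fR : m ≫ f ≅ T.ρ.map f ≫ m')
    (gR : m' ≫ g ≅ T.ρ.map g ≫ m'') (hR : m' ≫ h ≅ T.ρ.map h ≫ m'') {Γ : g ⟶ h}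
    (H : m' ◁ Γ ≫ hR.hom = gR.hom ≫ T.ρ.map₂ Γ ▷ m'') :
    m ◁ f ◁ Γ ≫ (T.squareComp fR hR).hom =
      (T.squareComp fR gR).hom ≫ T.ρ.map₂ (f ◁ Γ) ▷ m'' := by
  simp only [squareComp, Iso.trans_hom, Iso.symm_hom, whiskerRightIso_hom, whiskerLeftIso_hom]
  calc
    _ = 𝟙 _ ⊗≫ ((m ≫ f) ◁ Γ ≫ fR.hom ▷ h) ⊗≫ T.ρ.map f ◁ hR.hom ⊗≫
        (T.ρ.mapComp f h).inv ▷ m'' := by bicategory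
    _ = 𝟙 _ ⊗≫ fR.hom ▷ g ⊗≫ T.ρ.map f ◁ (m' ◁ Γ ≫ hR.hom) ⊗≫
        (T.ρ.mapComp f h).inv ▷ m'' := by rw [whisker_exchange]; bicategory
    _ = _ := by
      rw [H]
      simp only [T.ρ.map₂_whisker_left, comp_whiskerRight, Category.assoc,
        inv_hom_whiskerRight_assoc]
      bicategory

theorem squareComp_whiskerRight {F F' F'' : C} {m : T.ρ.obj F ⟶ F} {m' : T.ρ.obj F' ⟶ F'}
    {m'' : T.ρ.obj F'' ⟶ F''} {f g : F ⟶ F'} {h : F' ⟶ F''} (fR : m ≫ f ≅ T.ρ.map f ≫ m')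
    (gR : m ≫ g ≅ T.ρ.map g ≫ m') (hR : m' ≫ h ≅ T.ρ.map h ≫ m'') {Γ : f ⟶ g}
    (H : m ◁ Γ ≫ gR.hom = fR.hom ≫ T.ρ.map₂ Γ ▷ m') :
    m ◁ Γ ▷ h ≫ (T.squareComp gR hR).hom =
      (T.squareComp fR hR).hom ≫ T.ρ.map₂ (Γ ▷ h) ▷ m'' := by
  simp only [squareComp, Iso.trans_hom, Iso.symm_hom, whiskerRightIso_hom, whiskerLeftIso_hom]
  calc
    _ = 𝟙 _ ⊗≫ (m ◁ Γ ≫ gR.hom) ▷ h ⊗≫ T.ρ.map g ◁ hR.hom ⊗≫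
        (T.ρ.mapComp g h).inv ▷ m'' := by bicategory
    _ = 𝟙 _ ⊗≫ fR.hom ▷ h ⊗≫ (T.ρ.map₂ Γ ▷ (m' ≫ h) ≫ T.ρ.map g ◁ hR.hom) ⊗≫
        (T.ρ.mapComp g h).inv ▷ m'' := by rw [H]; bicategory
    _ = _ := by
      rw [← whisker_exchange]
      simp only [T.ρ.map₂_whisker_right, comp_whiskerRight, Category.assoc,
        inv_hom_whiskerRight_assoc]
      bicategory

theorem squareComp_associator {F F' F'' F₃ : C} {m : T.ρ.obj F ⟶ F} {m' : T.ρ.obj F' ⟶ F'}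
    {m'' : T.ρ.obj F'' ⟶ F''} {m₃ : T.ρ.obj F₃ ⟶ F₃} {f : F ⟶ F'} {g : F' ⟶ F''} {h : F'' ⟶ F₃}
    (fR : m ≫ f ≅ T.ρ.map f ≫ m') (gR : m' ≫ g ≅ T.ρ.map g ≫ m'')
    (hR : m'' ≫ h ≅ T.ρ.map h ≫ m₃) :
    m ◁ (α_ f g h).hom ≫ (T.squareComp fR (T.squareComp gR hR)).hom =
      (T.squareComp (T.squareComp fR gR) hR).hom ≫ T.ρ.map₂ (α_ f g h).hom ▷ m₃ := by
  simp only [squareComp, Iso.trans_hom, Iso.symm_hom, whiskerRightIso_hom, whiskerLeftIso_hom,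
    T.ρ.map₂_associator, comp_whiskerRight, Category.assoc, inv_hom_whiskerRight_assoc]
  calc
    _ = 𝟙 _ ⊗≫ fR.hom ▷ g ▷ h ⊗≫ T.ρ.map f ◁ gR.hom ▷ h ⊗≫ T.ρ.map f ◁ T.ρ.map g ◁ hR.hom ⊗≫
        T.ρ.map f ◁ (T.ρ.mapComp g h).inv ▷ m₃ ⊗≫ (T.ρ.mapComp f (g ≫ h)).inv ▷ m₃ := by
      bicategory
    _ = 𝟙 _ ⊗≫ fR.hom ▷ g ▷ h ⊗≫ T.ρ.map f ◁ gR.hom ▷ h ⊗≫ ((T.ρ.map f ≫ T.ρ.map g) ◁ hR.hom ≫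
        ((T.ρ.mapComp f g).inv ≫ (T.ρ.mapComp f g).hom) ▷ (T.ρ.map h ≫ m₃)) ⊗≫
        T.ρ.map f ◁ (T.ρ.mapComp g h).inv ▷ m₃ ⊗≫ (T.ρ.mapComp f (g ≫ h)).inv ▷ m₃ := by
      rw [Iso.inv_hom_id]
      bicategory
    _ = _ := by
      rw [comp_whiskerRight, whisker_exchange_assoc]
      bicategory

theorem squareComp_leftUnitor {F F' : C} {m : T.ρ.obj F ⟶ F} {m' : T.ρ.obj F' ⟶ F'} {f : F ⟶ F'}
    (fR : m ≫ f ≅ T.ρ.map f ≫ m') :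
    m ◁ (λ_ f).hom ≫ fR.hom =
      (T.squareComp (T.squareId m) fR).hom ≫ T.ρ.map₂ (λ_ f).hom ▷ m' := by
  simp only [squareComp, squareId, Iso.trans_hom, Iso.symm_hom, whiskerRightIso_hom,
    whiskerLeftIso_hom, T.ρ.map₂_left_unitor, comp_whiskerRight, Category.assoc,
    inv_hom_whiskerRight_assoc]
  calc
    _ = 𝟙 _ ⊗≫ (𝟙 _ ◁ fR.hom ≫ ((T.ρ.mapId F).inv ≫ (T.ρ.mapId F).hom) ▷ _) ⊗≫ 𝟙 _ := by
      rw [Iso.inv_hom_id]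
      bicategory
    _ = _ := by
      rw [comp_whiskerRight, whisker_exchange_assoc]
      bicategory

theorem squareComp_rightUnitor {F F' : C} {m : T.ρ.obj F ⟶ F} {m' : T.ρ.obj F' ⟶ F'} {f : F ⟶ F'}
    (fR : m ≫ f ≅ T.ρ.map f ≫ m') :
    m ◁ (ρ_ f).hom ≫ fR.hom =
      (T.squareComp fR (T.squareId m')).hom ≫ T.ρ.map₂ (ρ_ f).hom ▷ m' := by
  simp only [squareComp, squareId, Iso.trans_hom, Iso.symm_hom, whiskerRightIso_hom,
    whiskerLeftIso_hom, T.ρ.map₂_right_unitor, comp_whiskerRight, Category.assoc,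
    inv_hom_whiskerRight_assoc]
  calc
    _ = 𝟙 _ ⊗≫ fR.hom ⊗≫ T.ρ.map f ◁ ((T.ρ.mapId F').inv ≫ (T.ρ.mapId F').hom) ▷ m' ⊗≫ 𝟙 _ := by
      rw [Iso.inv_hom_id]
      bicategory
    _ = _ := by
      bicategory

end Z2Action

/-- The homotopy fixed points of an action of `ℤ/2`: an object `F` with a 1-isomorphism
`m = F_R : ρ(F) → F` and a 2-isomorphism `φ = φ_{R,R} : R_F ≫ ρ(m) ≫ m ≅ F_{R R} = 𝟙`. -/
structure HFP {C : Type u} [Bicategory.{w, v} C] (T : Z2Action C) where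
  F : C
  m : T.ρ.obj F ⟶ F
  invertible : IsEquiv1 m
  φ : T.Rapp F ≫ T.ρ.map m ≫ m ≅ 𝟙 F
  coherence :
    (α_ (T.Rapp (T.ρ.obj F)) (T.ρ.map (T.ρ.map m)) (T.ρ.map m ≫ m)).inv ≫
        (T.Rnat m).inv ▷ (T.ρ.map m ≫ m) ≫ (α_ m (T.Rapp F) (T.ρ.map m ≫ m)).hom ≫
        m ◁ φ.hom ≫ (ρ_ m).hom =
      (T.ω F).hom ▷ (T.ρ.map (T.ρ.map m) ≫ T.ρ.map m ≫ m) ≫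
        T.ρ.map (T.Rapp F) ◁ ((α_ _ _ m).inv ≫ (T.ρ.mapComp (T.ρ.map m) m).inv ▷ m) ≫
        (α_ _ _ m).inv ≫
        ((T.ρ.mapComp (T.Rapp F) (T.ρ.map m ≫ m)).inv ≫ T.ρ.map₂ φ.hom ≫ (T.ρ.mapId F).hom) ▷ m ≫
        (λ_ m).hom

namespace HFP
variable {C : Type u} [Bicategory.{w, v} C] {T : Z2Action C}

/-- A 1-morphism of homotopy fixed points. -/
structure Hom (X Y : HFP T) where
  f : X.F ⟶ Y.F
  fR : X.m ≫ f ≅ T.ρ.map f ≫ Y.m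
  compatible : X.φ.hom ▷ f ≫ (λ_ f).hom = T.sqMap fR.hom ≫ f ◁ Y.φ.hom ≫ (ρ_ f).hom

/-- A 2-morphism of homotopy fixed points. -/
@[ext] structure Hom₂ {X Y : HFP T} (f g : Hom X Y) where
  Γ : f.f ⟶ g.f
  compatible : X.m ◁ Γ ≫ g.fR.hom = f.fR.hom ≫ T.ρ.map₂ Γ ▷ Y.m

instance (X Y : HFP T) : Category (Hom X Y) where
  Hom f g := Hom₂ f g
  id f := ⟨𝟙 _, by simp⟩
  comp η ξ := ⟨η.Γ ≫ ξ.Γ, by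
    rw [whiskerLeft_comp, Category.assoc, ξ.compatible, reassoc_of% η.compatible, T.ρ.map₂_comp,
      comp_whiskerRight]⟩

theorem ext₂ {X Y : HFP T} {f g : Hom X Y} {η ξ : f ⟶ g} (h : η.Γ = ξ.Γ) : η = ξ := Hom₂.ext h

/-- Isomorphisms between 1-morphisms of homotopy fixed points. -/
def isoMk {X Y : HFP T} {f g : Hom X Y} (Γ : f.f ≅ g.f)
    (h : X.m ◁ Γ.hom ≫ g.fR.hom = f.fR.hom ≫ T.ρ.map₂ Γ.hom ▷ Y.m) : f ≅ g where
  hom := ⟨Γ.hom, h⟩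
  inv := ⟨Γ.inv, by
    rw [← cancel_epi (X.m ◁ Γ.hom), ← whiskerLeft_comp_assoc, Γ.hom_inv_id, reassoc_of% h,
      ← comp_whiskerRight, ← T.ρ.map₂_comp, Γ.hom_inv_id]
    simp⟩
  hom_inv_id := ext₂ Γ.hom_inv_id
  inv_hom_id := ext₂ Γ.inv_hom_id

/-- The identity 1-morphism. -/
def idHom (X : HFP T) : Hom X X where
  f := 𝟙 X.F
  fR := T.squareId X.m
  compatible := by
    rw [T.sqMap_id]
    simp

/-- The composite of 1-morphisms. -/
def compHom {X Y Z : HFP T} (f : Hom X Y) (g : Hom Y Z) : Hom X Z where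
  f := f.f ≫ g.f
  fR := T.squareComp f.fR g.fR
  compatible := by
    have h1 : (α_ f.f g.f (T.sq Z.m)).inv ≫ (f.f ≫ g.f) ◁ Z.φ.hom ≫ (ρ_ (f.f ≫ g.f)).hom =
        f.f ◁ (g.f ◁ Z.φ.hom ≫ (ρ_ g.f).hom) := by
      bicategory
    have h2 : (α_ f.f (T.sq Y.m) g.f).hom ≫ f.f ◁ (Y.φ.hom ▷ g.f ≫ (λ_ g.f).hom) =
        (f.f ◁ Y.φ.hom ≫ (ρ_ f.f).hom) ▷ g.f := by
      bicategory
    have h3 : (α_ (T.sq X.m) f.f g.f).inv ≫ (X.φ.hom ▷ f.f ≫ (λ_ f.f).hom) ▷ g.f =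
        X.φ.hom ▷ (f.f ≫ g.f) ≫ (λ_ (f.f ≫ g.f)).hom := by
      bicategory
    rw [T.sqMap_comp, ← h3, f.compatible]
    simp only [Category.assoc, h1]
    rw [← whiskerLeft_comp, ← g.compatible, h2, ← comp_whiskerRight]

/-- Left whiskering of 2-morphisms. -/
def whiskerL {X Y Z : HFP T} (f : Hom X Y) {g h : Hom Y Z} (η : Hom₂ g h) :
    Hom₂ (compHom f g) (compHom f h) where
  Γ := f.f ◁ η.Γ
  compatible := T.squareComp_whiskerLeft f.fR g.fR h.fR η.compatible

/-- Right whiskering of 2-morphisms. -/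
def whiskerR {X Y Z : HFP T} {f g : Hom X Y} (η : Hom₂ f g) (h : Hom Y Z) :
    Hom₂ (compHom f h) (compHom g h) where
  Γ := η.Γ ▷ h.f
  compatible := T.squareComp_whiskerRight f.fR g.fR h.fR η.compatible

instance : Bicategory (HFP T) where
  Hom := Hom
  id := idHom
  comp := compHom
  whiskerLeft f _ _ η := whiskerL f η
  whiskerRight η h := whiskerR η h
  associator f g h := isoMk (α_ f.f g.f h.f) (T.squareComp_associator f.fR g.fR h.fR)
  leftUnitor f := isoMk (λ_ f.f) (T.squareComp_leftUnitor f.fR)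
  rightUnitor f := isoMk (ρ_ f.f) (T.squareComp_rightUnitor f.fR)
  whiskerLeft_id _ _ := ext₂ (whiskerLeft_id _ _)
  whiskerLeft_comp _ _ _ _ _ _ := ext₂ (whiskerLeft_comp _ _ _)
  id_whiskerLeft _ := ext₂ (id_whiskerLeft _)
  comp_whiskerLeft _ _ _ _ _ := ext₂ (comp_whiskerLeft _ _ _)
  id_whiskerRight _ _ := ext₂ (id_whiskerRight _ _)
  comp_whiskerRight _ _ _ := ext₂ (comp_whiskerRight _ _ _)
  whiskerRight_id _ := ext₂ (whiskerRight_id _)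
  whiskerRight_comp _ _ _ := ext₂ (whiskerRight_comp _ _ _)
  whisker_assoc _ _ _ _ _ := ext₂ (whisker_assoc _ _ _)
  whisker_exchange _ _ := ext₂ (whisker_exchange _ _)
  pentagon _ _ _ _ := ext₂ (pentagon _ _ _ _)
  triangle _ _ := ext₂ (triangle _ _)

end HFP

end

section

section
variable {C : Type u} [Bicategory.{w, v} C]

theorem conj_eq_iff {c d : C} {l₁ l₂ : c ⟶ d} {r₁ r₂ : d ⟶ c} (adj₁ : l₁ ⊣ r₁) (adj₂ : l₂ ⊣ r₂)
    (α : l₂ ⟶ l₁) (β : r₁ ⟶ r₂) :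
    conjugateEquiv adj₁ adj₂ α = β ↔ β ▷ l₂ ≫ adj₂.counit = r₁ ◁ α ≫ adj₁.counit := by
  constructor
  · rintro rfl
    rw [conjugateEquiv_apply']
    calc
      _ = 𝟙 _ ⊗≫ r₁ ◁ adj₂.unit ▷ l₂ ⊗≫ r₁ ◁ α ▷ r₂ ▷ l₂ ⊗≫
          (adj₁.counit ▷ (r₂ ≫ l₂) ≫ 𝟙 _ ◁ adj₂.counit) ⊗≫ 𝟙 _ := by bicategory
      _ = 𝟙 _ ⊗≫ r₁ ◁ adj₂.unit ▷ l₂ ⊗≫ r₁ ◁ (α ▷ (r₂ ≫ l₂) ≫ l₁ ◁ adj₂.counit) ⊗≫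
          adj₁.counit ⊗≫ 𝟙 _ := by
        rw [← whisker_exchange]
        bicategory
      _ = 𝟙 _ ⊗≫ r₁ ◁ leftZigzag adj₂.unit adj₂.counit ⊗≫ r₁ ◁ α ⊗≫
          adj₁.counit ⊗≫ 𝟙 _ := by
        rw [← whisker_exchange]
        bicategory
      _ = _ := by
        rw [adj₂.left_triangle]
        bicategory
  · intro h
    rw [← Equiv.eq_symm_apply, conjugateEquiv_symm_apply']
    symm
    calc
      _ = 𝟙 _ ⊗≫ adj₁.unit ▷ l₂ ⊗≫ l₁ ◁ (β ▷ l₂ ≫ adj₂.counit) ⊗≫ 𝟙 _ := by bicategory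
      _ = 𝟙 _ ⊗≫ (adj₁.unit ▷ l₂ ≫ (l₁ ≫ r₁) ◁ α) ⊗≫ l₁ ◁ adj₁.counit ⊗≫ 𝟙 _ := by
        rw [h]
        bicategory
      _ = 𝟙 _ ⊗≫ α ⊗≫ leftZigzag adj₁.unit adj₁.counit ⊗≫ 𝟙 _ := by
        rw [← whisker_exchange]
        bicategory
      _ = _ := by
        rw [adj₁.left_triangle]
        bicategory

theorem conj_leftUnitor {a b : C} {l : a ⟶ b} {r : b ⟶ a} (adj : l ⊣ r) :
    conjugateEquiv (adj.comp (Adjunction.id b)) adj (ρ_ l).inv = (λ_ r).hom := by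
  rw [← cancel_mono (λ_ r).inv, Iso.hom_inv_id]
  have := conjugateEquiv_comp_id_right_apply adj adj (𝟙 l)
  rw [Bicategory.conjugateEquiv_id, Category.id_comp] at this
  rw [← this, Bicategory.conjugateEquiv_comp]
  simp

theorem conj_rightUnitor {a b : C} {l : a ⟶ b} {r : b ⟶ a} (adj : l ⊣ r) :
    conjugateEquiv ((Adjunction.id a).comp adj) adj (λ_ l).inv = (ρ_ r).hom := by
  rw [← cancel_mono (ρ_ r).inv, Iso.hom_inv_id]
  have := conjugateEquiv_id_comp_right_apply adj adj (𝟙 l)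
  rw [Bicategory.conjugateEquiv_id, Category.id_comp] at this
  rw [← this, Bicategory.conjugateEquiv_comp]
  simp

end

namespace Duality
variable {C : Type u} [Bicategory.{w, v} C] (D : Duality C)

theorem map₂_leftUnitor_inv {a b : C} (f : a ⟶ b) :
    D.map₂ (λ_ f).inv = (ρ_ (D.map f)).inv ≫ D.map f ◁ (D.mapId a).inv ≫
      (D.mapComp (𝟙 a) f).inv := by
  refine (cancel_epi (D.mapIso (λ_ f)).hom).1 ?_
  change D.map₂ _ ≫ D.map₂ _ = D.map₂ _ ≫ _
  rw [map₂_hom_inv, map₂_left_unitor]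
  simp

theorem map₂_rightUnitor_inv {a b : C} (f : a ⟶ b) :
    D.map₂ (ρ_ f).inv = (λ_ (D.map f)).inv ≫ (D.mapId b).inv ▷ D.map f ≫
      (D.mapComp f (𝟙 b)).inv := by
  refine (cancel_epi (D.mapIso (ρ_ f)).hom).1 ?_
  change D.map₂ _ ≫ D.map₂ _ = D.map₂ _ ≫ _
  rw [map₂_hom_inv, map₂_right_unitor]
  simp

/-- A duality maps an adjunction `l ⊣ r` to an adjunction `D(r) ⊣ D(l)`. -/
def adj {a b : C} {l : a ⟶ b} {r : b ⟶ a} (A : l ⊣ r) : D.map r ⊣ D.map l where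
  unit := (D.mapId a).inv ≫ D.map₂ A.unit ≫ (D.mapComp l r).hom
  counit := (D.mapComp r l).inv ≫ D.map₂ A.counit ≫ (D.mapId b).hom
  left_triangle := by
    have h : D.map₂ (r ◁ A.unit ≫ (α_ _ _ _).inv ≫ A.counit ▷ r) =
        D.map₂ ((ρ_ r).hom ≫ (λ_ r).inv) := congrArg D.map₂ (by
      have := A.right_triangle
      simpa [rightZigzag, bicategoricalComp] using this)
    simp only [map₂_comp, map₂_whisker_left, map₂_whisker_right, map₂_associator_inv,
      map₂_leftUnitor_inv, map₂_right_unitor, Category.assoc, Iso.inv_hom_id_assoc,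
      Iso.cancel_iso_hom_left] at h
    simp only [← Category.assoc, Iso.cancel_iso_inv_right] at h
    simp only [Category.assoc] at h
    calc
      _ = (D.mapId a).inv ▷ D.map r ≫ (D.map₂ A.unit ▷ D.map r ≫ (D.mapComp l r).hom ▷ D.map r ≫
          (α_ _ _ _).hom ≫ D.map r ◁ (D.mapComp r l).inv ≫ D.map r ◁ D.map₂ A.counit) ≫
          D.map r ◁ (D.mapId b).hom := by
        simp [leftZigzag, bicategoricalComp]
      _ = _ := by
        rw [h]
        simp
  right_triangle := by
    have h : D.map₂ (A.unit ▷ l ≫ (α_ _ _ _).hom ≫ l ◁ A.counit) =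
        D.map₂ ((λ_ l).hom ≫ (ρ_ l).inv) := congrArg D.map₂ (by
      have := A.left_triangle
      simpa [leftZigzag, bicategoricalComp] using this)
    simp only [map₂_comp, map₂_whisker_left, map₂_whisker_right, map₂_associator,
      map₂_rightUnitor_inv, map₂_left_unitor, Category.assoc, Iso.inv_hom_id_assoc,
      Iso.cancel_iso_hom_left] at h
    simp only [← Category.assoc, Iso.cancel_iso_inv_right] at h
    simp only [Category.assoc] at h
    calc
      _ = D.map l ◁ (D.mapId a).inv ≫ (D.map l ◁ D.map₂ A.unit ≫ D.map l ◁ (D.mapComp l r).hom ≫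
          (α_ _ _ _).inv ≫ (D.mapComp r l).inv ▷ D.map l ≫ D.map₂ A.counit ▷ D.map l) ≫
          (D.mapId b).hom ▷ D.map l := by
        simp [rightZigzag, bicategoricalComp]
      _ = _ := by
        rw [h]
        simp

theorem conj_adj {a b : C} {l₁ l₂ : a ⟶ b} {r₁ r₂ : b ⟶ a} (A₁ : l₁ ⊣ r₁) (A₂ : l₂ ⊣ r₂)
    (α : l₂ ⟶ l₁) :
    conjugateEquiv (D.adj A₂) (D.adj A₁) (D.map₂ (conjugateEquiv A₁ A₂ α)) = D.map₂ α := by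
  have h := congrArg D.map₂ ((conj_eq_iff A₁ A₂ α _).1 rfl)
  simp only [map₂_comp, map₂_whisker_left, map₂_whisker_right, Category.assoc] at h
  rw [conj_eq_iff]
  simp only [Iso.cancel_iso_hom_left] at h
  simp only [adj]
  rw [← reassoc_of% h]

theorem conj_adj_id (a : C) :
    conjugateEquiv (D.adj (Adjunction.id a)) (Adjunction.id (D.obj a)) (D.mapId a).inv =
      (D.mapId a).hom := by
  rw [conj_eq_iff]
  simp only [adj, Bicategory.Adjunction.id, map₂_right_unitor]
  simp
  rw [whisker_exchange_assoc]
  simp [unitors_equal]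

theorem conj_adj_comp {a b c : C} {l₁ : a ⟶ b} {r₁ : b ⟶ a} (A₁ : l₁ ⊣ r₁)
    {l₂ : b ⟶ c} {r₂ : c ⟶ b} (A₂ : l₂ ⊣ r₂) :
    conjugateEquiv (D.adj (A₁.comp A₂)) ((D.adj A₁).comp (D.adj A₂)) (D.mapComp r₂ r₁).inv =
      (D.mapComp l₁ l₂).hom := by
  rw [conj_eq_iff]
  simp only [adj, Bicategory.Adjunction.comp, Bicategory.Adjunction.compCounit, bicategoricalComp]
  simp [map₂_associator, map₂_associator_inv, map₂_comp, map₂_whisker_left, map₂_whisker_right, map₂_left_unitor]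

end Duality

end

section

/-- If `l` is an equivalence, then a 2-isomorphism `k : r ≫ l ≅ 𝟙` is the counit of an adjunction
`l ⊣ r`. -/
noncomputable def adjOfCounit {C : Type u} [Bicategory.{w, v} C] {a b : C} {l : a ⟶ b} {r : b ⟶ a}
    (h : IsEquiv1 l) (k : r ≫ l ≅ 𝟙 b) : l ⊣ r :=
  let i := Classical.choice h.choose_spec.1
  let E : b ≌ a := Equivalence.mkOfAdjointifyCounit k.symm
    (whiskerLeftIso l ((ρ_ r).symm ≪≫ whiskerLeftIso r i.symm ≪≫ (α_ _ _ _).symm ≪≫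
      whiskerRightIso k _ ≪≫ λ_ _) ≪≫ i)
  { unit := E.counit.inv
    counit := k.hom
    left_triangle := by
      have h := congrArg Iso.inv E.right_triangle
      rw [rightZigzagIso_inv] at h
      exact h
    right_triangle := by
      have h := congrArg Iso.inv E.left_triangle
      rw [leftZigzagIso_inv] at h
      exact h }

theorem adjOfCounit_counit {C : Type u} [Bicategory.{w, v} C] {a b : C} {l : a ⟶ b} {r : b ⟶ a}
    (h : IsEquiv1 l) (k : r ≫ l ≅ 𝟙 b) : (adjOfCounit h k).counit = k.hom := rfl

namespace Duality
variable {C : Type u} [Bicategory.{w, v} C] [IsBigroupoid C] (D : Duality C)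

/-- The chosen inverse of `D(f)`. -/
noncomputable def inv {a b : C} (f : a ⟶ b) : D.obj a ⟶ D.obj b :=
  (IsBigroupoid.isEquiv1 (D.map f)).choose

/-- The chosen inverse of `D(f)` is a right adjoint of `D(f)`. -/
noncomputable def invAdj {a b : C} (f : a ⟶ b) : D.map f ⊣ D.inv f :=
  adjOfCounit (IsBigroupoid.isEquiv1 (D.map f))
    (Classical.choice (IsBigroupoid.isEquiv1 (D.map f)).choose_spec.2)

/-- The inverse of the 2-morphism `D(η)`, transported to the chosen inverses. -/
noncomputable def inv₂ {a b : C} {f g : a ⟶ b} (η : f ⟶ g) : D.inv f ⟶ D.inv g :=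
  conjugateEquiv (D.invAdj f) (D.invAdj g)
    (D.map₂ (haveI := IsBigroupoid.isIso η; CategoryTheory.inv η))

theorem inv₂_iso {a b : C} {f g : a ⟶ b} (η : f ≅ g) : D.inv₂ η.hom =
    conjugateEquiv (D.invAdj f) (D.invAdj g) (D.map₂ η.inv) := by
  simp [inv₂]

theorem inv₂_iso_inv {a b : C} {f g : a ⟶ b} (η : f ≅ g) : D.inv₂ η.inv =
    conjugateEquiv (D.invAdj g) (D.invAdj f) (D.map₂ η.hom) :=
  D.inv₂_iso η.symm

theorem exists_iso {a b : C} {f g : a ⟶ b} (η : f ⟶ g) : ∃ i : f ≅ g, i.hom = η :=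
  haveI := IsBigroupoid.isIso η
  ⟨asIso η, rfl⟩

/-- `(𝟙)⁻¹ ≅ 𝟙`. -/
noncomputable def invId (a : C) : D.inv (𝟙 a) ≅ 𝟙 (D.obj a) :=
  conjugateIsoEquiv (D.invAdj (𝟙 a)) (Adjunction.id (D.obj a)) (D.mapId a).symm

/-- `(D(g) ≫ D(f))⁻¹ ≅ D(f)⁻¹ ≫ D(g)⁻¹`. -/
noncomputable def invComp {a b c : C} (f : a ⟶ b) (g : b ⟶ c) :
    D.inv (f ≫ g) ≅ D.inv f ≫ D.inv g :=
  conjugateIsoEquiv (D.invAdj (f ≫ g)) ((D.invAdj g).comp (D.invAdj f)) (D.mapComp f g).symm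

theorem invId_hom (a : C) : (D.invId a).hom =
    conjugateEquiv (D.invAdj (𝟙 a)) (Adjunction.id (D.obj a)) (D.mapId a).inv := rfl

theorem invId_inv (a : C) : (D.invId a).inv =
    conjugateEquiv (Adjunction.id (D.obj a)) (D.invAdj (𝟙 a)) (D.mapId a).hom := rfl

theorem invComp_hom {a b c : C} (f : a ⟶ b) (g : b ⟶ c) :
    (D.invComp f g).hom =
    conjugateEquiv (D.invAdj (f ≫ g)) ((D.invAdj g).comp (D.invAdj f)) (D.mapComp f g).inv := rfl

theorem invComp_inv {a b c : C} (f : a ⟶ b) (g : b ⟶ c) :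
    (D.invComp f g).inv =
    conjugateEquiv ((D.invAdj g).comp (D.invAdj f)) (D.invAdj (f ≫ g)) (D.mapComp f g).hom := rfl

/-- The pseudofunctor `A ↦ D(A)`, `f ↦ D(f)⁻¹`. -/
noncomputable def pseudofunctor : Pseudofunctor C C where
  obj := D.obj
  map := D.inv
  map₂ := D.inv₂
  map₂_id f := by
    rw [← Iso.refl_hom, inv₂_iso, Iso.refl_inv, D.map₂_id, Bicategory.conjugateEquiv_id]
  map₂_comp η ξ := by
    obtain ⟨η, rfl⟩ := exists_iso η
    obtain ⟨ξ, rfl⟩ := exists_iso ξ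
    rw [← Iso.trans_hom, inv₂_iso, inv₂_iso, inv₂_iso, Bicategory.conjugateEquiv_comp,
      Iso.trans_inv, D.map₂_comp]
  mapId := D.invId
  mapComp := D.invComp
  map₂_whisker_left f g h η := by
    obtain ⟨η, rfl⟩ := exists_iso η
    rw [← whiskerLeftIso_hom, inv₂_iso, inv₂_iso, whiskerLeftIso_inv, map₂_whisker_left,
      invComp_hom, invComp_inv, ← Bicategory.conjugateEquiv_whiskerRight,
      Bicategory.conjugateEquiv_comp, Bicategory.conjugateEquiv_comp, Category.assoc]
  map₂_whisker_right {a b c f g} η h := by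
    obtain ⟨η, rfl⟩ := exists_iso η
    rw [← whiskerRightIso_hom, inv₂_iso, inv₂_iso, whiskerRightIso_inv, map₂_whisker_right,
      invComp_hom, invComp_inv, ← Bicategory.conjugateEquiv_whiskerLeft,
      Bicategory.conjugateEquiv_comp, Bicategory.conjugateEquiv_comp, Category.assoc]
  map₂_associator f g h := by
    rw [inv₂_iso, map₂_associator_inv, invComp_hom, invComp_inv, invComp_hom, invComp_inv,
      ← Bicategory.conjugateEquiv_whiskerLeft (D.invAdj h), ← Bicategory.conjugateEquiv_whiskerRight _ _ (D.invAdj f),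
      ← Bicategory.conjugateEquiv_associator_hom (D.invAdj h) (D.invAdj g) (D.invAdj f)]
    simp only [Bicategory.conjugateEquiv_comp, Category.assoc]
  map₂_left_unitor f := by
    rw [inv₂_iso, map₂_leftUnitor_inv, invComp_hom, invId_hom, ← conj_leftUnitor,
      ← Bicategory.conjugateEquiv_whiskerLeft (D.invAdj f),
      Bicategory.conjugateEquiv_comp, Bicategory.conjugateEquiv_comp, Category.assoc]
  map₂_right_unitor f := by
    rw [inv₂_iso, map₂_rightUnitor_inv, invComp_hom, invId_hom, ← conj_rightUnitor,
      ← Bicategory.conjugateEquiv_whiskerRight _ _ (D.invAdj f),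
      Bicategory.conjugateEquiv_comp, Bicategory.conjugateEquiv_comp, Category.assoc]

end Duality

end

section

namespace Duality
variable {C : Type u} [Bicategory.{w, v} C] [IsBigroupoid C] (D : Duality C)

/-- The adjunction `D(e_a) ⊣ e_{D(a)}` with counit `θ_a`. -/
noncomputable def θAdj (a : C) : D.map (D.e a) ⊣ D.e (D.obj a) :=
  adjOfCounit (IsBigroupoid.isEquiv1 _) (D.θ a)

theorem θAdj_counit (a : C) : (D.θAdj a).counit = (D.θ a).hom := rfl

/-- The identification `D(D(f)) ≅ D(D(f)⁻¹)⁻¹`. -/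
noncomputable def κ {a b : C} (f : a ⟶ b) : D.map (D.map f) ≅ D.inv (D.inv f) :=
  conjugateIsoEquiv (D.adj (D.invAdj f)) (D.invAdj (D.inv f)) (Iso.refl _)

theorem κ_hom {a b : C} (f : a ⟶ b) : (D.κ f).hom =
    conjugateEquiv (D.adj (D.invAdj f)) (D.invAdj (D.inv f)) (𝟙 _) := rfl

theorem κ_inv {a b : C} (f : a ⟶ b) : (D.κ f).inv =
    conjugateEquiv (D.invAdj (D.inv f)) (D.adj (D.invAdj f)) (𝟙 _) := rfl

theorem κ_naturality {a b : C} {f g : a ⟶ b} (η : f ⟶ g) :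
    (D.κ f).hom ≫ D.inv₂ (D.inv₂ η) = D.map₂ (D.map₂ η) ≫ (D.κ g).hom := by
  obtain ⟨η, rfl⟩ := exists_iso η
  have h : D.inv₂ η.hom = (conjugateIsoEquiv (D.invAdj f) (D.invAdj g) (D.mapIso η.symm)).hom :=
    D.inv₂_iso η
  rw [h, inv₂_iso, κ_hom, κ_hom, Bicategory.conjugateEquiv_comp,
    ← D.conj_adj (D.invAdj g) (D.invAdj f), Bicategory.conjugateEquiv_comp,
    Category.comp_id, Category.id_comp]
  rfl

theorem κ_id (a : C) : (D.κ (𝟙 a)).hom ≫ D.inv₂ (D.invId a).hom ≫ (D.invId (D.obj a)).hom =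
    D.map₂ (D.mapId a).hom ≫ (D.mapId (D.obj a)).hom := by
  rw [inv₂_iso, κ_hom, invId_hom, invId_inv, ← D.conj_adj (Adjunction.id _) (D.invAdj (𝟙 a)),
    ← conj_adj_id (D := D) (D.obj a)]
  simp only [Bicategory.conjugateEquiv_comp, Category.comp_id, Category.id_comp, Category.assoc]

theorem κ_comp {a b c : C} (f : a ⟶ b) (g : b ⟶ c) :
    (D.κ (f ≫ g)).hom ≫ D.inv₂ (D.invComp f g).hom ≫ (D.invComp (D.inv f) (D.inv g)).hom =
      D.map₂ (D.mapComp f g).hom ≫ (D.mapComp (D.map g) (D.map f)).hom ≫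
        (D.κ f).hom ▷ D.map (D.map g) ≫ D.inv (D.inv f) ◁ (D.κ g).hom := by
  rw [inv₂_iso, κ_hom, κ_hom, κ_hom, invComp_hom, invComp_inv,
    ← D.conj_adj ((D.invAdj g).comp (D.invAdj f)) (D.invAdj (f ≫ g)),
    ← D.conj_adj_comp (D.invAdj g) (D.invAdj f),
    ← Bicategory.conjugateEquiv_whiskerLeft (D.adj (D.invAdj g)),
    ← Bicategory.conjugateEquiv_whiskerRight _ _ (D.invAdj (D.inv f))]
  simp only [Bicategory.conjugateEquiv_comp, Category.comp_id, Category.id_comp, Category.assoc,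
    whiskerLeft_id, id_whiskerRight]

/-- The naturality constraint `f ≫ e_b ≅ e_a ≫ ρ(ρ(f))`. -/
noncomputable def invNat {a b : C} (f : a ⟶ b) : f ≫ D.e b ≅ D.e a ≫ D.inv (D.inv f) :=
  D.nat f ≪≫ whiskerLeftIso (D.e a) (D.κ f)

theorem invNat_comp {a b c : C} (f : a ⟶ b) (g : b ⟶ c) :
    (D.invNat (f ≫ g)).hom ≫ D.e a ◁ (D.inv₂ (D.invComp f g).hom ≫
      (D.invComp (D.inv f) (D.inv g)).hom) =
      (α_ f g (D.e c)).hom ≫ f ◁ (D.invNat g).hom ≫ (α_ f (D.e b) (D.inv (D.inv g))).inv ≫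
        (D.invNat f).hom ▷ D.inv (D.inv g) ≫ (α_ (D.e a) (D.inv (D.inv f)) _).hom := by
  simp only [invNat, Iso.trans_hom, whiskerLeftIso_hom, Category.assoc, ← whiskerLeft_comp, κ_comp]
  simp only [whiskerLeft_comp]
  have h := D.nat_comp f g
  simp only [whiskerLeft_comp] at h
  rw [reassoc_of% h]
  calc
    _ = 𝟙 _ ⊗≫ f ◁ (D.nat g).hom ⊗≫ (D.nat f).hom ▷ D.map (D.map g) ⊗≫
        D.e a ◁ ((D.κ f).hom ▷ D.map (D.map g) ≫ D.inv (D.inv f) ◁ (D.κ g).hom) ⊗≫ 𝟙 _ := by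
      bicategory
    _ = 𝟙 _ ⊗≫ f ◁ (D.nat g).hom ⊗≫ ((D.nat f).hom ▷ D.map (D.map g) ≫
        (D.e a ≫ D.map (D.map f)) ◁ (D.κ g).hom) ⊗≫
          D.e a ◁ (D.κ f).hom ▷ D.inv (D.inv g) ⊗≫ 𝟙 _ := by
      rw [← whisker_exchange]
      bicategory
    _ = _ := by
      rw [← whisker_exchange]
      bicategory

/-- The pseudonatural equivalence `𝟭 ⟶ ρ ∘ ρ`. -/
noncomputable def invTrans :
    Pseudofunctor.StrongTrans (Pseudofunctor.id C) (D.pseudofunctor.comp D.pseudofunctor) where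
  app := D.e
  naturality f := D.invNat f
  naturality_naturality {a b f g} η := by
    change η ▷ D.e b ≫ (D.invNat g).hom = (D.invNat f).hom ≫ D.e a ◁ D.inv₂ (D.inv₂ η)
    simp only [invNat, Iso.trans_hom, whiskerLeftIso_hom, Category.assoc, ← whiskerLeft_comp,
      κ_naturality]
    rw [← Category.assoc, nat_naturality]
    simp
  naturality_id a := by
    change (D.invNat (𝟙 a)).hom ≫ D.e a ◁ (D.inv₂ (D.invId a).hom ≫ (D.invId (D.obj a)).hom) =
      𝟙 (𝟙 a) ▷ D.e a ≫ (λ_ (D.e a)).hom ≫ (ρ_ (D.e a)).inv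
    rw [id_whiskerRight, Category.id_comp, ← nat_id, ← κ_id]
    simp [invNat]
  naturality_comp {a b c} f g := by
    change (D.invNat (f ≫ g)).hom ≫ D.e a ◁ (D.inv₂ (D.invComp f g).hom ≫
      (D.invComp (D.inv f) (D.inv g)).hom) = 𝟙 (f ≫ g) ▷ D.e c ≫ (α_ f g (D.e c)).hom ≫
        f ◁ (D.invNat g).hom ≫ (α_ f (D.e b) (D.inv (D.inv g))).inv ≫
        (D.invNat f).hom ▷ D.inv (D.inv g) ≫ (α_ (D.e a) (D.inv (D.inv f)) _).hom
    rw [id_whiskerRight, Category.id_comp, invNat_comp]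

/-- The modification `e_{D(a)} ≅ D(e_a)⁻¹`. -/
noncomputable def invω (a : C) : D.e (D.obj a) ≅ D.inv (D.e a) :=
  conjugateIsoEquiv (D.θAdj a) (D.invAdj (D.e a)) (Iso.refl _)

theorem invω_hom (a : C) : (D.invω a).hom =
    conjugateEquiv (D.θAdj a) (D.invAdj (D.e a)) (𝟙 _) := rfl

theorem nat_adj {a b : C} {f : a ⟶ b} {r : D.obj a ⟶ D.obj b} (A : D.map f ⊣ r) :
    r ◁ (D.nat (D.map f)).hom ≫ (α_ _ _ _).inv ≫ (D.nat r).hom ▷ D.map (D.map (D.map f)) ≫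
      (α_ _ _ _).hom ≫ D.e (D.obj a) ◁ (D.adj (D.adj A)).counit =
    (α_ _ _ _).inv ≫ A.counit ▷ D.e (D.obj a) ≫ (λ_ _).hom ≫ (ρ_ _).inv := by
  have h1 := D.nat_comp r (D.map f)
  have h2 := D.nat_naturality A.counit
  have h3 := D.nat_id (D.obj a)
  simp only [whiskerLeft_comp] at h1 h3
  have h1' := reassoc_of% h1
  have h3' := reassoc_of% h3
  simp only [adj, map₂_comp, whiskerLeft_comp]
  have hm : D.map₂ (D.mapComp r (D.map f)).hom ≫ D.map₂ (D.mapComp r (D.map f)).inv = 𝟙 _ :=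
    D.map₂_hom_inv _
  calc
    _ = (α_ _ _ _).inv ≫ ((D.nat (r ≫ D.map f)).hom ≫
          D.e (D.obj a) ◁ D.map₂ (D.mapComp r (D.map f)).hom ≫
          D.e (D.obj a) ◁ (D.mapComp (D.map (D.map f)) (D.map r)).hom) ≫
        D.e (D.obj a) ◁ (D.mapComp (D.map (D.map f)) (D.map r)).inv ≫
        D.e (D.obj a) ◁ D.map₂ (D.mapComp r (D.map f)).inv ≫
        D.e (D.obj a) ◁ D.map₂ (D.map₂ A.counit) ≫
        D.e (D.obj a) ◁ D.map₂ (D.mapId (D.obj a)).hom ≫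
        D.e (D.obj a) ◁ (D.mapId (D.obj (D.obj a))).hom := by
      rw [h1]
      simp
    _ = (α_ _ _ _).inv ≫ (D.nat (r ≫ D.map f)).hom ≫
        D.e (D.obj a) ◁ (D.map₂ (D.mapComp r (D.map f)).hom ≫
          D.map₂ (D.mapComp r (D.map f)).inv) ≫
        D.e (D.obj a) ◁ D.map₂ (D.map₂ A.counit) ≫
        D.e (D.obj a) ◁ D.map₂ (D.mapId (D.obj a)).hom ≫
        D.e (D.obj a) ◁ (D.mapId (D.obj (D.obj a))).hom := by
      simp
    _ = (α_ _ _ _).inv ≫ A.counit ▷ D.e (D.obj a) ≫ ((D.nat (𝟙 (D.obj a))).hom ≫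
        D.e (D.obj a) ◁ D.map₂ (D.mapId (D.obj a)).hom ≫
        D.e (D.obj a) ◁ (D.mapId (D.obj (D.obj a))).hom) := by
      rw [hm, whiskerLeft_id, Category.id_comp, reassoc_of% h2]
    _ = _ := by
      rw [h3]

theorem conj_nat {a b : C} {f : a ⟶ b} {r : D.obj a ⟶ D.obj b} (A : D.map f ⊣ r) :
    conjugateEquiv ((D.θAdj b).comp A) ((D.adj (D.adj A)).comp (D.θAdj a))
      ((D.mapComp (D.e a) (D.map (D.map f))).inv ≫ D.map₂ (D.nat f).inv ≫
        (D.mapComp f (D.e b)).hom) = (D.nat r).hom := by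
  rw [conj_eq_iff]
  have h := D.nat_adj A
  have hθ := D.θ_naturality f
  simp only [Bicategory.Adjunction.comp, Bicategory.Adjunction.compCounit, θAdj_counit]
  set X := (D.mapComp (D.e a) (D.map (D.map f))).inv ≫ D.map₂ (D.nat f).inv ≫
        (D.mapComp f (D.e b)).hom with hX
  set K := (D.adj (D.adj A)).counit
  have hi : (D.nat (D.map f)).inv ▷ D.map (D.e a) ≫ (α_ _ _ _).hom ≫ D.map f ◁ (D.θ a).hom ≫
      (ρ_ (D.map f)).hom = (α_ _ _ _).hom ≫ D.e (D.obj b) ◁ X ≫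
        (α_ _ _ _).inv ≫ (D.θ b).hom ▷ D.map f ≫ (λ_ (D.map f)).hom := by
    rw [hθ]
    simp
  symm
  calc
    _ = 𝟙 _ ⊗≫ r ◁ ((α_ _ _ _).hom ≫ D.e (D.obj b) ◁ X ≫
        (α_ _ _ _).inv ≫ (D.θ b).hom ▷ D.map f ≫ (λ_ (D.map f)).hom) ⊗≫ A.counit ⊗≫ 𝟙 _ := by
      bicategory
    _ = 𝟙 _ ⊗≫ r ◁ (D.nat (D.map f)).inv ▷ D.map (D.e a) ⊗≫
        ((r ≫ D.map f) ◁ (D.θ a).hom ≫ A.counit ▷ 𝟙 _) ⊗≫ 𝟙 _ := by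
      rw [← hi]
      bicategory
    _ = 𝟙 _ ⊗≫ r ◁ (D.nat (D.map f)).inv ▷ D.map (D.e a) ⊗≫
        ((α_ _ _ _).inv ≫ A.counit ▷ D.e (D.obj a) ≫ (λ_ _).hom ≫ (ρ_ _).inv) ▷ D.map (D.e a) ⊗≫
        (D.θ a).hom ⊗≫ 𝟙 _ := by
      rw [whisker_exchange]
      bicategory
    _ = 𝟙 _ ⊗≫ r ◁ ((D.nat (D.map f)).inv ≫ (D.nat (D.map f)).hom) ▷ D.map (D.e a) ⊗≫
        (D.nat r).hom ▷ D.map (D.map (D.map f)) ▷ D.map (D.e a) ⊗≫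
        D.e (D.obj a) ◁ K ▷ D.map (D.e a) ⊗≫
        (D.θ a).hom ⊗≫ 𝟙 _ := by
      rw [← h]
      bicategory
    _ = _ := by
      rw [Iso.inv_hom_id]
      bicategory

theorem invω_naturality {a b : C} (f : a ⟶ b) :
    (D.invNat (D.inv f)).hom ≫ (D.invω a).hom ▷ D.inv (D.inv (D.inv f)) =
      D.inv f ◁ (D.invω b).hom ≫ (D.invComp f (D.e b)).inv ≫ D.inv₂ (D.invNat f).hom ≫
        (D.invComp (D.e a) (D.inv (D.inv f))).hom := by
  have h : (D.mapComp (D.e a) (D.inv (D.inv f))).inv ≫ D.map₂ (D.invNat f).inv =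
      D.map₂ (D.κ f).inv ▷ D.map (D.e a) ≫ (D.mapComp (D.e a) (D.map (D.map f))).inv ≫
        D.map₂ (D.nat f).inv := by
    simp [invNat, map₂_comp, map₂_whisker_left]
  have hk : conjugateEquiv (D.adj (D.adj (D.invAdj f))) (D.adj (D.invAdj (D.inv f)))
      (D.map₂ (D.κ f).inv) = 𝟙 _ := by
    rw [κ_inv, conj_adj, map₂_id]
  have h' := congrArg (D.e (D.obj a) ◁ ·) hk
  simp only [whiskerLeft_id, ← Bicategory.conjugateEquiv_whiskerRight _ _ (D.θAdj a)] at h'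
  have hn : (D.invNat (D.inv f)).hom = conjugateEquiv ((D.θAdj b).comp (D.invAdj f))
      ((D.invAdj (D.inv (D.inv f))).comp (D.θAdj a)) ((D.mapComp (D.e a) (D.inv (D.inv f))).inv ≫
        D.map₂ (D.invNat f).inv ≫ (D.mapComp f (D.e b)).hom) := by
    calc
      _ = (D.nat (D.inv f)).hom ≫ 𝟙 _ ≫ D.e (D.obj a) ◁ (D.κ (D.inv f)).hom := by
        simp [invNat]
      _ = _ := by
        rw [← h', κ_hom, ← Bicategory.conjugateEquiv_whiskerRight _ _ (D.θAdj a),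
          ← D.conj_nat (D.invAdj f), reassoc_of% h]
        simp only [Bicategory.conjugateEquiv_comp, Category.assoc, id_whiskerRight,
          Category.id_comp]
  rw [hn, inv₂_iso, invω_hom, invω_hom, invComp_hom, invComp_inv,
    ← Bicategory.conjugateEquiv_whiskerLeft (D.invAdj (D.inv (D.inv f))),
    ← Bicategory.conjugateEquiv_whiskerRight _ _ (D.invAdj f)]
  simp only [Bicategory.conjugateEquiv_comp, Category.assoc, id_whiskerRight, whiskerLeft_id,
    Category.id_comp, Category.comp_id]

theorem nat_e (b : C) : (D.nat (D.e b)).hom =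
    D.e b ◁ conjugateEquiv (D.θAdj (D.obj b)) (D.adj (D.θAdj b)) (𝟙 _) := by
  set Y := conjugateEquiv (D.θAdj (D.obj b)) (D.adj (D.θAdj b)) (𝟙 _) with hY
  have h := (conj_eq_iff (D.θAdj (D.obj b)) (D.adj (D.θAdj b)) (𝟙 _) Y).1 hY.symm
  rw [whiskerLeft_id, Category.id_comp, θAdj_counit] at h
  have hs := D.swallowtail b
  have hc : D.e b ◁ ((D.mapComp (D.e (D.obj b)) (D.map (D.e b))).inv ≫ D.map₂ (D.θ b).hom ≫
    (D.mapId (D.obj b)).hom) = D.e b ◁ (D.adj (D.θAdj b)).counit := rfl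
  rw [← h, hc] at hs
  set K := (D.adj (D.θAdj b)).counit
  set U := (D.adj (D.θAdj b)).unit
  have key : ∀ Z : D.e b ≫ D.e (D.obj (D.obj b)) ⟶ D.e b ≫ D.map (D.map (D.e b)),
      Z = 𝟙 _ ⊗≫ (D.e b ≫ D.e (D.obj (D.obj b))) ◁ U ⊗≫
        (Z ▷ D.map (D.e (D.obj b)) ≫ (α_ _ _ _).hom ≫ D.e b ◁ K) ▷ D.map (D.map (D.e b)) ⊗≫
          𝟙 _ := by
    intro Z
    symm
    have hr := (D.adj (D.θAdj b)).right_triangle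
    calc
      _ = 𝟙 _ ⊗≫ ((D.e b ≫ D.e (D.obj (D.obj b))) ◁ U ≫ Z ▷ _) ⊗≫
          D.e b ◁ K ▷ D.map (D.map (D.e b)) ⊗≫ 𝟙 _ := by bicategory
      _ = 𝟙 _ ⊗≫ Z ⊗≫ D.e b ◁ rightZigzag U K ⊗≫ 𝟙 _ := by
        rw [whisker_exchange]
        bicategory
      _ = _ := by
        rw [hr]
        bicategory
  have hf : (D.nat (D.e b)).hom ▷ D.map (D.e (D.obj b)) ≫ (α_ _ _ _).hom ≫ D.e b ◁ K =
      (D.e b ◁ Y) ▷ D.map (D.e (D.obj b)) ≫ (α_ _ _ _).hom ≫ D.e b ◁ K := by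
    rw [← cancel_mono (ρ_ (D.e b)).hom, ← cancel_epi (α_ _ _ _).inv]
    simp only [Category.assoc]
    rw [← hs]
    simp
  rw [key (D.nat (D.e b)).hom, hf, ← key]

theorem invω_pentagon (b : C) :
    (D.invNat (D.e b)).hom = D.e b ◁ ((D.invω (D.obj b)).hom ≫ D.inv₂ (D.invω b).hom) := by
  have h : D.inv₂ (D.invω b).hom = conjugateEquiv _ _ (D.map₂ (D.invω b).inv) := D.inv₂_iso _
  have h' : conjugateEquiv (D.adj (D.θAdj b)) (D.adj (D.invAdj (D.e b))) (D.map₂ (D.invω b).inv) =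
      𝟙 _ := by
    change conjugateEquiv _ _ (D.map₂ (conjugateEquiv (D.invAdj (D.e b)) (D.θAdj b) (𝟙 _))) = _
    rw [conj_adj, map₂_id]
  rw [invNat, Iso.trans_hom, whiskerLeftIso_hom, nat_e, ← whiskerLeft_comp, κ_hom, h, invω_hom]
  congr 1
  rw [← Category.id_comp (conjugateEquiv (D.adj (D.invAdj (D.e b))) _ _), ← h']
  simp only [Bicategory.conjugateEquiv_comp, Category.comp_id, Category.id_comp]

/-- The action of `ℤ/2` on a bigroupoid which is determined by a duality `D`. Its generator acts by
`A ↦ D(A)`, `f ↦ D(f)⁻¹`. -/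
noncomputable def action : Z2Action C where
  ρ := D.pseudofunctor
  R := D.invTrans
  R_equiv a := D.e_equiv a
  ω := D.invω
  ω_naturality := D.invω_naturality
  ω_pentagon := D.invω_pentagon

end Duality

section
variable {B : Type u} [Bicategory.{w, v} B] {C : Type u'} [Bicategory.{w', v'} C]

/-- A biequivalence: a pseudofunctor which is essentially surjective up to equivalence and induces
equivalences of the categories of 1-morphisms. -/
def IsBiequivalence (F : Pseudofunctor B C) : Prop :=
  (∀ a b : B, (F.mapFunctor a b).IsEquivalence) ∧
    ∀ c : C, ∃ (b : B) (f : F.obj b ⟶ c), IsEquiv1 f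

end

end

/-! The statement holds for every duality `D` on a bigroupoid; superalgebras enter only at the end,
through `SAlgFd.duality`. A stellar object and a homotopy fixed point consist of the same object a
and the same invertible 1-morphism M : D(a) → a. The remaining data differ only in that the stellar
side uses D, which reverses 1-morphisms, while the action uses the chosen inverse D(-)⁻¹. The
invertible counit D(N)⁻¹ ≫ D(N) ≅ 𝟙 moves a factor D(N) from one side of a 2-morphism to the other,
and each stellar datum is thereby transposed into a fixed point datum.

For 1-morphisms, a unitarity datum D(N) ≫ M ≫ N ≅ M' becomes a square M ≫ N ≅ D(N)⁻¹ ≫ M' (`square`,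
inverted by `exists_square`). For objects, σ : M ≫ e ≅ D(M) becomes φ : e ≫ D(M)⁻¹ ≫ M ≅ 𝟙
(`Transposed`); here σ and φ determine each other because whiskering with an equivalence is fully
faithful.

It remains to match the axioms. Unitarity of a 2-morphism is compatibility with the squares
(`square_conjMap`). Hermiticity of a unitarity datum is compatibility of its square with the fixed
point data (`compatible_iff`). The involution condition on σ is the coherence condition on φ for the
triple (R, R, R) (`coherence_iff`). All three are proved in one way: both sides are modified by
operations that lose no information, such as whiskering with an equivalence or composing with an
invertible 2-morphism, until they visibly contain the two sides of the other axiom. The structure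
cells of the action are mates of those of D, so they are eliminated through the characterisation of
mates by counits (`conj_eq_iff`).

Transposition sends identity and composite unitarity data to the identity square and to pasted
squares (`square_conjId`, `square_comp`). The resulting pseudofunctor therefore has constraints
whose underlying 2-morphisms are identities. It is surjective on objects and on 1-morphisms and
bijective on 2-morphisms. The core loses none of these 1-morphisms, since every stellar 1-morphism
is an equivalence (`Stellar.isEquiv1`). -/

section
-- Whiskering with an equivalence is fully faithful
variable {C : Type u} [Bicategory.{w, v} C]

/-- Postcomposition with an equivalence is an equivalence of categories. -/
theorem IsEquiv1.postcomp_isEquivalence {b c : C} {f : b ⟶ c} (h : IsEquiv1 f) (a : C) :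
    (postcomp a f).IsEquivalence := by
  obtain ⟨g, ⟨i⟩, ⟨j⟩⟩ := h
  -- Naturality of the unit and, in `hj`, of the counit, for postcomposition with the inverse g as
  -- the inverse functor. Both are instances of the interchange law.
  have hi {x y : a ⟶ b} (η : x ⟶ y) : η ≫ (ρ_ y).inv ≫ y ◁ i.inv ≫ (α_ y f g).inv =
      ((ρ_ x).inv ≫ x ◁ i.inv ≫ (α_ x f g).inv) ≫ η ▷ f ▷ g := by
    calc
      _ = 𝟙 _ ⊗≫ (η ▷ 𝟙 b ≫ y ◁ i.inv) ⊗≫ 𝟙 _ := by bicategory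
      _ = _ := by rw [← whisker_exchange]; bicategory
  have hj {x y : a ⟶ c} (η : x ⟶ y) : η ▷ g ▷ f ≫ (α_ y g f).hom ≫ y ◁ j.hom ≫ (ρ_ y).hom =
      ((α_ x g f).hom ≫ x ◁ j.hom ≫ (ρ_ x).hom) ≫ η := by
    calc
      _ = 𝟙 _ ⊗≫ (η ▷ (g ≫ f) ≫ y ◁ j.hom) ⊗≫ 𝟙 _ := by bicategory
      _ = _ := by rw [← whisker_exchange]; bicategory
  exact (CategoryTheory.Equivalence.mk (postcomp a f) (postcomp a g)
    (NatIso.ofComponents (fun x => (ρ_ x).symm ≪≫ whiskerLeftIso x i.symm ≪≫ (α_ x f g).symm) hi)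
    (NatIso.ofComponents (fun x => α_ x g f ≪≫ whiskerLeftIso x j ≪≫ ρ_ x)
      hj)).isEquivalence_functor

/-- Precomposition with an equivalence is an equivalence of categories. -/
theorem IsEquiv1.precomp_isEquivalence {a b : C} {f : a ⟶ b} (h : IsEquiv1 f) (c : C) :
    (precomp c f).IsEquivalence := by
  obtain ⟨g, ⟨i⟩, ⟨j⟩⟩ := h
  have hj {x y : b ⟶ c} (η : x ⟶ y) : η ≫ (λ_ y).inv ≫ j.inv ▷ y ≫ (α_ g f y).hom =
      ((λ_ x).inv ≫ j.inv ▷ x ≫ (α_ g f x).hom) ≫ g ◁ f ◁ η := by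
    calc
      _ = 𝟙 _ ⊗≫ (𝟙 b ◁ η ≫ j.inv ▷ y) ⊗≫ 𝟙 _ := by bicategory
      _ = _ := by rw [whisker_exchange]; bicategory
  have hi {x y : a ⟶ c} (η : x ⟶ y) : f ◁ g ◁ η ≫ (α_ f g y).inv ≫ i.hom ▷ y ≫ (λ_ y).hom =
      ((α_ f g x).inv ≫ i.hom ▷ x ≫ (λ_ x).hom) ≫ η := by
    calc
      _ = 𝟙 _ ⊗≫ ((f ≫ g) ◁ η ≫ i.hom ▷ y) ⊗≫ 𝟙 _ := by bicategory
      _ = _ := by rw [whisker_exchange]; bicategory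
  exact (CategoryTheory.Equivalence.mk (precomp c f) (precomp c g)
    (NatIso.ofComponents (fun x => (λ_ x).symm ≪≫ whiskerRightIso j.symm x ≪≫ α_ g f x) hj)
    (NatIso.ofComponents (fun x => (α_ f g x).symm ≪≫ whiskerRightIso i x ≪≫ λ_ x)
      hi)).isEquivalence_functor

/-- Faithfulness of postcomposition. With its left-handed twin it is the rule for stripping an
equivalence from both sides of an equation, on which the comparisons of axioms rest. -/
theorem IsEquiv1.whiskerRight_inj {a b c : C} {f : b ⟶ c} (h : IsEquiv1 f) {x y : a ⟶ b}
    {η ξ : x ⟶ y} : η ▷ f = ξ ▷ f ↔ η = ξ :=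
  haveI := h.postcomp_isEquivalence a
  (postcomp a f).map_injective_iff _ _

theorem IsEquiv1.whiskerLeft_inj {a b c : C} {f : a ⟶ b} (h : IsEquiv1 f) {x y : b ⟶ c}
    {η ξ : x ⟶ y} : f ◁ η = f ◁ ξ ↔ η = ξ :=
  haveI := h.precomp_isEquivalence c
  (precomp c f).map_injective_iff _ _

/-- Fullness of postcomposition, which reflects isomorphisms as well. This lemma and its left-handed
twin produce every transposed datum: a formula gives the whiskered 2-isomorphism, and the datum is
its preimage. -/
theorem IsEquiv1.exists_whiskerRight {a b c : C} {f : b ⟶ c} (h : IsEquiv1 f) {x y : a ⟶ b}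
    (ζ : x ≫ f ≅ y ≫ f) : ∃ η : x ≅ y, η.hom ▷ f = ζ.hom :=
  haveI := h.postcomp_isEquivalence a
  ⟨(postcomp a f).preimageIso ζ, (postcomp a f).map_preimage ζ.hom⟩

theorem IsEquiv1.exists_whiskerLeft {a b c : C} {f : a ⟶ b} (h : IsEquiv1 f) {x y : b ⟶ c}
    (ζ : f ≫ x ≅ f ≫ y) : ∃ η : x ≅ y, f ◁ η.hom = ζ.hom :=
  haveI := h.precomp_isEquivalence c
  ⟨(precomp c f).preimageIso ζ, (precomp c f).map_preimage ζ.hom⟩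

end

/-! ### Unitarity data as squares -/

namespace Duality
variable {C : Type u} [Bicategory.{w, v} C] [IsBigroupoid C] (D : Duality C)

theorem isEquiv1 {a b : C} (f : a ⟶ b) : IsEquiv1 f := IsBigroupoid.isEquiv1 f

/-- The counit `D(f)⁻¹ ≫ D(f) ≅ 𝟙`. -/
noncomputable def counit {a b : C} (f : a ⟶ b) : D.inv f ≫ D.map f ≅ 𝟙 (D.obj a) :=
  haveI := IsBigroupoid.isIso (D.invAdj f).counit
  asIso (D.invAdj f).counit

theorem counit_hom {a b : C} (f : a ⟶ b) : (D.counit f).hom = (D.invAdj f).counit := rfl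

theorem inv₂_counit {a b : C} {f g : a ⟶ b} (η : f ≅ g) :
    D.inv₂ η.hom ▷ D.map g ≫ (D.counit g).hom = D.inv f ◁ D.map₂ η.inv ≫ (D.counit f).hom :=
  (conj_eq_iff (D.invAdj f) (D.invAdj g) _ _).1 (D.inv₂_iso η).symm

theorem invId_counit (a : C) :
    (D.counit (𝟙 a)).hom = D.inv (𝟙 a) ◁ (D.mapId a).hom ≫ (ρ_ _).hom ≫ (D.invId a).hom := by
  have h := (conj_eq_iff (D.invAdj (𝟙 a)) (Adjunction.id (D.obj a)) _ _).1 (D.invId_hom a).symm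
  rw [counit_hom, ← cancel_epi (D.inv (𝟙 a) ◁ (D.mapId a).inv), ← h]
  simp [Bicategory.Adjunction.id]

theorem invComp_counit {a b c : C} (f : a ⟶ b) (g : b ⟶ c) :
    (D.counit (f ≫ g)).hom = 𝟙 _ ⊗≫ (D.invComp f g).hom ▷ D.map (f ≫ g) ⊗≫
      (D.inv f ≫ D.inv g) ◁ (D.mapComp f g).hom ⊗≫ D.inv f ◁ (D.counit g).hom ▷ D.map f ⊗≫
        (D.counit f).hom := by
  have h := (conj_eq_iff (D.invAdj (f ≫ g)) ((D.invAdj g).comp (D.invAdj f)) _ _).1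
    (D.invComp_hom f g).symm
  -- After this precomposition the left-hand side is one side of the counit identity `h` for the
  -- mate `invComp`; on the right the comparison cell has to slide along until it meets its inverse.
  rw [counit_hom, ← cancel_epi (D.inv (f ≫ g) ◁ (D.mapComp f g).inv), ← h]
  simp only [Bicategory.Adjunction.comp, Bicategory.Adjunction.compCounit, ← counit_hom]
  symm
  calc
    _ = 𝟙 _ ⊗≫ (D.inv (f ≫ g) ◁ (D.mapComp f g).inv ≫ (D.invComp f g).hom ▷ D.map (f ≫ g)) ⊗≫
      (D.inv f ≫ D.inv g) ◁ (D.mapComp f g).hom ⊗≫ D.inv f ◁ (D.counit g).hom ▷ D.map f ⊗≫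
        (D.counit f).hom := by bicategory
    _ = 𝟙 _ ⊗≫ (D.invComp f g).hom ▷ (D.map g ≫ D.map f) ⊗≫
      (D.inv f ≫ D.inv g) ◁ ((D.mapComp f g).inv ≫ (D.mapComp f g).hom) ⊗≫
        D.inv f ◁ (D.counit g).hom ▷ D.map f ⊗≫ (D.counit f).hom := by
      rw [whisker_exchange]
      bicategory
    _ = _ := by
      rw [Iso.inv_hom_id]
      bicategory

section square
variable {a b : C} {N : a ⟶ b} {M : D.obj a ⟶ a} {M' : D.obj b ⟶ b}

/-- The square `M ≫ N ≅ D(N)⁻¹ ≫ M'` which corresponds to a unitarity datum. -/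
noncomputable def square (φ : D.conj N M ≅ M') : M ≫ N ≅ D.inv N ≫ M' :=
  (λ_ _).symm ≪≫ whiskerRightIso (D.counit N).symm _ ≪≫ α_ _ _ _ ≪≫ whiskerLeftIso _ φ

/-- The definition of `square` contains the inverse of the counit; cancelling it characterises the
square by a condition with counits only, which is easy to test in pasting calculations. -/
theorem square_eq_iff (φ : D.conj N M ≅ M') (s : M ≫ N ≅ D.inv N ≫ M') :
    D.square φ = s ↔ (D.counit N).hom ▷ (M ≫ N) ≫ (λ_ _).hom ≫ s.hom =
      (α_ _ _ _).hom ≫ D.inv N ◁ φ.hom := by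
  constructor
  · rintro rfl
    simp [square]
  · intro h
    ext
    rw [← cancel_epi (λ_ (M ≫ N)).hom, ← cancel_epi ((D.counit N).hom ▷ (M ≫ N)), h]
    simp [square]

theorem counit_square (φ : D.conj N M ≅ M') :
    (D.counit N).hom ▷ (M ≫ N) ≫ (λ_ _).hom ≫ (D.square φ).hom =
      (α_ _ _ _).hom ≫ D.inv N ◁ φ.hom := (D.square_eq_iff φ _).1 rfl

/-- The condition of `square_eq_iff` prescribes the datum whiskered with the equivalence D(N)⁻¹, and
such a whiskering has a preimage. This gives surjectivity on 1-morphisms. -/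
theorem exists_square (s : M ≫ N ≅ D.inv N ≫ M') : ∃ φ : D.conj N M ≅ M', D.square φ = s := by
  obtain ⟨φ, h⟩ := (isEquiv1 (D.inv N)).exists_whiskerLeft
    ((α_ _ _ _).symm ≪≫ whiskerRightIso (D.counit N) _ ≪≫ λ_ _ ≪≫ s)
  refine ⟨φ, (D.square_eq_iff _ _).2 ?_⟩
  rw [h]
  simp

/-- Precompose the square condition with the invertible cell made of D(ψ⁻¹) and the counit of N.
Both sides then begin with `inv₂` of ψ and continue with a cell whiskered by D(N')⁻¹; removing both
leaves the unitarity condition, multiplied by D(ψ⁻¹). -/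
theorem square_conjMap {N' : a ⟶ b} (φ : D.conj N M ≅ M') (φ' : D.conj N' M ≅ M') (ψ : N ≅ N') :
    M ◁ ψ.hom ≫ (D.square φ').hom = (D.square φ).hom ≫ D.inv₂ ψ.hom ▷ M' ↔
      D.conjMap ψ.hom M ≫ φ'.hom = φ.hom := by
  -- The factor D(ψ⁻¹) is there to exchange the counit of N for that of N', which is the one that
  -- evaluates the square of φ'.
  have e : D.inv N ◁ D.map₂ ψ.inv ▷ (M ≫ N) ≫ (α_ _ _ _).inv ≫ (D.counit N).hom ▷ (M ≫ N) ≫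
        (λ_ _).hom ≫ M ◁ ψ.hom ≫ (D.square φ').hom =
      D.inv₂ ψ.hom ▷ (D.map N' ≫ M ≫ N) ≫ D.inv N' ◁ (D.map N' ◁ M ◁ ψ.hom ≫ φ'.hom) := by
    calc
      _ = 𝟙 _ ⊗≫ (D.inv N ◁ D.map₂ ψ.inv ≫ (D.counit N).hom) ▷ (M ≫ N) ⊗≫ M ◁ ψ.hom ≫
          (D.square φ').hom := by bicategory
      _ = 𝟙 _ ⊗≫ D.inv₂ ψ.hom ▷ D.map N' ▷ (M ≫ N) ⊗≫ ((D.counit N').hom ▷ (M ≫ N) ≫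
          𝟙 _ ◁ M ◁ ψ.hom) ⊗≫ (D.square φ').hom := by
        rw [← inv₂_counit]
        bicategory
      _ = 𝟙 _ ⊗≫ D.inv₂ ψ.hom ▷ D.map N' ▷ (M ≫ N) ⊗≫ D.inv N' ◁ D.map N' ◁ M ◁ ψ.hom ⊗≫
          (D.counit N').hom ▷ (M ≫ N') ≫ (λ_ _).hom ≫ (D.square φ').hom := by
        rw [← whisker_exchange]
        bicategory
      _ = _ := by
        rw [counit_square]
        bicategory
  -- On this side the counit of N evaluates the square of φ directly; afterwards `inv₂` of ψ only
  -- has to slide to the front.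
  have e' : D.inv N ◁ D.map₂ ψ.inv ▷ (M ≫ N) ≫ (α_ _ _ _).inv ≫ (D.counit N).hom ▷ (M ≫ N) ≫
        (λ_ _).hom ≫ (D.square φ).hom ≫ D.inv₂ ψ.hom ▷ M' =
      D.inv₂ ψ.hom ▷ (D.map N' ≫ M ≫ N) ≫ D.inv N' ◁ (D.map₂ ψ.inv ▷ (M ≫ N) ≫ φ.hom) := by
    have := reassoc_of% D.counit_square φ
    rw [this, Iso.inv_hom_id_assoc, whisker_exchange, whisker_exchange_assoc,
      ← whiskerLeft_comp]
  have := IsBigroupoid.isIso (D.inv₂ ψ.hom)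
  have hp : D.map₂ ψ.hom ≫ D.map₂ ψ.inv = 𝟙 _ := D.map₂_hom_inv ψ
  have hp' : D.map₂ ψ.inv ≫ D.map₂ ψ.hom = 𝟙 _ := D.map₂_inv_hom ψ
  have : IsIso (D.map₂ ψ.inv) := ⟨_, hp', hp⟩
  rw [← cancel_epi (D.inv N ◁ D.map₂ ψ.inv ▷ (M ≫ N) ≫ (α_ _ _ _).inv ≫
    (D.counit N).hom ▷ (M ≫ N) ≫ (λ_ _).hom)]
  simp only [Category.assoc]
  -- The unitarity condition is multiplied by D(ψ⁻¹) as well, which cancels the factor D(ψ) inside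
  -- `conjMap`.
  rw [e, e', cancel_epi, (isEquiv1 (D.inv N')).whiskerLeft_inj,
    ← cancel_epi (D.map₂ ψ.inv ▷ (M ≫ N)), conjMap, Category.assoc, ← comp_whiskerRight_assoc, hp',
    id_whiskerRight, Category.id_comp]

end square

/-- The counit of an identity is `mapId` followed by `invId`. The first is the comparison cell in
`conjId`, the second cancels the one in `squareId`. -/
theorem square_conjId {a : C} (M : D.obj a ⟶ a) : D.square (D.conjId M) = D.action.squareId M := by
  refine (D.square_eq_iff _ _).2 ?_
  -- Unfolds the action: its unit constraint is `invId`.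
  change _ ≫ _ ≫ (ρ_ M ≪≫ (λ_ M).symm ≪≫ whiskerRightIso (D.invId a).symm M).hom = _
  rw [invId_counit]
  simp only [conjId, Iso.trans_hom, Iso.symm_hom, whiskerRightIso_hom]
  calc
    _ = 𝟙 _ ⊗≫ D.inv (𝟙 a) ◁ (D.mapId a).hom ▷ M ⊗≫
      ((D.invId a).hom ≫ (D.invId a).inv) ▷ M ⊗≫ 𝟙 _ := by bicategory
    _ = _ := by
      rw [Iso.hom_inv_id]
      bicategory

/-- The counit of a composite is a nest of the two counits. The counit of N₁ evaluates the first
square to φ₁, the counit of N₂ slides past φ₁ and evaluates the second square to φ₂, and the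
comparison cell `invComp` cancels against the one in the pasted square. -/
theorem square_comp {a b c : C} {N₁ : a ⟶ b} {N₂ : b ⟶ c} {M : D.obj a ⟶ a} {M' : D.obj b ⟶ b}
    {M'' : D.obj c ⟶ c} (φ₁ : D.conj N₁ M ≅ M') (φ₂ : D.conj N₂ M' ≅ M'') :
    D.square (D.conjComp N₁ N₂ M ≪≫ whiskerLeftIso (D.map N₂) (whiskerRightIso φ₁ N₂) ≪≫ φ₂) =
      D.action.squareComp (D.square φ₁) (D.square φ₂) := by
  refine (D.square_eq_iff _ _).2 ?_
  change _ ≫ _ ≫ ((α_ M N₁ N₂).symm ≪≫ whiskerRightIso (D.square φ₁) N₂ ≪≫ α_ _ _ _ ≪≫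
    whiskerLeftIso (D.inv N₁) (D.square φ₂) ≪≫ (α_ _ _ _).symm ≪≫
      whiskerRightIso (D.invComp N₁ N₂).symm M'').hom = _
  rw [invComp_counit]
  simp only [conjComp, Iso.trans_hom, Iso.symm_hom, whiskerRightIso_hom, whiskerLeftIso_hom]
  have h1 := D.counit_square φ₁
  have h2 := D.counit_square φ₂
  calc
    _ = 𝟙 _ ⊗≫ (D.invComp N₁ N₂).hom ▷ (D.map (N₁ ≫ N₂) ≫ M ≫ N₁ ≫ N₂) ⊗≫
      (D.inv N₁ ≫ D.inv N₂) ◁ (D.mapComp N₁ N₂).hom ▷ (M ≫ N₁ ≫ N₂) ⊗≫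
      D.inv N₁ ◁ (D.counit N₂).hom ▷ D.map N₁ ▷ (M ≫ N₁ ≫ N₂) ⊗≫
      ((D.counit N₁).hom ▷ (M ≫ N₁) ≫ (λ_ _).hom ≫ (D.square φ₁).hom) ▷ N₂ ⊗≫
      D.inv N₁ ◁ (D.square φ₂).hom ⊗≫ (D.invComp N₁ N₂).inv ▷ M'' := by bicategory
    _ = 𝟙 _ ⊗≫ (D.invComp N₁ N₂).hom ▷ (D.map (N₁ ≫ N₂) ≫ M ≫ N₁ ≫ N₂) ⊗≫
      (D.inv N₁ ≫ D.inv N₂) ◁ (D.mapComp N₁ N₂).hom ▷ (M ≫ N₁ ≫ N₂) ⊗≫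
      D.inv N₁ ◁ ((D.counit N₂).hom ▷ (D.map N₁ ≫ M ≫ N₁) ≫ 𝟙 _ ◁ φ₁.hom) ▷ N₂ ⊗≫
      D.inv N₁ ◁ (D.square φ₂).hom ⊗≫ (D.invComp N₁ N₂).inv ▷ M'' := by
      rw [h1]
      bicategory
    _ = 𝟙 _ ⊗≫ (D.invComp N₁ N₂).hom ▷ (D.map (N₁ ≫ N₂) ≫ M ≫ N₁ ≫ N₂) ⊗≫
      (D.inv N₁ ≫ D.inv N₂) ◁ ((D.mapComp N₁ N₂).hom ▷ (M ≫ N₁ ≫ N₂) ⊗≫ D.map N₂ ◁ φ₁.hom ▷ N₂) ⊗≫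
      D.inv N₁ ◁ ((D.counit N₂).hom ▷ (M' ≫ N₂) ≫ (λ_ _).hom ≫ (D.square φ₂).hom) ⊗≫
        (D.invComp N₁ N₂).inv ▷ M'' := by
      rw [← whisker_exchange]
      bicategory
    _ = 𝟙 _ ⊗≫ ((D.invComp N₁ N₂).hom ▷ (D.map (N₁ ≫ N₂) ≫ M ≫ N₁ ≫ N₂) ≫
      (D.inv N₁ ≫ D.inv N₂) ◁ ((D.mapComp N₁ N₂).hom ▷ (M ≫ N₁ ≫ N₂) ⊗≫ D.map N₂ ◁ φ₁.hom ▷ N₂ ⊗≫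
        φ₂.hom)) ⊗≫ (D.invComp N₁ N₂).inv ▷ M'' := by
      rw [h2]
      bicategory
    _ = 𝟙 _ ⊗≫ D.inv (N₁ ≫ N₂) ◁ ((D.mapComp N₁ N₂).hom ▷ (M ≫ N₁ ≫ N₂) ⊗≫
        D.map N₂ ◁ φ₁.hom ▷ N₂ ⊗≫ φ₂.hom) ⊗≫
        ((D.invComp N₁ N₂).hom ≫ (D.invComp N₁ N₂).inv) ▷ M'' := by
      -- Interchange carries `invComp` to the far end, where its inverse stands.
      rw [← whisker_exchange]
      bicategory
    _ = _ := by
      rw [Iso.hom_inv_id]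
      bicategory

end Duality

/-! ### Stellar 1-morphisms are equivalences -/

namespace Duality
section
variable {C : Type u} [Bicategory.{w, v} C] (D : Duality C)

/-- Naturality of the Hermitian structure in N, complementing `herm_naturality`, which is naturality
in M. The dual of `conjMap` contains D(ψ) and D(D(ψ)): the first slides past s, and the second
becomes ψ by naturality of `D.nat`. -/
theorem herm_conjMap {a b : C} {N N' : a ⟶ b} (ψ : N ⟶ N') {M : D.obj a ⟶ a}
    (s : M ≫ D.e a ⟶ D.map M) :
    D.herm N s ≫ D.map₂ (D.conjMap ψ M) = D.conjMap ψ M ▷ D.e b ≫ D.herm N' s := by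
  have hn := D.nat_naturality ψ
  simp only [herm, conjMap, map₂_comp, map₂_whisker_left, map₂_whisker_right, Category.assoc,
    Iso.inv_hom_id_assoc, comp_whiskerRight]
  calc
    _ = 𝟙 _ ⊗≫ D.map N ◁ (M ◁ (D.nat N).hom ⊗≫ s ▷ D.map (D.map N)) ⊗≫
        ((D.map N ◁ 𝟙 (D.map M) ⊗≫ (D.mapComp M N).inv) ▷ D.map (D.map N) ≫
          D.map (M ≫ N) ◁ D.map₂ (D.map₂ ψ)) ⊗≫ (D.mapComp M N).hom ▷ D.map (D.map N') ⊗≫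
        D.map₂ ψ ▷ D.map M ▷ D.map (D.map N') ⊗≫ (D.mapComp M N').inv ▷ D.map (D.map N') ≫
        (D.mapComp (D.map N') (M ≫ N')).inv := by
      bicategory
    _ = 𝟙 _ ⊗≫ D.map N ◁ (M ◁ (D.nat N).hom ⊗≫ (s ▷ D.map (D.map N) ≫
          D.map M ◁ D.map₂ (D.map₂ ψ))) ⊗≫
        ((D.mapComp M N).inv ≫ (D.mapComp M N).hom) ▷ D.map (D.map N') ⊗≫
        D.map₂ ψ ▷ D.map M ▷ D.map (D.map N') ⊗≫ (D.mapComp M N').inv ▷ D.map (D.map N') ≫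
        (D.mapComp (D.map N') (M ≫ N')).inv := by
      rw [← whisker_exchange]
      bicategory
    _ = 𝟙 _ ⊗≫ D.map N ◁ M ◁ ((D.nat N).hom ≫ D.e a ◁ D.map₂ (D.map₂ ψ)) ⊗≫
        (D.map N ◁ s ≫ D.map₂ ψ ▷ D.map M) ▷ D.map (D.map N') ⊗≫
        (D.mapComp M N').inv ▷ D.map (D.map N') ≫
        (D.mapComp (D.map N') (M ≫ N')).inv := by
      rw [← whisker_exchange, Iso.inv_hom_id]
      bicategory
    _ = 𝟙 _ ⊗≫ D.map N ◁ M ◁ ψ ▷ D.e b ⊗≫ (D.map N ◁ M ◁ (D.nat N').hom ⊗≫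
        D.map₂ ψ ▷ (M ≫ D.e a ≫ D.map (D.map N'))) ⊗≫ D.map N' ◁ s ▷ D.map (D.map N') ⊗≫
        (D.mapComp M N').inv ▷ D.map (D.map N') ≫
        (D.mapComp (D.map N') (M ≫ N')).inv := by
      -- The double dual of ψ has reached `D.nat`, whose naturality replaces it by ψ itself.
      rw [← hn, whisker_exchange]
      bicategory
    _ = 𝟙 _ ⊗≫ (D.map N ◁ M ◁ ψ ≫ D.map₂ ψ ▷ (M ≫ N')) ▷ D.e b ⊗≫
        D.map N' ◁ M ◁ (D.nat N').hom ⊗≫ D.map N' ◁ s ▷ D.map (D.map N') ⊗≫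
        (D.mapComp M N').inv ▷ D.map (D.map N') ≫
        (D.mapComp (D.map N') (M ≫ N')).inv := by
      -- The two factors must form a plain composite, with the coherence cell moved outside, before
      -- interchange can be applied to them.
      have h : D.map N ◁ M ◁ (D.nat N').hom ⊗≫ D.map₂ ψ ▷ (M ≫ D.e a ≫ D.map (D.map N')) =
          𝟙 _ ⊗≫ (D.map N ◁ M ◁ (D.nat N').hom ≫ D.map₂ ψ ▷ (M ≫ D.e a ≫ D.map (D.map N'))) := by
        bicategory
      rw [h, whisker_exchange]
      bicategory
    _ = _ := by
      rw [whisker_exchange]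
      bicategory

end

section
variable {C : Type u} [Bicategory.{w, v} C] [IsBigroupoid C] {D : Duality C}

/-- Let N' invert N through ψ : N ≫ N' ≅ 𝟙. The unitarity datum on N' is forced by the wish that ψ
be unitary, and it is a composite of three isomorphisms, each compatible with the Hermitian
structures by `herm_naturality` and `herm_conjComp`, `herm_conjMap`, or `herm_conjId`. -/
theorem _root_.Stellar.exists_rightInverse {X Y : Stellar D} (F : X ⟶ Y) :
    ∃ G : Y ⟶ X, Nonempty (F ≫ G ≅ 𝟙 X) := by
  obtain ⟨N', ⟨ψ⟩, ⟨_⟩⟩ := F.invertible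
  let χ : D.conj F.N X.M ≅ Y.M := F.φ
  -- Transport along ψ; this is not the identification `D.κ`.
  let κ : D.conj (F.N ≫ N') X.M ≅ D.conj (𝟙 X.obj) X.M :=
    { hom := D.conjMap ψ.hom X.M
      inv := D.conjMap ψ.inv X.M
      hom_inv_id := by rw [← D.conjMap_comp, ψ.hom_inv_id, D.conjMap_id]
      inv_hom_id := by rw [← D.conjMap_comp, ψ.inv_hom_id, D.conjMap_id] }
  -- The part of the unitarity datum of a composite that precedes the datum on N'. Its inverse is
  -- the first factor of the datum sought.
  let t : D.conj (F.N ≫ N') X.M ≅ D.conj N' Y.M :=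
    D.conjComp F.N N' X.M ≪≫ whiskerLeftIso (D.map N') (whiskerRightIso χ N')
  have ht : D.herm (F.N ≫ N') X.σ.hom ≫ D.map₂ t.hom = t.hom ▷ D.e X.obj ≫ D.herm N' Y.σ.hom := by
    simp only [t, Iso.trans_hom, whiskerLeftIso_hom, whiskerRightIso_hom, comp_whiskerRight,
      Category.assoc, D.map₂_comp]
    rw [← D.herm_naturality N' F.hermitian.symm, reassoc_of% D.herm_conjComp]
  refine ⟨⟨N', IsBigroupoid.isEquiv1 N', t.symm ≪≫ κ ≪≫ D.conjId X.M, ?_⟩,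
    ⟨Stellar.isoMk ψ ?_⟩⟩
  -- Hermiticity may be tested after `t`, which then cancels and leaves the Hermiticity of `κ` and
  -- of `conjId`.
  · rw [← cancel_epi (t.hom ▷ D.e X.obj)]
    simp only [Iso.trans_hom, Iso.symm_hom, comp_whiskerRight, Category.assoc,
      hom_inv_whiskerRight_assoc, D.map₂_comp]
    rw [← reassoc_of% ht, reassoc_of% D.map₂_hom_inv t, ← D.herm_conjId,
      ← reassoc_of% D.herm_conjMap]
  · change D.conjMap ψ.hom X.M ≫ (D.conjId X.M).hom = (D.conjComp F.N N' X.M ≪≫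
      whiskerLeftIso (D.map N') (whiskerRightIso χ N') ≪≫ t.symm ≪≫ κ ≪≫ D.conjId X.M).hom
    simp [t, κ]

/-- As in a monoid in which every element has a right inverse: if F ≫ G ≅ 𝟙 and G ≫ H ≅ 𝟙, then F ≅
H, so G is a two-sided inverse of F. Hence the core contains all stellar 1-morphisms. -/
theorem _root_.Stellar.isEquiv1 {X Y : Stellar D} (F : X ⟶ Y) : IsEquiv1 F := by
  obtain ⟨G, ⟨i⟩⟩ := Stellar.exists_rightInverse F
  obtain ⟨H, ⟨j⟩⟩ := Stellar.exists_rightInverse G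
  refine ⟨G, ⟨i⟩, ⟨whiskerLeftIso G ?_ ≪≫ j⟩⟩
  exact (ρ_ F).symm ≪≫ whiskerLeftIso F j.symm ≪≫ (α_ F G H).symm ≪≫ whiskerRightIso i H ≪≫ λ_ H

end
end Duality

/-! ### Transposing involutions into fixed point data -/

namespace Duality
variable {C : Type u} [Bicategory.{w, v} C] [IsBigroupoid C] (D : Duality C)

/-- The transposition between involution data `M ≫ e ⟶ D(M)` and fixed point data
`e ≫ D(M)⁻¹ ≫ M ⟶ 𝟙`. -/
def Transposed {a : C} {M : D.obj a ⟶ a} (σ : M ≫ D.e a ⟶ D.map M)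
    (φ : D.e a ≫ D.inv M ≫ M ⟶ 𝟙 a) : Prop :=
  φ ▷ D.e a ≫ (λ_ _).hom = (α_ _ _ _).hom ≫
    D.e a ◁ ((α_ _ _ _).hom ≫ D.inv M ◁ σ ≫ (D.counit M).hom) ≫ (ρ_ _).hom

/-- The transposition condition prescribes φ after whiskering with the equivalence e, so φ is a
preimage. -/
theorem exists_transposed {a : C} {M : D.obj a ⟶ a} (σ : M ≫ D.e a ≅ D.map M) :
    ∃ φ : D.e a ≫ D.inv M ≫ M ≅ 𝟙 a, D.Transposed σ.hom φ.hom := by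
  obtain ⟨φ, h⟩ := (isEquiv1 (D.e a)).exists_whiskerRight
    (α_ _ _ _ ≪≫ whiskerLeftIso (D.e a) (α_ _ _ _ ≪≫ whiskerLeftIso (D.inv M) σ ≪≫ D.counit M) ≪≫
      ρ_ _ ≪≫ (λ_ (D.e a)).symm)
  exact ⟨φ, by simp [Transposed, h]⟩

theorem exists_transposed' {a : C} {M : D.obj a ⟶ a} (φ : D.e a ≫ D.inv M ≫ M ≅ 𝟙 a) :
    ∃ σ : M ≫ D.e a ≅ D.map M, D.Transposed σ.hom φ.hom := by
  -- In this direction two equivalences are stripped: first e, which gives ζ : D(M)⁻¹ ≫ M ≫ e ≅ 𝟙,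
  -- and then D(M)⁻¹, once the counit of M has been moved to the other side.
  obtain ⟨ζ, hζ⟩ := (isEquiv1 (D.e a)).exists_whiskerLeft
    ((α_ _ _ _).symm ≪≫ whiskerRightIso φ (D.e a) ≪≫ λ_ _ ≪≫ (ρ_ (D.e a)).symm)
  obtain ⟨σ, hσ⟩ := (isEquiv1 (D.inv M)).exists_whiskerLeft
    ((α_ _ _ _).symm ≪≫ ζ ≪≫ (D.counit M).symm)
  refine ⟨σ, ?_⟩
  rw [Transposed, hσ]
  simp [hζ]

/-- Whiskering with e is faithful. Since the fixed point datum of a stellar object is obtained by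
choice, uniqueness is what identifies it with a given one. -/
theorem Transposed.unique {a : C} {M : D.obj a ⟶ a} {σ : M ≫ D.e a ⟶ D.map M}
    {φ φ' : D.e a ≫ D.inv M ≫ M ⟶ 𝟙 a} (h : D.Transposed σ φ) (h' : D.Transposed σ φ') :
    φ = φ' := by
  rw [← (isEquiv1 (D.e a)).whiskerRight_inj, ← cancel_mono (λ_ (D.e a)).hom]
  exact h.trans h'.symm

/-- The counit `D(D(f)) ≫ D(D(f)⁻¹) ≅ 𝟙`. -/
noncomputable def counit₂ {a b : C} (f : a ⟶ b) :
    D.map (D.map f) ≫ D.map (D.inv f) ≅ 𝟙 (D.obj (D.obj a)) :=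
  (D.mapComp (D.inv f) (D.map f)).symm ≪≫ D.mapIso (D.counit f) ≪≫ D.mapId (D.obj a)

theorem counit₂_hom {a b : C} (f : a ⟶ b) : (D.counit₂ f).hom =
    (D.mapComp (D.inv f) (D.map f)).inv ≫ D.map₂ (D.counit f).hom ≫ (D.mapId (D.obj a)).hom := rfl

/-- Both D(D(f)) and the chosen D(D(f)⁻¹)⁻¹ are inverse to D(D(f)⁻¹), and `κ` is the mate of the
identity; hence it matches the two counits. -/
theorem κ_inv_counit₂ {a b : C} (f : a ⟶ b) :
    (D.κ f).inv ▷ D.map (D.inv f) ≫ (D.counit₂ f).hom = (D.counit (D.inv f)).hom := by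
  have h := (conj_eq_iff (D.invAdj (D.inv f)) (D.adj (D.invAdj f)) _ _).1 (D.κ_inv f).symm
  rwa [whiskerLeft_id, Category.id_comp] at h

section
variable {a b : C} {N : a ⟶ b} {M : D.obj a ⟶ a} {M' : D.obj b ⟶ b}

/-- The image of the inverse of a square under the duality. -/
noncomputable def mapInv (s : M ≫ N ≅ D.inv N ≫ M') :
    D.map M' ≫ D.map (D.inv N) ⟶ D.map N ≫ D.map M :=
  (D.mapComp (D.inv N) M').inv ≫ D.map₂ s.inv ≫ (D.mapComp M N).hom

/-- The image of a square under the pseudofunctor `D(-)⁻¹`. -/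
noncomputable def invSquare (s : M ≫ N ≅ D.inv N ≫ M') :
    D.inv M ≫ D.inv N ⟶ D.inv (D.inv N) ≫ D.inv M' :=
  (D.invComp M N).inv ≫ D.inv₂ s.hom ≫ (D.invComp (D.inv N) M').hom

/-- `inv₂` and `invComp` are mates, so `invSquare` is the mate of `mapInv` for the composite
adjunctions, whose counits are the nested counits displayed. This is how the image of a square under
the action is traded for its image under D. -/
theorem invSquare_counit (s : M ≫ N ≅ D.inv N ≫ M') :
    D.invSquare s ▷ (D.map M' ≫ D.map (D.inv N)) ⊗≫
      D.inv (D.inv N) ◁ (D.counit M').hom ▷ D.map (D.inv N) ⊗≫ (D.counit (D.inv N)).hom =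
    (D.inv M ≫ D.inv N) ◁ D.mapInv s ⊗≫ D.inv M ◁ (D.counit N).hom ▷ D.map M ⊗≫
      (D.counit M).hom := by
  have h : conjugateEquiv ((D.invAdj N).comp (D.invAdj M))
      ((D.invAdj M').comp (D.invAdj (D.inv N))) (D.mapInv s) = D.invSquare s := by
    rw [invSquare, inv₂_iso, invComp_hom, invComp_inv, Bicategory.conjugateEquiv_comp,
      Bicategory.conjugateEquiv_comp, mapInv, Category.assoc]
  have h' := (conj_eq_iff _ _ _ _).1 h
  simp only [Bicategory.Adjunction.comp, Bicategory.Adjunction.compCounit, ← counit_hom] at h'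
  calc
    _ = D.invSquare s ▷ (D.map M' ≫ D.map (D.inv N)) ≫ (𝟙 _ ⊗≫
        D.inv (D.inv N) ◁ (D.counit M').hom ▷ D.map (D.inv N) ⊗≫ (D.counit (D.inv N)).hom) := by
      bicategory
    _ = _ := by
      -- The counit identity of the mates differs from the goal by coherence cells only.
      refine Eq.trans ?_ (h'.trans ?_) <;> bicategory

/-- The square of φ consists of φ and the inverse counit of N; its inverse therefore undoes φ and
leaves the counit. Applying D turns that counit into `counit₂`. -/
theorem map₂_mapInv (φ : D.conj N M ≅ M') :
    D.map₂ φ.hom ▷ D.map (D.inv N) ≫ D.mapInv (D.square φ) =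
      (D.mapComp (D.map N) (M ≫ N)).hom ▷ D.map (D.inv N) ⊗≫ D.map (M ≫ N) ◁ (D.counit₂ N).hom ⊗≫
        (D.mapComp M N).hom := by
  have h : D.inv N ◁ φ.hom ≫ (D.square φ).inv =
      (α_ _ _ _).inv ≫ (D.counit N).hom ▷ (M ≫ N) ≫ (λ_ _).hom := by
    rw [← cancel_mono (D.square φ).hom]
    simp only [Category.assoc, Iso.inv_hom_id, Category.comp_id, counit_square,
      Iso.inv_hom_id_assoc]
  have h' := congrArg D.map₂ h
  simp only [map₂_comp, map₂_whisker_left, map₂_whisker_right, map₂_associator_inv,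
    map₂_left_unitor, Category.assoc, Iso.inv_hom_id_assoc, Iso.cancel_iso_hom_left] at h'
  rw [mapInv, reassoc_of% h', counit₂_hom]
  bicategory

end

end Duality

/-! ### Hermiticity and compatibility with fixed point data -/

namespace Duality
variable {C : Type u} [Bicategory.{w, v} C] [IsBigroupoid C] (D : Duality C)

section
variable {a b : C} {N : a ⟶ b} {M : D.obj a ⟶ a} {M' : D.obj b ⟶ b}

/-- The transport of `σ` along `N`, in terms of the inverse of `D(M)`. -/
noncomputable def transL (N : a ⟶ b) (σ : M ≫ D.e a ⟶ D.map M) :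
    D.inv M ≫ M ≫ N ≫ D.e b ⟶ D.map (D.map N) :=
  D.inv M ◁ (M ◁ (D.nat N).hom ⊗≫ σ ▷ D.map (D.map N)) ⊗≫ (D.counit M).hom ▷ D.map (D.map N) ≫
    (λ_ _).hom

/-- The transport of `σ'` along a square. -/
noncomputable def transR (s : M ≫ N ≅ D.inv N ≫ M') (σ' : M' ≫ D.e b ⟶ D.map M') :
    D.inv M ≫ M ≫ N ≫ D.e b ⟶ D.map (D.map N) :=
  𝟙 _ ⊗≫ D.inv M ◁ s.hom ▷ D.e b ⊗≫ D.invSquare s ▷ (M' ≫ D.e b) ⊗≫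
    D.inv (D.inv N) ◁ (D.inv M' ◁ σ' ≫ (D.counit M').hom) ≫ (ρ_ _).hom ≫ (D.κ N).inv

/-- Sliding φ past `D.nat N` places it next to e, where the transposition rule replaces it by σ. The
result has the form e ◁ _, ready for e to be stripped. -/
theorem Transposed.whisker_nat {σ : M ≫ D.e a ⟶ D.map M} {φ : D.e a ≫ D.inv M ≫ M ⟶ 𝟙 a}
    (h : D.Transposed σ φ) (N : a ⟶ b) :
    (φ ▷ N ≫ (λ_ N).hom) ▷ D.e b ≫ (D.nat N).hom = 𝟙 _ ⊗≫ D.e a ◁ D.transL N σ := by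
  simp only [transL]
  calc
    _ = 𝟙 _ ⊗≫ (φ ▷ (N ≫ D.e b) ≫ 𝟙 a ◁ (D.nat N).hom) ⊗≫ 𝟙 _ := by bicategory
    _ = 𝟙 _ ⊗≫ (D.e a ≫ D.inv M ≫ M) ◁ (D.nat N).hom ⊗≫ (φ ▷ D.e a ≫ (λ_ _).hom) ▷
        D.map (D.map N) ⊗≫ 𝟙 _ := by
      rw [← whisker_exchange]
      bicategory
    _ = _ := by
      rw [h]
      bicategory

/-- The counterpart of `whisker_nat` for the other side of the compatibility condition: φ' already
stands next to e and becomes σ', and `D.nat N` then meets the inverse naturality cell of the action.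
-/
theorem Transposed.whisker_sqMap {σ' : M' ≫ D.e b ⟶ D.map M'} {φ' : D.e b ≫ D.inv M' ≫ M' ⟶ 𝟙 b}
    (h : D.Transposed σ' φ') (s : M ≫ N ≅ D.inv N ≫ M') :
    ((𝟙 ((D.e a ≫ D.inv M ≫ M) ≫ N) ⊗≫ D.e a ◁ D.inv M ◁ s.hom ⊗≫ D.e a ◁ D.invSquare s ▷ M' ⊗≫
      (D.invNat N).inv ▷ (D.inv M' ≫ M') ⊗≫ N ◁ φ') ≫ (ρ_ N).hom) ▷ D.e b ≫ (D.nat N).hom =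
      𝟙 _ ⊗≫ D.e a ◁ D.transR s σ' := by
  -- The two naturality cells differ by `κ`, so only its inverse survives, in the form e ◁ _ that is
  -- wanted.
  have hk : (D.invNat N).inv ≫ (D.nat N).hom = D.e a ◁ (D.κ N).inv := by simp [invNat]
  simp only [transR]
  calc
    _ = 𝟙 _ ⊗≫ D.e a ◁ D.inv M ◁ s.hom ▷ D.e b ⊗≫ D.e a ◁ D.invSquare s ▷ M' ▷ D.e b ⊗≫
      (D.invNat N).inv ▷ (D.inv M' ≫ M' ≫ D.e b) ⊗≫ N ◁ (φ' ▷ D.e b ≫ (λ_ _).hom) ⊗≫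
        (D.nat N).hom := by bicategory
    _ = 𝟙 _ ⊗≫ D.e a ◁ D.inv M ◁ s.hom ▷ D.e b ⊗≫ D.e a ◁ D.invSquare s ▷ M' ▷ D.e b ⊗≫
      ((D.invNat N).inv ▷ (D.inv M' ≫ M' ≫ D.e b) ≫
        (N ≫ D.e b) ◁ (D.inv M' ◁ σ' ≫ (D.counit M').hom)) ⊗≫ (D.nat N).hom := by
      rw [h]
      bicategory
    _ = 𝟙 _ ⊗≫ D.e a ◁ D.inv M ◁ s.hom ▷ D.e b ⊗≫ D.e a ◁ D.invSquare s ▷ M' ▷ D.e b ⊗≫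
      (D.e a ≫ D.inv (D.inv N)) ◁ (D.inv M' ◁ σ' ≫ (D.counit M').hom) ⊗≫
      ((D.invNat N).inv ≫ (D.nat N).hom) ⊗≫ 𝟙 _ := by
      rw [← whisker_exchange]
      bicategory
    _ = _ := by
      rw [hk]
      bicategory

/-- The part of `transL` before the counit of `M`. -/
noncomputable def coreL (N : a ⟶ b) (σ : M ≫ D.e a ⟶ D.map M) :
    (M ≫ N ≫ D.e b) ≫ D.map (D.inv N) ⟶ D.map M :=
  (M ◁ (D.nat N).hom ⊗≫ σ ▷ D.map (D.map N)) ▷ D.map (D.inv N) ⊗≫ D.map M ◁ (D.counit₂ N).hom ≫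
    (ρ_ _).hom

/-- The part of `transR` before the counit of `M`. -/
noncomputable def coreR (s : M ≫ N ≅ D.inv N ≫ M') (σ' : M' ≫ D.e b ⟶ D.map M') :
    (M ≫ N ≫ D.e b) ≫ D.map (D.inv N) ⟶ D.map M :=
  𝟙 _ ⊗≫ s.hom ▷ (D.e b ≫ D.map (D.inv N)) ⊗≫ D.inv N ◁ σ' ▷ D.map (D.inv N) ⊗≫
    D.inv N ◁ D.mapInv s ⊗≫ (D.counit N).hom ▷ D.map M ≫ (λ_ _).hom

/-- The counit of M and `counit₂` of N act on different factors, so the counit of M can be postponed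
to the end. There it is common to both sides of the comparison and cancels, together with the
whiskering by D(M)⁻¹. -/
theorem transL_counit₂ (N : a ⟶ b) (σ : M ≫ D.e a ⟶ D.map M) :
    D.transL N σ ▷ D.map (D.inv N) ≫ (D.counit₂ N).hom =
      𝟙 _ ⊗≫ D.inv M ◁ D.coreL N σ ≫ (D.counit M).hom := by
  simp only [transL, coreL]
  symm
  calc
    _ = 𝟙 _ ⊗≫ D.inv M ◁ (M ◁ (D.nat N).hom ⊗≫ σ ▷ D.map (D.map N)) ▷ D.map (D.inv N) ⊗≫
        ((D.inv M ≫ D.map M) ◁ (D.counit₂ N).hom ≫ (D.counit M).hom ▷ 𝟙 _) ⊗≫ 𝟙 _ := by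
      bicategory
    _ = _ := by
      rw [whisker_exchange]
      bicategory

/-- The added `counit₂` absorbs the inverse of `κ` and becomes the counit of D(N)⁻¹. With the counit
of M' it forms the nest to which `invSquare_counit` applies, so that the action no longer appears in
the remaining core. -/
theorem transR_counit₂ (s : M ≫ N ≅ D.inv N ≫ M') (σ' : M' ≫ D.e b ⟶ D.map M') :
    D.transR s σ' ▷ D.map (D.inv N) ≫ (D.counit₂ N).hom =
      𝟙 _ ⊗≫ D.inv M ◁ D.coreR s σ' ≫ (D.counit M).hom := by
  simp only [transR, coreR]
  have hk := D.κ_inv_counit₂ N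
  have hs := D.invSquare_counit s
  calc
    _ = 𝟙 _ ⊗≫ D.inv M ◁ s.hom ▷ D.e b ▷ D.map (D.inv N) ⊗≫
        (D.invSquare s ▷ (M' ≫ D.e b) ≫ (D.inv (D.inv N) ≫ D.inv M') ◁ σ') ▷ D.map (D.inv N) ⊗≫
        D.inv (D.inv N) ◁ (D.counit M').hom ▷ D.map (D.inv N) ⊗≫
        ((D.κ N).inv ▷ D.map (D.inv N) ≫ (D.counit₂ N).hom) := by bicategory
    _ = 𝟙 _ ⊗≫ D.inv M ◁ s.hom ▷ D.e b ▷ D.map (D.inv N) ⊗≫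
        D.inv M ◁ D.inv N ◁ σ' ▷ D.map (D.inv N) ⊗≫
        (D.invSquare s ▷ (D.map M' ≫ D.map (D.inv N)) ⊗≫
      D.inv (D.inv N) ◁ (D.counit M').hom ▷ D.map (D.inv N) ⊗≫ (D.counit (D.inv N)).hom) := by
      rw [hk, ← whisker_exchange]
      bicategory
    _ = _ := by
      rw [hs]
      bicategory

/-- Precomposition with the counit of N supplies the factor D(N) missing from `coreL`, and thereby
exhibits `herm N σ`. The datum φ is arbitrary here: it enters through `map₂` and is removed again by
`mapInv`. -/
theorem counit_coreL (φ : D.conj N M ≅ M') (σ : M ≫ D.e a ⟶ D.map M) :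
    (D.counit N).hom ▷ ((M ≫ N ≫ D.e b) ≫ D.map (D.inv N)) ≫ (λ_ _).hom ≫ D.coreL N σ =
      𝟙 _ ⊗≫ D.inv N ◁ ((D.herm N σ ≫ D.map₂ φ.hom) ▷ D.map (D.inv N) ≫ D.mapInv (D.square φ)) ⊗≫
        (D.counit N).hom ▷ D.map M ≫ (λ_ _).hom := by
  have h := D.map₂_mapInv φ
  -- The calculation runs from the right, because `map₂_mapInv` eliminates φ whereas nothing on the
  -- left would introduce it.
  symm
  calc
    _ = 𝟙 _ ⊗≫ D.inv N ◁ (D.herm N σ ▷ D.map (D.inv N) ≫ (D.map₂ φ.hom ▷ D.map (D.inv N) ≫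
        D.mapInv (D.square φ))) ⊗≫ (D.counit N).hom ▷ D.map M ≫ (λ_ _).hom := by
      bicategory
    _ = 𝟙 _ ⊗≫ D.inv N ◁ (D.map N ◁ (M ◁ (D.nat N).hom ⊗≫ σ ▷ D.map (D.map N)) ▷ D.map (D.inv N) ⊗≫
        ((D.mapComp M N).inv ▷ D.map (D.map N) ≫ ((D.mapComp (D.map N) (M ≫ N)).inv ≫
          (D.mapComp (D.map N) (M ≫ N)).hom)) ▷ D.map (D.inv N) ⊗≫
          D.map (M ≫ N) ◁ (D.counit₂ N).hom ⊗≫ (D.mapComp M N).hom) ⊗≫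
          (D.counit N).hom ▷ D.map M ≫ (λ_ _).hom := by
      rw [h, herm]
      bicategory
    _ = 𝟙 _ ⊗≫ D.inv N ◁ (D.map N ◁ (M ◁ (D.nat N).hom ⊗≫ σ ▷ D.map (D.map N)) ▷ D.map (D.inv N) ⊗≫
        ((D.mapComp M N).inv ▷ (D.map (D.map N) ≫ D.map (D.inv N)) ≫
          D.map (M ≫ N) ◁ (D.counit₂ N).hom) ⊗≫ (D.mapComp M N).hom) ⊗≫
          (D.counit N).hom ▷ D.map M ≫ (λ_ _).hom := by
      rw [Iso.inv_hom_id]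
      bicategory
    _ = 𝟙 _ ⊗≫ D.inv N ◁ (D.map N ◁ (M ◁ (D.nat N).hom ⊗≫ σ ▷ D.map (D.map N)) ▷ D.map (D.inv N) ⊗≫
        (D.map N ≫ D.map M) ◁ (D.counit₂ N).hom ⊗≫ ((D.mapComp M N).inv ≫ (D.mapComp M N).hom)) ⊗≫
          (D.counit N).hom ▷ D.map M ≫ (λ_ _).hom := by
      rw [← whisker_exchange]
      bicategory
    _ = 𝟙 _ ⊗≫ ((D.inv N ≫ D.map N) ◁ D.coreL N σ ≫
          (D.counit N).hom ▷ D.map M) ⊗≫ 𝟙 _ := by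
      rw [Iso.inv_hom_id, coreL]
      bicategory
    _ = _ := by
      rw [whisker_exchange]
      bicategory

/-- The counit of N evaluates the square to φ, which exhibits the other side of the Hermiticity
condition inside the same operation as in `counit_coreL`. -/
theorem counit_coreR (φ : D.conj N M ≅ M') (σ' : M' ≫ D.e b ⟶ D.map M') :
    (D.counit N).hom ▷ ((M ≫ N ≫ D.e b) ≫ D.map (D.inv N)) ≫ (λ_ _).hom ≫
        D.coreR (D.square φ) σ' =
      𝟙 _ ⊗≫ D.inv N ◁ ((φ.hom ▷ D.e b ≫ σ') ▷ D.map (D.inv N) ≫ D.mapInv (D.square φ)) ⊗≫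
        (D.counit N).hom ▷ D.map M ≫ (λ_ _).hom := by
  have h := D.counit_square φ
  calc
    _ = 𝟙 _ ⊗≫ ((D.counit N).hom ▷ (M ≫ N) ≫ (λ_ _).hom ≫ (D.square φ).hom) ▷
        (D.e b ≫ D.map (D.inv N)) ⊗≫ D.inv N ◁ σ' ▷ D.map (D.inv N) ⊗≫
        D.inv N ◁ D.mapInv (D.square φ) ⊗≫ (D.counit N).hom ▷ D.map M ≫ (λ_ _).hom := by
      rw [coreR]
      bicategory
    _ = _ := by
      rw [h]
      bicategory

/-- The Hermiticity condition is the compatibility condition for the corresponding square. -/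
theorem compatible_iff {σ : M ≫ D.e a ⟶ D.map M} {φ : D.e a ≫ D.inv M ≫ M ⟶ 𝟙 a}
    {σ' : M' ≫ D.e b ⟶ D.map M'} {φ' : D.e b ≫ D.inv M' ≫ M' ⟶ 𝟙 b}
    (h : D.Transposed σ φ) (h' : D.Transposed σ' φ') (χ : D.conj N M ≅ M') :
    φ ▷ N ≫ (λ_ N).hom = D.action.sqMap (D.square χ).hom ≫ N ◁ φ' ≫ (ρ_ N).hom ↔
      χ.hom ▷ D.e b ≫ σ' = D.herm N σ ≫ D.map₂ χ.hom := by
  -- Rewrites the pasting of the action in terms of the cells of D, up to coherence.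
  have hs : D.action.sqMap (D.square χ).hom ≫ N ◁ φ' ≫ (ρ_ N).hom =
    (𝟙 ((D.e a ≫ D.inv M ≫ M) ≫ N) ⊗≫ D.e a ◁ D.inv M ◁ (D.square χ).hom ⊗≫
      D.e a ◁ D.invSquare (D.square χ) ▷ M' ⊗≫
      (D.invNat N).inv ▷ (D.inv M' ≫ M') ⊗≫ N ◁ φ') ≫ (ρ_ N).hom := by
    change ((α_ (D.e a) (D.inv M ≫ M) N).hom ≫ D.e a ◁ ((α_ _ _ _).hom ≫
      D.inv M ◁ (D.square χ).hom ≫ (α_ _ _ _).inv ≫ D.invSquare (D.square χ) ▷ M' ≫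
        (α_ _ _ _).hom) ≫ (α_ _ _ _).inv ≫ (D.invNat N).inv ▷ _ ≫ (α_ _ _ _).hom) ≫
        N ◁ φ' ≫ (ρ_ N).hom = _
    bicategory
  -- The last operation to be undone: whiskering with an equivalence followed by an invertible
  -- 2-morphism.
  have hX : Function.Injective fun x : D.conj N M ≫ D.e b ⟶ D.map M' =>
      x ▷ D.map (D.inv N) ≫ D.mapInv (D.square χ) := by
    intro x y hxy
    have := IsBigroupoid.isIso (D.mapInv (D.square χ))
    exact (isEquiv1 _).whiskerRight_inj.1 ((cancel_mono _).1 hxy)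
  rw [hs, ← (isEquiv1 (D.e b)).whiskerRight_inj, ← cancel_mono (D.nat N).hom,
    h.whisker_nat D, h'.whisker_sqMap D (D.square χ)]
  -- Strips e on the left and adds D(D(N)⁻¹) with its counit on the right; neither loses
  -- information.
  have h1 (x y : D.inv M ≫ M ≫ N ≫ D.e b ⟶ D.map (D.map N)) :
      (𝟙 _ ⊗≫ D.e a ◁ x : ((D.e a ≫ D.inv M ≫ M) ≫ N) ≫ D.e b ⟶ _) = 𝟙 _ ⊗≫ D.e a ◁ y ↔
        x ▷ D.map (D.inv N) ≫ (D.counit₂ N).hom = y ▷ D.map (D.inv N) ≫ (D.counit₂ N).hom := by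
    rw [cancel_mono, (isEquiv1 _).whiskerRight_inj]
    simp only [bicategoricalComp, cancel_epi]
    exact (isEquiv1 _).whiskerLeft_inj
  rw [h1, transL_counit₂, transR_counit₂]
  simp only [bicategoricalComp, cancel_epi, cancel_mono]
  rw [(isEquiv1 _).whiskerLeft_inj, ← cancel_epi (λ_ ((M ≫ N ≫ D.e b) ≫ D.map (D.inv N))).hom,
    ← cancel_epi ((D.counit N).hom ▷ ((M ≫ N ≫ D.e b) ≫ D.map (D.inv N))), counit_coreL _ χ,
    counit_coreR]
  simp only [bicategoricalComp, cancel_epi, cancel_mono]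
  -- The fixed point condition has σ on its left and the Hermiticity condition has σ on its right,
  -- hence the final symmetry.
  rw [(isEquiv1 _).whiskerLeft_inj, hX.eq_iff, eq_comm]

end

end Duality

/-! ### Coherence of a fixed point and the involution condition -/

namespace Duality
variable {C : Type u} [Bicategory.{w, v} C] [IsBigroupoid C] (D : Duality C)

/-- The unit `𝟙 ≅ D(f) ≫ D(f)⁻¹`. -/
noncomputable def unit {a b : C} (f : a ⟶ b) : 𝟙 (D.obj b) ≅ D.map f ≫ D.inv f :=
  haveI := IsBigroupoid.isIso (D.invAdj f).unit
  asIso (D.invAdj f).unit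

/-- A triangle identity with the invertible unit moved across. It exchanges a counit to the right of
D(f) for an inverse unit to its left. -/
theorem map_whiskerLeft_counit {a b : C} (f : a ⟶ b) :
    D.map f ◁ (D.counit f).hom =
      (α_ _ _ _).inv ≫ (D.unit f).inv ▷ D.map f ≫ (λ_ _).hom ≫ (ρ_ _).inv := by
  have h : leftZigzag (D.unit f).hom (D.counit f).hom = (λ_ _).hom ≫ (ρ_ _).inv :=
    (D.invAdj f).left_triangle
  rw [← h]
  simp [leftZigzag, bicategoricalComp]

section
variable {a : C} {M : D.obj a ⟶ a}

/-- The image of a fixed point datum `e ≫ D(M)⁻¹ ≫ M ≅ 𝟙` under the duality. -/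
noncomputable def mapFix (φ : D.e a ≫ D.inv M ≫ M ≅ 𝟙 a) :
    (D.map M ≫ D.map (D.inv M)) ≫ D.map (D.e a) ≅ 𝟙 (D.obj a) :=
  whiskerRightIso (D.mapComp (D.inv M) M).symm _ ≪≫ (D.mapComp (D.e a) (D.inv M ≫ M)).symm ≪≫
    D.mapIso φ ≪≫ D.mapId a

/-- The image of a fixed point datum `e ≫ D(M)⁻¹ ≫ M ≅ 𝟙` under the pseudofunctor `D(-)⁻¹`. -/
noncomputable def invFix (φ : D.e a ≫ D.inv M ≫ M ≅ 𝟙 a) :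
    D.e (D.obj a) ≫ D.inv (D.inv M) ≫ D.inv M ⟶ 𝟙 (D.obj a) :=
  (D.invω a).hom ▷ (D.inv (D.inv M) ≫ D.inv M) ≫ D.inv (D.e a) ◁ (D.invComp (D.inv M) M).inv ≫
    (D.invComp (D.e a) (D.inv M ≫ M)).inv ≫ D.inv₂ φ.hom ≫ (D.invId a).hom

/-- The image of `σ : M ≫ e ≅ D(M)` under the duality. -/
def mapInvol (σ : M ≫ D.e a ≅ D.map M) : D.map (D.e a) ≫ D.map M ≅ D.map (D.map M) :=
  (D.mapComp M (D.e a)).symm ≪≫ D.mapIso σ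

/-- All cells in `invFix` are mates, and `invω` is the mate of an identity for the adjunction D(e) ⊣
e with counit θ. Hence `invFix` is the mate of the inverse of D(φ). A mate with values in the
identity adjunction needs no unit other than an identity, so only the three counits remain. -/
theorem invFix_eq (φ : D.e a ≫ D.inv M ≫ M ≅ 𝟙 a) :
    D.invFix φ = 𝟙 _ ⊗≫ (D.e (D.obj a) ≫ D.inv (D.inv M) ≫ D.inv M) ◁ (D.mapFix φ).inv ⊗≫
      D.e (D.obj a) ◁ D.inv (D.inv M) ◁ (D.counit M).hom ▷ (D.map (D.inv M) ≫ D.map (D.e a)) ⊗≫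
      D.e (D.obj a) ◁ (D.counit (D.inv M)).hom ▷ D.map (D.e a) ⊗≫ (D.θ a).hom := by
  have h : conjugateEquiv (((D.invAdj M).comp (D.invAdj (D.inv M))).comp (D.θAdj a))
      (Adjunction.id (D.obj a)) (D.mapFix φ).inv = D.invFix φ := by
    rw [invFix, inv₂_iso, invω_hom, invComp_inv, invComp_inv, invId_hom,
      ← Bicategory.conjugateEquiv_whiskerLeft ((D.invAdj M).comp (D.invAdj (D.inv M))),
      ← Bicategory.conjugateEquiv_whiskerRight _ _ (D.invAdj (D.e a))]
    simp only [Bicategory.conjugateEquiv_comp]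
    congr 1
    simp [mapFix, mapIso]
  rw [← h, Bicategory.conjugateEquiv_adjunction_id]
  simp only [Bicategory.Adjunction.comp, Bicategory.Adjunction.compCounit, θAdj_counit,
    ← counit_hom]
  bicategory

/-- D applied to the transposition rule: D reverses 1-morphisms, so the whiskering changes sides, σ
becomes `mapInvol` and the counit becomes `counit₂`. -/
theorem Transposed.mapFix {σ : M ≫ D.e a ≅ D.map M} {φ : D.e a ≫ D.inv M ≫ M ≅ 𝟙 a}
    (h : D.Transposed σ.hom φ.hom) :
    D.map (D.e a) ◁ (D.mapFix φ).hom =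
      𝟙 _ ⊗≫ ((D.mapInvol σ).hom ▷ D.map (D.inv M) ≫ (D.counit₂ M).hom) ▷ D.map (D.e a) ⊗≫ 𝟙 _ := by
  have h' := congrArg D.map₂ h
  simp only [map₂_comp, map₂_whisker_left, map₂_whisker_right, map₂_associator,
    map₂_left_unitor, map₂_right_unitor, Category.assoc, Iso.inv_hom_id_assoc,
    Iso.cancel_iso_hom_left] at h'
  rw [← cancel_mono (ρ_ _).hom]
  simp only [Duality.mapFix, mapInvol, counit₂_hom, mapIso, Iso.trans_hom, Iso.symm_hom,
    whiskerRightIso_hom, whiskerLeft_comp, Category.assoc]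
  rw [h']
  simp only [whiskerLeft_inv_hom_assoc, comp_whiskerRight, Category.assoc,
    inv_hom_whiskerRight_assoc]
  calc
    _ = 𝟙 _ ⊗≫ (D.map (D.e a) ◁ ((D.mapComp (D.inv M) M).inv ≫ (D.mapComp (D.inv M) M).hom)) ▷
        D.map (D.e a) ⊗≫ (((D.mapComp M (D.e a)).inv ≫ D.map₂ σ.hom) ▷ D.map (D.inv M) ≫
        (D.mapComp (D.inv M) (D.map M)).inv ≫ D.map₂ (D.counit M).hom ≫
        (D.mapId (D.obj (D.obj a))).hom) ▷ D.map (D.e a) ⊗≫ 𝟙 _ := by bicategory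
    _ = _ := by
      rw [Iso.inv_hom_id]
      bicategory

/-- The isomorphism `e ≫ D(D(M)) ≅ D(M)` which is obtained from the dual of `σ`. -/
noncomputable def cobar (σ : M ≫ D.e a ≅ D.map M) :
    D.e (D.obj a) ≫ D.map (D.map M) ≅ D.map M :=
  whiskerLeftIso _ (D.mapInvol σ).symm ≪≫ (α_ _ _ _).symm ≪≫ whiskerRightIso (D.θ a) _ ≪≫ λ_ _

omit [IsBigroupoid C] in
-- The bar of σ is the inverse of `D.nat M` followed by... `cobar`, taken as a whole, so the
-- involution condition can be solved for σ. In this form it has no inverse of σ outside `cobar` and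
-- can be read off from the coherence condition.
theorem involution_iff (σ : M ≫ D.e a ≅ D.map M) :
    σ.hom ≫ D.bar σ.hom = 𝟙 _ ↔ (D.nat M).inv ≫ σ.hom = (D.cobar σ).hom := by
  have h : D.bar σ.hom = (D.cobar σ).inv ≫ (D.nat M).inv := by
    simp [bar, cobar, mapInvol, mapIso]
  rw [h, ← Category.assoc, Iso.comp_inv_eq, Category.id_comp, Iso.comp_inv_eq, Iso.inv_comp_eq,
    eq_comm]

/-- The central computation for objects: it expresses the image of φ under the action through σ. By
`invFix_eq` that image contains the inverse of D(φ), and the dual transposition rule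
`Transposed.mapFix` creates D(φ) itself out of `mapInvol` and `counit₂`. The two cancel, leaving θ,
and θ with the inverse of `mapInvol` is `cobar`. -/
theorem Transposed.invFix {σ : M ≫ D.e a ≅ D.map M} {φ : D.e a ≫ D.inv M ≫ M ≅ 𝟙 a}
    (h : D.Transposed σ.hom φ.hom) :
    D.invFix φ ▷ D.map M = 𝟙 _ ⊗≫ (D.e (D.obj a) ≫ D.inv (D.inv M)) ◁ (D.counit M).hom ⊗≫
      D.e (D.obj a) ◁ (D.κ M).inv ≫ (D.cobar σ).hom ≫ (λ_ _).inv := by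
  set e := D.e (D.obj a)
  set X := D.mapFix φ
  set S := D.mapInvol σ
  have hX : D.map (D.e a) ◁ X.hom = 𝟙 _ ⊗≫ (S.hom ▷ D.map (D.inv M) ≫ (D.counit₂ M).hom) ▷
      D.map (D.e a) ⊗≫ 𝟙 _ := h.mapFix
  have hκ := D.κ_inv_counit₂ M
  -- The counit standing between `X.inv` and `X.hom` becomes an inverse unit acting on other
  -- factors, so that the two can meet and cancel.
  have hu : (D.map M ≫ D.inv M) ◁ X.inv ⊗≫
      D.map M ◁ (D.counit M).hom ▷ (D.map (D.inv M) ≫ D.map (D.e a)) ⊗≫ X.hom =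
        (ρ_ _).hom ≫ (D.unit M).inv := by
    calc
      _ = (D.map M ≫ D.inv M) ◁ X.inv ⊗≫
          (D.map M ◁ (D.counit M).hom) ▷ (D.map (D.inv M) ≫ D.map (D.e a)) ⊗≫ X.hom := by
        bicategory
      _ = 𝟙 _ ⊗≫ ((D.map M ≫ D.inv M) ◁ X.inv ≫
          (D.unit M).inv ▷ ((D.map M ≫ D.map (D.inv M)) ≫ D.map (D.e a))) ⊗≫ X.hom := by
        rw [D.map_whiskerLeft_counit]
        bicategory
      _ = 𝟙 _ ⊗≫ (D.unit M).inv ⊗≫ (X.inv ≫ X.hom) := by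
        rw [whisker_exchange]
        bicategory
      _ = _ := by
        rw [Iso.inv_hom_id]
        bicategory
  -- `S` and `κ` are placed in front because they are what `hκ` and `hX` need in order to rebuild
  -- `X.hom`. Being invertible, they are removed at the end.
  have hz : (e ◁ S.hom ▷ D.inv M) ≫ (e ◁ (D.κ M).hom ▷ D.inv M) ≫ D.invFix φ =
      𝟙 _ ⊗≫ (e ≫ D.map (D.e a)) ◁ (D.unit M).inv ≫ (ρ_ _).hom ≫ (D.θ a).hom := by
    rw [invFix_eq]
    calc
      _ = 𝟙 _ ⊗≫ ((e ◁ (S.hom ≫ (D.κ M).hom) ▷ D.inv M) ▷ 𝟙 _ ≫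
          (e ≫ D.inv (D.inv M) ≫ D.inv M) ◁ X.inv) ⊗≫
          e ◁ D.inv (D.inv M) ◁ (D.counit M).hom ▷ (D.map (D.inv M) ≫ D.map (D.e a)) ⊗≫
          e ◁ (D.counit (D.inv M)).hom ▷ D.map (D.e a) ⊗≫ (D.θ a).hom := by bicategory
      _ = 𝟙 _ ⊗≫ (e ≫ D.map (D.e a)) ◁ (D.map M ≫ D.inv M) ◁ X.inv ⊗≫
          e ◁ ((S.hom ≫ (D.κ M).hom) ▷ (D.inv M ≫ D.map M) ≫ D.inv (D.inv M) ◁ (D.counit M).hom) ▷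
            (D.map (D.inv M) ≫ D.map (D.e a)) ⊗≫
          e ◁ (D.counit (D.inv M)).hom ▷ D.map (D.e a) ⊗≫ (D.θ a).hom := by
        rw [← whisker_exchange]
        bicategory
      _ = 𝟙 _ ⊗≫ (e ≫ D.map (D.e a)) ◁ ((D.map M ≫ D.inv M) ◁ X.inv ⊗≫
          D.map M ◁ (D.counit M).hom ▷ (D.map (D.inv M) ≫ D.map (D.e a))) ⊗≫
          e ◁ (S.hom ▷ D.map (D.inv M) ≫ ((D.κ M).hom ≫ (D.κ M).inv) ▷ D.map (D.inv M) ≫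
            (D.counit₂ M).hom) ▷ D.map (D.e a) ⊗≫ (D.θ a).hom := by
        -- The counit of D(M)⁻¹ splits into the inverse of `κ`, which cancels the `κ` placed in
        -- front, and `counit₂`.
        rw [← whisker_exchange, ← hκ]
        bicategory
      _ = 𝟙 _ ⊗≫ (e ≫ D.map (D.e a)) ◁ ((D.map M ≫ D.inv M) ◁ X.inv ⊗≫
          D.map M ◁ (D.counit M).hom ▷ (D.map (D.inv M) ≫ D.map (D.e a))) ⊗≫
          e ◁ (𝟙 (D.map (D.e a) ≫ (D.map M ≫ D.map (D.inv M)) ≫ D.map (D.e a)) ⊗≫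
            (S.hom ▷ D.map (D.inv M) ≫ (D.counit₂ M).hom) ▷ D.map (D.e a) ⊗≫
              𝟙 (D.map (D.e a) ≫ 𝟙 (D.obj a))) ⊗≫
            (D.θ a).hom := by
        rw [Iso.hom_inv_id]
        bicategory
      _ = 𝟙 _ ⊗≫ (e ≫ D.map (D.e a)) ◁ ((D.map M ≫ D.inv M) ◁ X.inv ⊗≫
          D.map M ◁ (D.counit M).hom ▷ (D.map (D.inv M) ≫ D.map (D.e a)) ⊗≫ X.hom) ⊗≫
            (D.θ a).hom := by
        rw [← hX]
        bicategory
      _ = _ := by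
        rw [hu]
        bicategory
  rw [← cancel_epi ((e ◁ (D.κ M).hom ▷ D.inv M) ▷ D.map M),
    ← cancel_epi ((e ◁ S.hom ▷ D.inv M) ▷ D.map M)]
  calc
    _ = 𝟙 _ ⊗≫ ((e ◁ S.hom ▷ D.inv M) ≫ (e ◁ (D.κ M).hom ▷ D.inv M) ≫ D.invFix φ) ▷ D.map M ⊗≫
        𝟙 _ := by bicategory
    _ = 𝟙 _ ⊗≫ (e ≫ D.map (D.e a)) ◁ (D.unit M).inv ▷ D.map M ⊗≫
        (D.θ a).hom ▷ D.map M ⊗≫ 𝟙 _ := by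
      rw [hz]
      bicategory
    _ = 𝟙 _ ⊗≫ (e ≫ D.map (D.e a)) ◁ D.map M ◁ (D.counit M).hom ⊗≫
        (D.θ a).hom ▷ D.map M ⊗≫ 𝟙 _ := by
      -- A second use of the triangle identity turns the inverse unit back into a counit.
      rw [D.map_whiskerLeft_counit]
      bicategory
    -- An identity written as `S` and `κ` followed by their inverses is inserted: the first two
    -- match the factors placed in front, and the inverse of `S` with θ makes up `cobar`.
    _ = 𝟙 _ ⊗≫ (e ≫ D.map (D.e a)) ◁ D.map M ◁ (D.counit M).hom ⊗≫
        e ◁ (S.hom ≫ ((D.κ M).hom ≫ (D.κ M).inv) ≫ S.inv) ⊗≫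
        (D.θ a).hom ▷ D.map M ⊗≫ 𝟙 _ := by
      rw [Iso.hom_inv_id, Category.id_comp, Iso.hom_inv_id]
      bicategory
    _ = 𝟙 _ ⊗≫ e ◁ ((D.map (D.e a) ≫ D.map M) ◁ (D.counit M).hom ≫
        (S.hom ≫ (D.κ M).hom) ▷ 𝟙 _) ⊗≫ e ◁ ((D.κ M).inv ≫ S.inv) ⊗≫
        (D.θ a).hom ▷ D.map M ⊗≫ 𝟙 _ := by bicategory
    _ = _ := by
      rw [whisker_exchange, cobar]
      simp only [Iso.trans_hom, Iso.symm_hom, whiskerLeftIso_hom, whiskerRightIso_hom]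
      bicategory

/-- Whisker both sides with e and continue with σ. The left side is then computed by the
transposition rule and the right side by `Transposed.invFix`. Both begin with the same invertible
cells, built from σ, the counit of M and `κ`, and what remains is the equation of `involution_iff`.
-/
theorem coherence_iff {σ : M ≫ D.e a ≅ D.map M} {φ : D.e a ≫ D.inv M ≫ M ≅ 𝟙 a}
    (h : D.Transposed σ.hom φ.hom) :
    𝟙 (D.e (D.obj a) ≫ D.inv (D.inv M) ≫ D.inv M ≫ M) ⊗≫
        (D.invNat M).inv ▷ (D.inv M ≫ M) ⊗≫ M ◁ φ.hom ≫ (ρ_ M).hom =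
      𝟙 _ ⊗≫ D.invFix φ ▷ M ≫ (λ_ M).hom ↔ σ.hom ≫ D.bar σ.hom = 𝟙 _ := by
  set e := D.e (D.obj a)
  have h1 : (𝟙 (e ≫ D.inv (D.inv M) ≫ D.inv M ≫ M) ⊗≫
      (D.invNat M).inv ▷ (D.inv M ≫ M) ⊗≫ M ◁ φ.hom ≫ (ρ_ M).hom) ▷ D.e a ≫ σ.hom =
      𝟙 _ ⊗≫ (e ≫ D.inv (D.inv M)) ◁ D.inv M ◁ σ.hom ⊗≫
        (e ≫ D.inv (D.inv M)) ◁ (D.counit M).hom ⊗≫ e ◁ (D.κ M).inv ⊗≫ (D.nat M).inv ≫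
          σ.hom := by
    calc
      _ = 𝟙 _ ⊗≫ (D.invNat M).inv ▷ (D.inv M ≫ M ≫ D.e a) ⊗≫
          M ◁ (φ.hom ▷ D.e a ≫ (λ_ _).hom) ⊗≫ σ.hom := by bicategory
      _ = 𝟙 _ ⊗≫ ((D.invNat M).inv ▷ (D.inv M ≫ M ≫ D.e a) ≫
          (M ≫ D.e a) ◁ (D.inv M ◁ σ.hom ≫ (D.counit M).hom)) ⊗≫ σ.hom := by
        rw [h]
        bicategory
      _ = _ := by
        rw [← whisker_exchange, invNat]
        simp only [Iso.trans_inv, whiskerLeftIso_inv]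
        bicategory
  have h2 : (𝟙 (e ≫ D.inv (D.inv M) ≫ D.inv M ≫ M) ⊗≫ D.invFix φ ▷ M ≫ (λ_ M).hom) ▷ D.e a ≫
      σ.hom = 𝟙 _ ⊗≫ (e ≫ D.inv (D.inv M)) ◁ D.inv M ◁ σ.hom ⊗≫
        (e ≫ D.inv (D.inv M)) ◁ (D.counit M).hom ⊗≫ e ◁ (D.κ M).inv ⊗≫ (D.cobar σ).hom := by
    calc
      _ = 𝟙 _ ⊗≫ (D.invFix φ ▷ (M ≫ D.e a) ≫ 𝟙 _ ◁ σ.hom) ⊗≫ 𝟙 _ := by bicategory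
      _ = 𝟙 _ ⊗≫ (e ≫ D.inv (D.inv M)) ◁ D.inv M ◁ σ.hom ⊗≫ D.invFix φ ▷ D.map M ⊗≫ 𝟙 _ := by
        rw [← whisker_exchange]
        bicategory
      _ = _ := by
        rw [h.invFix]
        bicategory
  rw [involution_iff, ← (isEquiv1 (D.e a)).whiskerRight_inj, ← cancel_mono σ.hom, h1, h2]
  simp only [bicategoricalComp, cancel_epi]

end

end Duality

/-! ### The comparison pseudofunctor and the biequivalence -/

namespace Duality
variable {C : Type u} [Bicategory.{w, v} C] [IsBigroupoid C] (D : Duality C)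

/-- The coherence condition for a fixed point of the action of a duality. -/
def Coherent {a : C} {M : D.obj a ⟶ a} (φ : D.e a ≫ D.inv M ≫ M ≅ 𝟙 a) : Prop :=
  let T := D.action
  (α_ (T.Rapp (T.ρ.obj a)) (T.ρ.map (T.ρ.map M)) (T.ρ.map M ≫ M)).inv ≫
      (T.Rnat M).inv ▷ (T.ρ.map M ≫ M) ≫ (α_ M (T.Rapp a) (T.ρ.map M ≫ M)).hom ≫
      M ◁ φ.hom ≫ (ρ_ M).hom =
    (T.ω a).hom ▷ (T.ρ.map (T.ρ.map M) ≫ T.ρ.map M ≫ M) ≫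
      T.ρ.map (T.Rapp a) ◁ ((α_ _ _ M).inv ≫ (T.ρ.mapComp (T.ρ.map M) M).inv ▷ M) ≫
      (α_ _ _ M).inv ≫
      ((T.ρ.mapComp (T.Rapp a) (T.ρ.map M ≫ M)).inv ≫ T.ρ.map₂ φ.hom ≫ (T.ρ.mapId a).hom) ▷ M ≫
      (λ_ M).hom

theorem coherent_iff {a : C} {M : D.obj a ⟶ a} (φ : D.e a ≫ D.inv M ≫ M ≅ 𝟙 a) : D.Coherent φ ↔
    𝟙 (D.e (D.obj a) ≫ D.inv (D.inv M) ≫ D.inv M ≫ M) ⊗≫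
        (D.invNat M).inv ▷ (D.inv M ≫ M) ⊗≫ M ◁ φ.hom ≫ (ρ_ M).hom =
      𝟙 _ ⊗≫ D.invFix φ ▷ M ≫ (λ_ M).hom := by
  have h1 : (α_ (D.e (D.obj a)) (D.inv (D.inv M)) (D.inv M ≫ M)).inv ≫
      (D.invNat M).inv ▷ (D.inv M ≫ M) ≫ (α_ M (D.e a) (D.inv M ≫ M)).hom ≫
        M ◁ φ.hom ≫ (ρ_ M).hom = 𝟙 (D.e (D.obj a) ≫ D.inv (D.inv M) ≫ D.inv M ≫ M) ⊗≫
        (D.invNat M).inv ▷ (D.inv M ≫ M) ⊗≫ M ◁ φ.hom ≫ (ρ_ M).hom := by bicategory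
  have h2 : (D.invω a).hom ▷ (D.inv (D.inv M) ≫ D.inv M ≫ M) ≫
        D.inv (D.e a) ◁ ((α_ _ _ M).inv ≫ (D.invComp (D.inv M) M).inv ▷ M) ≫ (α_ _ _ M).inv ≫
        ((D.invComp (D.e a) (D.inv M ≫ M)).inv ≫ D.inv₂ φ.hom ≫ (D.invId a).hom) ▷ M ≫
        (λ_ M).hom = 𝟙 _ ⊗≫ D.invFix φ ▷ M ≫ (λ_ M).hom := by
    rw [invFix]
    bicategory
  rw [← h1, ← h2]
  -- The structure cells of the action unfold to `invNat`, `invω`, `invComp` and `invId`.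
  exact Iff.rfl

end Duality

/-- Equal squares on one 1-morphism are related by the identity 2-morphism. This supplies the
constraints of the comparison pseudofunctor from `square_conjId` and `square_comp`. -/
theorem Z2Action.id_compatible {C : Type u} [Bicategory.{w, v} C] (T : Z2Action C) {a b : C}
    {m : T.ρ.obj a ⟶ a} {m' : T.ρ.obj b ⟶ b} {f : a ⟶ b} {s t : m ≫ f ≅ T.ρ.map f ≫ m'}
    (h : s = t) : m ◁ 𝟙 f ≫ t.hom = s.hom ≫ T.ρ.map₂ (𝟙 f) ▷ m' := by
  simp [h]

namespace Stellar
variable {C : Type u} [Bicategory.{w, v} C] [IsBigroupoid C] {D : Duality C}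

/-- The homotopy fixed point datum of a stellar object, the transpose of its involution. -/
noncomputable def fixIso (X : Stellar D) : D.e X.obj ≫ D.inv X.M ≫ X.M ≅ 𝟙 X.obj :=
  (D.exists_transposed X.σ).choose

theorem transposed_fixIso (X : Stellar D) : D.Transposed X.σ.hom X.fixIso.hom :=
  (D.exists_transposed X.σ).choose_spec

/-- The homotopy fixed point of a stellar object. -/
noncomputable def toHFP (X : Stellar D) : HFP D.action where
  F := X.obj
  m := X.M
  invertible := X.invertible
  φ := X.fixIso
  coherence := (D.coherent_iff _).2 ((D.coherence_iff X.transposed_fixIso).2 X.involution)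

/-- The 1-morphism of homotopy fixed points of a stellar 1-morphism. -/
noncomputable def toHFPHom {X Y : Stellar D} (F : X ⟶ Y) : X.toHFP ⟶ Y.toHFP :=
  HFP.Hom.mk (X := X.toHFP) (Y := Y.toHFP) (Hom.N F) (D.square (Hom.φ F))
    ((D.compatible_iff X.transposed_fixIso Y.transposed_fixIso (Hom.φ F)).2 (Hom.hermitian F))

/-- The 2-morphism of homotopy fixed points of a unitary 2-morphism. -/
noncomputable def toHFPHom₂ {X Y : Stellar D} {F G : X ⟶ Y} (η : F ⟶ G) :
    toHFPHom F ⟶ toHFPHom G :=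
  HFP.Hom₂.mk (f := toHFPHom F) (g := toHFPHom G) (Hom₂.ψ η).hom
    ((D.square_conjMap _ _ (Hom₂.ψ η)).2 (Hom₂.unitary η))

/-- The compatibility of `toHFPHom` with identities. -/
noncomputable def toHFPId (X : Stellar D) : toHFPHom (𝟙 X) ≅ 𝟙 X.toHFP :=
  HFP.isoMk (f := toHFPHom (𝟙 X)) (g := HFP.idHom X.toHFP) (Iso.refl (𝟙 X.obj))
    (D.action.id_compatible (f := 𝟙 X.obj) (D.square_conjId X.M))

/-- The compatibility of `toHFPHom` with composition. -/
noncomputable def toHFPComp {X Y Z : Stellar D} (F : X ⟶ Y) (G : Y ⟶ Z) :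
    toHFPHom (F ≫ G) ≅ toHFPHom F ≫ toHFPHom G :=
  HFP.isoMk (f := toHFPHom (F ≫ G)) (g := HFP.compHom (toHFPHom F) (toHFPHom G))
    (Iso.refl (Hom.N F ≫ Hom.N G))
    (D.action.id_compatible (f := Hom.N F ≫ Hom.N G) (D.square_comp (Hom.φ F) (Hom.φ G)))

variable (D) in
/-- The pseudofunctor from the core of the stellar objects to the homotopy fixed points. -/
noncomputable def toHFPFunctor :
    Pseudofunctor (BiCore (Stellar D) fun _ => True) (HFP D.action) where
  obj X := X.obj.toHFP
  map F := toHFPHom F.hom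
  map₂ η := toHFPHom₂ η.iso.hom
  mapId X := toHFPId X.obj
  mapComp F G := toHFPComp F.hom G.hom
  map₂_id _ := rfl
  map₂_comp _ _ := rfl
  -- Since the constraints are identities underneath, this axiom and those that follow reduce to
  -- unit laws in C.
  map₂_whisker_left F G H η := HFP.ext₂ <| by
    change F.hom.N ◁ η.iso.hom.ψ.hom = 𝟙 (F.hom.N ≫ G.hom.N) ≫ F.hom.N ◁ η.iso.hom.ψ.hom ≫
      𝟙 (F.hom.N ≫ H.hom.N)
    simp
  map₂_whisker_right {_ _ _ F G} η H := HFP.ext₂ <| by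
    change η.iso.hom.ψ.hom ▷ H.hom.N = 𝟙 (F.hom.N ≫ H.hom.N) ≫ η.iso.hom.ψ.hom ▷ H.hom.N ≫
      𝟙 (G.hom.N ≫ H.hom.N)
    simp
  map₂_associator {W X Y Z} F G H := HFP.ext₂ <| by
    change (α_ F.hom.N G.hom.N H.hom.N).hom = 𝟙 _ ≫ 𝟙 (F.hom.N ≫ G.hom.N) ▷ H.hom.N ≫
      (α_ F.hom.N G.hom.N H.hom.N).hom ≫ F.hom.N ◁ 𝟙 (G.hom.N ≫ H.hom.N) ≫ 𝟙 _
    simp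
  map₂_left_unitor {X Y} F := HFP.ext₂ <| by
    change (λ_ F.hom.N).hom = 𝟙 _ ≫ 𝟙 (𝟙 X.obj.obj) ▷ F.hom.N ≫ (λ_ F.hom.N).hom
    simp
  map₂_right_unitor {X Y} F := HFP.ext₂ <| by
    change (ρ_ F.hom.N).hom = 𝟙 _ ≫ F.hom.N ◁ 𝟙 (𝟙 Y.obj.obj) ≫ (ρ_ F.hom.N).hom
    simp

/-- Surjectivity holds on the nose: the given φ is a transpose of the σ constructed from it, and
transposes are unique, so the chosen one is φ. -/
theorem exists_toHFP (c : HFP D.action) : ∃ X : Stellar D, X.toHFP = c := by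
  obtain ⟨a, M, hM, φ, h⟩ := c
  obtain ⟨σ, hσ⟩ := D.exists_transposed' φ
  let X : Stellar D := ⟨a, M, hM, σ, (D.coherence_iff hσ).1 ((D.coherent_iff φ).1 h)⟩
  have hφ : X.fixIso = φ := Iso.ext (X.transposed_fixIso.unique D hσ)
  exact ⟨X, by simp only [toHFP, hφ, X]⟩

/-- A fixed point 1-morphism does not carry an invertibility condition, but in a bigroupoid its
underlying 1-morphism is an equivalence anyway. -/
theorem exists_toHFPHom {X Y : Stellar D} (f : X.toHFP ⟶ Y.toHFP) :
    ∃ F : X ⟶ Y, toHFPHom F = f := by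
  obtain ⟨N, s, h⟩ := f
  obtain ⟨φ, rfl⟩ := D.exists_square (N := N) (M := X.M) (M' := Y.M) s
  exact ⟨⟨N, IsBigroupoid.isEquiv1 N, φ,
    (D.compatible_iff X.transposed_fixIso Y.transposed_fixIso φ).1 h⟩, rfl⟩

variable (D) in
theorem isBiequivalence_toHFPFunctor : IsBiequivalence (toHFPFunctor D) := by
  refine ⟨fun X Y => { faithful := ⟨?_⟩, full := ⟨?_⟩, essSurj := ⟨?_⟩ }, fun c => ?_⟩
  · intro F G η ξ h
    exact BiCore.ext₂ (ext₂ (congrArg HFP.Hom₂.Γ h))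
  · intro F G γ
    -- Unitary 2-morphisms are isomorphisms by definition, fixed point 2-morphisms are not;
    -- invertibility comes from the bigroupoid.
    obtain ⟨ψ, hψ⟩ : ∃ ψ : F.hom.N ≅ G.hom.N, ψ.hom = HFP.Hom₂.Γ γ :=
      ⟨@asIso _ _ _ _ _ (IsBigroupoid.isIso (C := C) (HFP.Hom₂.Γ γ)), rfl⟩
    have hγ : X.obj.M ◁ ψ.hom ≫ (D.square G.hom.φ).hom =
        (D.square F.hom.φ).hom ≫ D.inv₂ ψ.hom ▷ Y.obj.M := by
      rw [hψ]
      exact HFP.Hom₂.compatible γ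
    exact ⟨(BiCore.isoMk (isoMk ψ ((D.square_conjMap _ _ ψ).1 hγ))).hom, HFP.ext₂ hψ⟩
  · intro f
    obtain ⟨F, hF⟩ := exists_toHFPHom f
    -- The 1-morphisms of the core must be equivalences, which every stellar 1-morphism is.
    exact ⟨⟨F, Stellar.isEquiv1 F⟩, ⟨eqToIso hF⟩⟩
  · obtain ⟨X, rfl⟩ := exists_toHFP c
    exact ⟨⟨X, trivial⟩, 𝟙 _, .id _⟩

end Stellar

/-- The core of the bicategory of antilinear stellar algebras is biequivalent to the bicategory of
homotopy fixed points for the `ℤ/2`-action `A ↦ Ā^{op}` on finite-dimensional semisimple complex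
superalgebras. -/
theorem mainTheorem4 :
    ∃ F : Pseudofunctor (BiCore (Stellar SAlgFd.duality.{u}) fun _ => True)
        (HFP SAlgFd.duality.{u}.action), IsBiequivalence F :=
  -- `SAlgFd` is a core, hence a bigroupoid, so the general result applies to its duality.
  ⟨_, Stellar.isBiequivalence_toHFPFunctor SAlgFd.duality⟩
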